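/- Let $d\ge1$, $\gamma>0$, $\beta\in\mathbb R$ with $\gamma+\beta\ge0$, $\eta\in[-\beta,\gamma)$ and $k\in(0,\gamma)$ with $\eta<k$. Write $\langle v\rangle=\sqrt{1+|v|^2}$, $F(v)=c_\gamma\langle v\rangle^{-d-\gamma}$ with $c_\gamma=\pi^{-d/2}\,\Gamma(\frac{d+\gamma}2)/\Gamma(\frac\gamma2)$ (so that $\int_{\mathbb R^d}F\,dv=1$), $d\mu=F^{-1}dv$, and $$\Pi_\eta f(x,v)=\frac{\int_{\mathbb R^d}\langle w\rangle^\eta f(x,w)\,dw}{\int_{\mathbb R^d}\langle w\rangle^\eta F(w)\,dw}\,F(v)\,.$$ Let $L$ be one of the following operators, acting on the variable $v$: 1. $L_1f=\nabla_v\cdot\big(F\,\nabla_v(F^{-1}f)\big)$, with $\beta=2$; 2. $L_2f(v)=\int_{\mathbb R^d}b(v,v')\big(f(v')F(v)-f(v)F(v')\big)\,dv'$, where the measurable kernel $b$ is such that the collision frequency $\nu(v)=\int b(v,v')F(v')\,dv'$ is finite, positive, locally bounded, with $\nu(v)\sim|v|^{-\beta}$ as $|v|\to+\infty$; $\int\big(b(v,v')-b(v',v)\big)F(v')\,dv'=0$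 for all $v$; for some $Z>0$, $b(v,v')\ge Z^{-1}\langle v\rangle^{-\beta}\langle v'\rangle^{-\beta}$ for all $v\ne v'$; $\sup_v\langle v\rangle^\beta\int b(v',v)\langle v'\rangle^\ell F(v')\,dv'<\infty$ for all $\ell\in(0,\gamma+\beta)$; and $\iint\frac{b(v',v)^2}{\nu(v')\nu(v)}F(v)F(v')\,dv\,dv'<\infty$; 3. $L_3f=\Delta_v^{\sigma/2}f+\nabla_v\cdot(E\,f)$, where $\sigma\in(0,2)$, $\beta=\sigma-\gamma$, $\Delta_v^{\sigma/2}=-(-\Delta_v)^{\sigma/2}$, and $E$ is a radial vector field of class $C^1$ such that $L_3F=0$. Then there is a constant $\mathcal C>0$, independent of $f$, such that for every real-valued $f\in L^2(\langle v\rangle^k\,dx\,d\mu)$ on $\mathbb R^d\times\mathbb R^d$, $(1-\Pi_\eta)f$ is in $L^2(\langle v\rangle^\eta\,dx\,d\mu)$ and $$\mathcal C\,\|(1-\Pi_\eta)f\|_{L^2(\langle v\rangle^\eta dx\,d\mu)}^{2\frac{k+\beta}{k-\eta}}\;\|f\|_{L^2(\langle v\rangle^k dx\,d\mu)}^{-2\frac{\eta+\beta}{k-\eta}}\le-\iint_{\mathbb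 R^d\times\mathbb R^d}f\,Lf\,dx\,d\mu\,,$$ the left-hand side being $0$ if $f=0$. Here, if $L=L_2$, then $f\,Lf$ is integrable with respect to $dx\,d\mu$. If $L=L_1$ or $L=L_3$, the right-hand side is the quadratic form of $-L$ with values in $(-\infty,+\infty]$: it is the infimum of $\liminf_n\big(-\iint f_n\,Lf_n\,dx\,d\mu\big)$ over all sequences $(f_n)$ that converge to $f$ in $L^2(dx\,d\mu)$ and consist of functions of $L^2(\langle v\rangle^k\,dx\,d\mu)$ which are of class $C^2$ in $v$ and for which $f_n\,Lf_n$ is integrable with respect to $dx\,d\mu$. In particular, the inequality holds with the literal value of $-\iint f\,Lf\,dx\,d\mu$ if $f$ is itself such a function. -/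

import Mathlib

open MeasureTheory Filter Topology

noncomputable section

namespace FatTail

/-- The space `ℝ^d` with its Euclidean norm. -/
abbrev Vec (d : ℕ) := EuclideanSpace ℝ (Fin d)

variable {d : ℕ}

/-- The bracket `⟨v⟩ = √(1 + |v|²)`. -/
def bracket (v : Vec d) : ℝ := Real.sqrt (1 + ‖v‖ ^ 2)

/-- The fat tailed local equilibrium `F(v) = c_γ ⟨v⟩^{-(d+γ)}`, with
`c_γ = π^{-d/2} Γ((d+γ)/2) / Γ(γ/2)`, so that `∫ F dv = 1`. -/
def equilibrium (γ : ℝ) (v : Vec d) : ℝ :=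
  Real.pi ^ (-(d : ℝ) / 2) * Real.Gamma ((d + γ) / 2) / Real.Gamma (γ / 2) *
    bracket v ^ (-((d : ℝ) + γ))

/-- The measure `⟨v⟩^k dx dμ` on pairs `(x, v)`, where `dμ = F⁻¹ dv`. -/
def weightedMeasure (d : ℕ) (γ k : ℝ) : Measure (Vec d × Vec d) :=
  (volume : Measure (Vec d)).prod
    ((volume : Measure (Vec d)).withDensity
      fun v => ENNReal.ofReal (bracket v ^ k / equilibrium γ v))

/-- The norm of `L²(⟨v⟩^k dx dμ)`. It is only used for functions of that space. -/
def weightedNorm (γ k : ℝ) (f : Vec d × Vec d → ℝ) : ℝ :=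
  (eLpNorm f 2 (weightedMeasure d γ k)).toReal

/-- `Π_η f (x, v) = (∫ ⟨w⟩^η f(x,w) dw / ∫ ⟨w⟩^η F(w) dw) F(v)`. -/
def proj (γ η : ℝ) (f : Vec d × Vec d → ℝ) (z : Vec d × Vec d) : ℝ :=
  (∫ w : Vec d, bracket w ^ η * f (z.1, w)) / (∫ w : Vec d, bracket w ^ η * equilibrium γ w) *
    equilibrium γ z.2

/-- The divergence of a vector field on `ℝ^d`. -/
def divergence (X : Vec d → Vec d) (v : Vec d) : ℝ :=
  ∑ i : Fin d, (fderiv ℝ X v (EuclideanSpace.single i 1)) i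

/-- The Fokker-Planck operator `L₁ f = ∇ · (F ∇(F⁻¹ f))`. -/
def fokkerPlanck (γ : ℝ) (f : Vec d → ℝ) (v : Vec d) : ℝ :=
  divergence (fun w => equilibrium γ w • gradient (fun u => f u / equilibrium γ u) w) v

/-- The linear Boltzmann (scattering) operator
`L₂ f (v) = ∫ b(v,v') (f(v') F(v) - f(v) F(v')) dv'`. -/
def scattering (γ : ℝ) (b : Vec d → Vec d → ℝ) (f : Vec d → ℝ) (v : Vec d) : ℝ :=
  ∫ v' : Vec d, b v v' * (f v' * equilibrium γ v - f v * equilibrium γ v')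

/-- The collision frequency `ν(v) = ∫ b(v,v') F(v') dv'`. -/
def collisionFrequency (γ : ℝ) (b : Vec d → Vec d → ℝ) (v : Vec d) : ℝ :=
  ∫ v' : Vec d, b v v' * equilibrium γ v'

/-- The assumptions on the collision kernel `b` of the scattering operator. The lower bound on `b`
is only asked for off the diagonal, so that kernels such as `|v - v'|^{-β}` are not excluded by
the value that they are given on the diagonal. -/
structure IsCollisionKernel (γ β : ℝ) (b : Vec d → Vec d → ℝ) : Prop where
  measurable : Measurable (Function.uncurry b)
  /-- the collision frequency is well defined, positive and locally bounded -/
  frequency_integrable : ∀ v, Integrable (fun v' => b v v' * equilibrium γ v')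
  frequency_pos : ∀ v, 0 < collisionFrequency γ b v
  frequency_locally_bounded : ∀ R : ℝ, ∃ M : ℝ, ∀ v : Vec d, ‖v‖ ≤ R →
    collisionFrequency γ b v ≤ M
  /-- `ν(v) ∼ |v|^{-β}` as `|v| → ∞` -/
  frequency_equivalent : Tendsto (fun v : Vec d => collisionFrequency γ b v / ‖v‖ ^ (-β))
    (Bornology.cobounded (Vec d)) (𝓝 1)
  /-- local mass conservation -/
  mass : ∀ v, ∫ v', (b v v' - b v' v) * equilibrium γ v' = 0
  lower_bound : ∃ Z : ℝ, 0 < Z ∧ ∀ v v', v ≠ v' →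
    1 / Z * bracket v ^ (-β) * bracket v' ^ (-β) ≤ b v v'
  moment_bound : ∀ k : ℝ, 0 < k → k < γ + β → ∃ M : ℝ, ∀ v,
    Integrable (fun v' => b v' v * bracket v' ^ k * equilibrium γ v') ∧
    bracket v ^ β * ∫ v', b v' v * bracket v' ^ k * equilibrium γ v' ≤ M
  square_bound : Integrable (fun p : Vec d × Vec d =>
    b p.2 p.1 ^ 2 / (collisionFrequency γ b p.2 * collisionFrequency γ b p.1) *
      (equilibrium γ p.1 * equilibrium γ p.2))

/-- The fractional Laplacian `Δ^{σ/2} = -(-Δ)^{σ/2}`, as the principal value of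
`C_{d,σ} ∫ (f(v') - f(v)) / |v' - v|^{d+σ} dv'` written in its symmetrized, absolutely convergent
form, where `C_{d,σ} = - 2^σ π^{-d/2} Γ((d+σ)/2) / Γ(-σ/2) > 0`. -/
def fracLaplacian (σ : ℝ) (f : Vec d → ℝ) (v : Vec d) : ℝ :=
  -(2 ^ σ / Real.pi ^ ((d : ℝ) / 2) * (Real.Gamma ((d + σ) / 2) / Real.Gamma (-σ / 2))) / 2 *
    ∫ w : Vec d, (f (v + w) + f (v - w) - 2 * f v) / ‖w‖ ^ ((d : ℝ) + σ)

/-- The fractional Fokker-Planck operator `L₃ f = Δ^{σ/2} f + ∇ · (E f)`. -/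
def fracFokkerPlanck (σ : ℝ) (E : Vec d → Vec d) (f : Vec d → ℝ) (v : Vec d) : ℝ :=
  fracLaplacian σ f v + divergence (fun w => f w • E w) v

/-- `E` is the friction force: a (continuously differentiable) radial vector field for which
`L₃ F = 0`. -/
structure IsFrictionForce (γ σ : ℝ) (E : Vec d → Vec d) : Prop where
  contDiff : ContDiff ℝ 1 E
  radial : ∃ G : ℝ → ℝ, ∀ v, E v = G ‖v‖ • v
  stationary : ∀ v, fracFokkerPlanck σ E (equilibrium γ) v = 0

/-- The integrand `f L f`, where the operator `L` acts on the variable `v` only. -/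
def pairing (L : (Vec d → ℝ) → Vec d → ℝ) (f : Vec d × Vec d → ℝ) (z : Vec d × Vec d) : ℝ :=
  f z * L (fun v => f (z.1, v)) z.2

/-- `- ∬ f L f dx dμ`, for functions `f` such that `f L f` is integrable. -/
def dissipation (γ : ℝ) (L : (Vec d → ℝ) → Vec d → ℝ) (f : Vec d × Vec d → ℝ) : ℝ :=
  -∫ z, pairing L f z ∂(weightedMeasure d γ 0)

/-- The functions of `L²(⟨v⟩^k dx dμ)` for which `- ∬ f L f dx dμ` makes sense literally when `L` is
a (local or fractional) differential operator of order at most two: `f` is `C²` in `v`, so that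
`L f` is defined pointwise, and `f L f` is integrable. -/
structure IsClassical (γ k : ℝ) (L : (Vec d → ℝ) → Vec d → ℝ) (f : Vec d × Vec d → ℝ) :
    Prop where
  memLp : MemLp f 2 (weightedMeasure d γ k)
  contDiff : ∀ x, ContDiff ℝ 2 fun v => f (x, v)
  integrable : Integrable (pairing L f) (weightedMeasure d γ 0)

/-- The quadratic form `- ∬ f L f dx dμ` of an unbounded operator `L`, for an arbitrary `f`: the
lower semicontinuous extension, with respect to convergence in `L²(dx dμ)`, of its literal value on
classical functions. It is `+∞` if `f` is not in the domain of the form. -/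
def extendedDissipation (γ k : ℝ) (L : (Vec d → ℝ) → Vec d → ℝ) (f : Vec d × Vec d → ℝ) : EReal :=
  ⨅ φ : {φ : ℕ → Vec d × Vec d → ℝ // (∀ n, IsClassical γ k L (φ n)) ∧
      Tendsto (fun n => eLpNorm (φ n - f) 2 (weightedMeasure d γ 0)) atTop (𝓝 0)},
    liminf (fun n => ((dissipation γ L (φ.1 n) : ℝ) : EReal)) atTop

/-- On classical functions the extended form is at most the literal `- ∬ f L f dx dμ`, so that a
lower bound on the former is a lower bound on the latter. -/
theorem extendedDissipation_le {γ k : ℝ} {L : (Vec d → ℝ) → Vec d → ℝ}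
    {f : Vec d × Vec d → ℝ} (hf : IsClassical γ k L f) :
    extendedDissipation γ k L f ≤ ((dissipation γ L f : ℝ) : EReal) := by
  refine (iInf_le _ ⟨fun _ => f, fun _ => hf, by simp⟩).trans ?_
  simp

end FatTail

end

open FatTail

/-! Write g = f/F and measure f by the nonlocal energies E_s(f) = ∭ ⟨v⟩^s ⟨v'⟩^s F(v) F(v') (g(x,v)
- g(x,v'))² dx dv dv' (`energy`). Put W_s = ∫ ⟨v⟩^s F dv, finite for s < γ. Since Π_η replaces g by
its mean with respect to ⟨v⟩^η F, Jensen's inequality in v' gives W_η ‖(1-Π_η)f‖_η² ≤ E_η(f)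
(`mul_normSq_sub_proj_le`), while (a-b)² ≤ 2a² + 2b² gives E_k(f) ≤ 4 W_k ‖f‖_k²
(`energy_le_normSq`). The integrand of E_s is log-affine in s, so Hölder's inequality gives E_η ≤
E_{-β}^θ E_k^{1-θ} with θ = (k-η)/(k+β) (`energy_interpolation`). Raised to the power 1/θ, this is
the claim with E_{-β}(f) in place of the dissipation (`interpolated_coercivity`). What remains, for
each operator, is the inequality E_{-β}(f) ≤ -C ∬ f Lf dx dμ.

Scattering: mass conservation turns the dissipation into ½ ∭ b F F' (g-g')², and the lower bound on
b concludes (`scattering_coercivity_aux`).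

For the two differential operators the inequality is proved for C² functions of v, integrated in x
(`classical_of_slices`), and carried to the relaxed quadratic form by Fatou's lemma
(`le_extendedDissipation`). Integrability of f Lf alone does not justify integrating by parts over
the whole space, so the identities are tested against cut-offs, with an error that vanishes in the
limit (`nonneg_and_lintegral_le_of_localized`).

Fokker-Planck: the dissipation controls ∫ F|∇g|², and E_{-2} ≤ C ∫ F|∇g|² follows by writing g(v) -
g(v') as an integral along the segment; the decay of F absorbs the Jacobian of the change of
variables uniformly along the segment (`lintegral_segment_le`).

Fractional Fokker-Planck: with h = u²/F, the product rule and L₃F = 0 give g L₃u = -e + ½ L₃h, where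
e is a nonnegative nonlocal square (`slicePairing_fracFokkerPlanck`). In e, restricting one velocity
to the unit ball leaves a kernel of size ⟨v⟩^{-β} F(v), which bounds E_{-β}
(`exists_pairEnergy_le_fracEnergy`). The remaining term ∫ χ_R L₃h must have a nonpositive upper
limit. Its drift part has a favourable sign unless E points outwards, so only an upper bound on the
radial profile of E is needed. It comes from integrating L₃F = 0 radially and excluding a persistent
outward flux at infinity (`exists_frictionForce_bound`). -/

namespace FatTail

variable {d : ℕ}

/-! ### The bracket, the equilibrium and the weights ⟨v⟩^s F -/

theorem one_le_bracket (v : Vec d) : 1 ≤ bracket v := by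
  rw [bracket, Real.one_le_sqrt]
  nlinarith [sq_nonneg ‖v‖]

theorem bracket_pos (v : Vec d) : 0 < bracket v := one_pos.trans_le (one_le_bracket v)

theorem bracket_sq (v : Vec d) : bracket v ^ 2 = 1 + ‖v‖ ^ 2 :=
  Real.sq_sqrt (by positivity)

theorem norm_le_bracket (v : Vec d) : ‖v‖ ≤ bracket v :=
  Real.le_sqrt_of_sq_le (by linarith)

theorem contDiff_bracket {n : WithTop ℕ∞} : ContDiff ℝ n (bracket : Vec d → ℝ) :=
  (contDiff_const.add (contDiff_norm_sq ℝ)).sqrt fun v => by positivity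

theorem contDiff_bracket_rpow (s : ℝ) {n : WithTop ℕ∞} :
    ContDiff ℝ n (fun v : Vec d => bracket v ^ s) :=
  contDiff_bracket.rpow_const_of_ne fun v => (bracket_pos v).ne'

theorem bracket_rpow_pos (s : ℝ) (v : Vec d) : 0 < bracket v ^ s :=
  Real.rpow_pos_of_pos (bracket_pos v) s

theorem bracket_rpow_eq (s : ℝ) (v : Vec d) : bracket v ^ s = (1 + ‖v‖ ^ 2) ^ (s / 2) := by
  rw [bracket, Real.sqrt_eq_rpow, ← Real.rpow_mul (by positivity)]
  congr 1; ring

/-- The normalization constant `c_γ` of the equilibrium. -/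
noncomputable def normalization (d : ℕ) (γ : ℝ) : ℝ :=
  Real.pi ^ (-(d : ℝ) / 2) * Real.Gamma ((d + γ) / 2) / Real.Gamma (γ / 2)

theorem normalization_pos {γ : ℝ} (hγ : 0 < γ) : 0 < normalization d γ := by
  have h1 : 0 < Real.Gamma ((d + γ) / 2) := Real.Gamma_pos_of_pos (by positivity)
  have h2 : 0 < Real.Gamma (γ / 2) := Real.Gamma_pos_of_pos (by positivity)
  have := Real.pi_pos
  unfold normalization
  positivity

theorem equilibrium_eq (γ : ℝ) (v : Vec d) :
    equilibrium γ v = normalization d γ * bracket v ^ (-((d : ℝ) + γ)) := rfl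

theorem equilibrium_pos {γ : ℝ} (hγ : 0 < γ) (v : Vec d) : 0 < equilibrium γ v :=
  mul_pos (normalization_pos hγ) (bracket_rpow_pos _ v)

theorem contDiff_equilibrium (γ : ℝ) {n : WithTop ℕ∞} :
    ContDiff ℝ n (equilibrium γ : Vec d → ℝ) :=
  contDiff_const.mul (contDiff_bracket_rpow _)

theorem continuous_equilibrium (γ : ℝ) : Continuous (equilibrium γ : Vec d → ℝ) :=
  (contDiff_equilibrium (n := 0) γ).continuous

theorem continuous_bracket_rpow (s : ℝ) : Continuous (fun v : Vec d => bracket v ^ s) :=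
  (contDiff_bracket_rpow (n := 0) s).continuous

/-- The weight `⟨v⟩^s F(v)`. -/
noncomputable def weight (γ s : ℝ) (v : Vec d) : ℝ := bracket v ^ s * equilibrium γ v

theorem weight_pos {γ : ℝ} (hγ : 0 < γ) (s : ℝ) (v : Vec d) : 0 < weight γ s v :=
  mul_pos (bracket_rpow_pos s v) (equilibrium_pos hγ v)

theorem continuous_weight (γ s : ℝ) : Continuous (weight γ s : Vec d → ℝ) :=
  (continuous_bracket_rpow s).mul (continuous_equilibrium γ)

theorem weight_zero (γ : ℝ) (v : Vec d) : weight γ 0 v = equilibrium γ v := by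
  simp [weight]

theorem weight_eq (γ s : ℝ) (v : Vec d) :
    weight γ s v = normalization d γ * bracket v ^ (s - ((d : ℝ) + γ)) := by
  rw [weight, equilibrium_eq, sub_eq_add_neg, Real.rpow_add (bracket_pos v)]
  ring

theorem weight_mono {γ : ℝ} (hγ : 0 < γ) {s t : ℝ} (h : s ≤ t) (v : Vec d) :
    weight γ s v ≤ weight γ t v :=
  mul_le_mul_of_nonneg_right (Real.rpow_le_rpow_of_exponent_le (one_le_bracket v) h)
    (equilibrium_pos hγ v).le

theorem integrable_weight {γ s : ℝ} (h : s < γ) : Integrable (weight γ s : Vec d → ℝ) := by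
  have h1 : Integrable (fun v : Vec d => (1 + ‖v‖ ^ 2) ^ (-((d : ℝ) + γ - s) / 2)) :=
    integrable_rpow_neg_one_add_norm_sq (by simp; linarith)
  refine (h1.const_mul (normalization d γ)).congr (.of_forall fun v => ?_)
  simp only [weight_eq, bracket_rpow_eq]
  ring_nf

theorem integral_weight_pos {γ s : ℝ} (hγ : 0 < γ) (h : s < γ) :
    0 < ∫ v : Vec d, weight γ s v := by
  rw [integral_pos_iff_support_of_nonneg (fun v => (weight_pos hγ s v).le) (integrable_weight h)]
  have : Function.support (weight γ s : Vec d → ℝ) = Set.univ :=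
    Set.eq_univ_of_forall fun v => (weight_pos hγ s v).ne'
  rw [this]
  exact Measure.measure_univ_pos.mpr (NeZero.ne _)

theorem integrable_equilibrium {γ : ℝ} (hγ : 0 < γ) : Integrable (equilibrium γ : Vec d → ℝ) :=
  (integrable_weight hγ).congr (.of_forall fun v => weight_zero γ v)

/-! ### Weighted L² norms as Lebesgue integrals -/

theorem weightedMeasure_eq {γ s : ℝ} :
    weightedMeasure d γ s = (volume : Measure (Vec d × Vec d)).withDensity
      fun z => ENNReal.ofReal (bracket z.2 ^ s / equilibrium γ z.2) := by
  rw [weightedMeasure, prod_withDensity_right]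
  · rfl
  · exact ((continuous_bracket_rpow s).measurable.div
      (continuous_equilibrium γ).measurable).ennreal_ofReal

theorem measurable_density (γ s : ℝ) : Measurable fun z : Vec d × Vec d =>
    bracket z.2 ^ s / equilibrium γ z.2 :=
  ((continuous_bracket_rpow s).measurable.comp measurable_snd).div
      ((continuous_equilibrium γ).measurable.comp measurable_snd)

theorem density_pos {γ : ℝ} (hγ : 0 < γ) (s : ℝ) (v : Vec d) :
    0 < bracket v ^ s / equilibrium γ v := div_pos (bracket_rpow_pos s v) (equilibrium_pos hγ v)

/-- The density is everywhere positive, so every weighted measure has the null sets of Lebesgue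
measure. Measurability and almost everywhere convergence therefore do not depend on the weight. -/
theorem ae_weightedMeasure_iff {γ s : ℝ} (hγ : 0 < γ) {p : Vec d × Vec d → Prop} :
    (∀ᵐ z ∂(weightedMeasure d γ s), p z) ↔ ∀ᵐ z, p z := by
  rw [weightedMeasure_eq, ae_withDensity_iff (measurable_density γ s).ennreal_ofReal]
  refine eventually_congr (.of_forall fun z => ?_)
  have : ENNReal.ofReal (bracket z.2 ^ s / equilibrium γ z.2) ≠ 0 := by
    simpa using density_pos hγ s z.2
  simp [this]

theorem aestronglyMeasurable_weightedMeasure_iff {γ s : ℝ} (hγ : 0 < γ) {f : Vec d × Vec d → ℝ} :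
    AEStronglyMeasurable f (weightedMeasure d γ s) ↔ AEStronglyMeasurable f := by
  constructor <;> rintro ⟨g, hg, h⟩ <;> refine ⟨g, hg, ?_⟩
  · exact (ae_weightedMeasure_iff hγ).1 h
  · exact (ae_weightedMeasure_iff hγ).2 h

theorem integral_weightedMeasure {γ s : ℝ} (hγ : 0 < γ) (f : Vec d × Vec d → ℝ) :
    ∫ z, f z ∂(weightedMeasure d γ s) = ∫ z, bracket z.2 ^ s / equilibrium γ z.2 * f z := by
  rw [weightedMeasure_eq, integral_withDensity_eq_integral_toReal_smul
    (measurable_density γ s).ennreal_ofReal (by simp)]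
  refine integral_congr_ae (.of_forall fun z => ?_)
  simp [ENNReal.toReal_ofReal (density_pos hγ s z.2).le]

theorem integrable_weightedMeasure_iff {γ s : ℝ} (hγ : 0 < γ) {f : Vec d × Vec d → ℝ} :
    Integrable f (weightedMeasure d γ s) ↔
      Integrable fun z => bracket z.2 ^ s / equilibrium γ z.2 * f z := by
  rw [weightedMeasure_eq, integrable_withDensity_iff_integrable_smul'
    (measurable_density γ s).ennreal_ofReal (by simp)]
  refine integrable_congr (.of_forall fun z => ?_)
  simp [ENNReal.toReal_ofReal (density_pos hγ s z.2).le]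

/-- The square of the norm of `L²(⟨v⟩^s dx dμ)`, as an extended nonnegative number. -/
noncomputable def normSq (γ s : ℝ) (f : Vec d × Vec d → ℝ) : ENNReal :=
  ∫⁻ z, ENNReal.ofReal (bracket z.2 ^ s / equilibrium γ z.2 * f z ^ 2)

theorem eLpNorm_sq {γ s : ℝ} (hγ : 0 < γ) (f : Vec d × Vec d → ℝ) :
    eLpNorm f 2 (weightedMeasure d γ s) ^ 2 = normSq γ s f := by
  rw [eLpNorm_eq_lintegral_rpow_enorm_toReal two_ne_zero ENNReal.ofNat_ne_top,
    ← ENNReal.rpow_natCast, ← ENNReal.rpow_mul]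
  norm_num
  rw [weightedMeasure_eq, lintegral_withDensity_eq_lintegral_mul_non_measurable _
    (measurable_density γ s).ennreal_ofReal (by simp), normSq]
  refine lintegral_congr fun z => ?_
  rw [Pi.mul_apply, ENNReal.ofReal_mul (density_pos hγ s z.2).le,
    ← Real.enorm_of_nonneg (sq_nonneg _), enorm_pow]

theorem memLp_weightedMeasure_iff {γ s : ℝ} (hγ : 0 < γ) {f : Vec d × Vec d → ℝ} :
    MemLp f 2 (weightedMeasure d γ s) ↔ AEStronglyMeasurable f ∧ normSq γ s f ≠ ⊤ := by
  rw [MemLp, aestronglyMeasurable_weightedMeasure_iff hγ, ← eLpNorm_sq hγ, lt_top_iff_ne_top]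
  simp

theorem weightedNorm_sq {γ s : ℝ} (hγ : 0 < γ) (f : Vec d × Vec d → ℝ) :
    weightedNorm γ s f ^ 2 = (normSq γ s f).toReal := by
  rw [weightedNorm, ← eLpNorm_sq hγ, ENNReal.toReal_pow]

theorem weightedNorm_nonneg (γ s : ℝ) (f : Vec d × Vec d → ℝ) : 0 ≤ weightedNorm γ s f :=
  ENNReal.toReal_nonneg

theorem normSq_mono {γ : ℝ} (hγ : 0 < γ) {s t : ℝ} (h : s ≤ t) (f : Vec d × Vec d → ℝ) :
    normSq γ s f ≤ normSq γ t f := by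
  refine lintegral_mono fun z => ENNReal.ofReal_le_ofReal ?_
  have := equilibrium_pos hγ z.2
  have := Real.rpow_le_rpow_of_exponent_le (one_le_bracket z.2) h
  gcongr

theorem density_mul_sq {γ : ℝ} (hγ : 0 < γ) (s : ℝ) (v : Vec d) (a : ℝ) :
    bracket v ^ s / equilibrium γ v * a ^ 2 = weight γ s v * (a / equilibrium γ v) ^ 2 := by
  have := equilibrium_pos hγ v
  rw [weight]
  field_simp

/-! ### Nonlocal energies and their control by the weighted norm -/

/-- The integrand of the nonlocal energy with kernel `⟨v⟩^s ⟨v'⟩^s F(v) F(v')`. -/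
noncomputable def energyIntegrand (γ s : ℝ) (u : Vec d → ℝ) (q : Vec d × Vec d) : ℝ :=
  weight γ s q.1 * weight γ s q.2 * (u q.1 / equilibrium γ q.1 - u q.2 / equilibrium γ q.2) ^ 2

theorem energyIntegrand_nonneg {γ : ℝ} (hγ : 0 < γ) (s : ℝ) (u : Vec d → ℝ) (q : Vec d × Vec d) :
    0 ≤ energyIntegrand γ s u q :=
  mul_nonneg (mul_pos (weight_pos hγ s _) (weight_pos hγ s _)).le (sq_nonneg _)

/-- The nonlocal energy of a function of `v`. -/
noncomputable def pairEnergy (γ s : ℝ) (u : Vec d → ℝ) : ENNReal :=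
  ∫⁻ q : Vec d × Vec d, ENNReal.ofReal (energyIntegrand γ s u q)

/-- The nonlocal energy of a function of `(x, v)`. -/
noncomputable def energy (γ s : ℝ) (f : Vec d × Vec d → ℝ) : ENNReal :=
  ∫⁻ p : Vec d × (Vec d × Vec d), ENNReal.ofReal (energyIntegrand γ s (fun v => f (p.1, v)) p.2)

theorem quasiMeasurePreserving_left : Measure.QuasiMeasurePreserving
    (fun p : Vec d × (Vec d × Vec d) => (p.1, p.2.1)) :=
  QuasiMeasurePreserving.prodMap (.id _) Measure.quasiMeasurePreserving_fst

theorem quasiMeasurePreserving_right : Measure.QuasiMeasurePreserving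
    (fun p : Vec d × (Vec d × Vec d) => (p.1, p.2.2)) :=
  QuasiMeasurePreserving.prodMap (.id _) Measure.quasiMeasurePreserving_snd

theorem aestronglyMeasurable_energyIntegrand {f : Vec d × Vec d → ℝ} (γ s : ℝ)
    (hf : AEStronglyMeasurable f) : AEStronglyMeasurable
      fun p : Vec d × (Vec d × Vec d) => energyIntegrand γ s (fun v => f (p.1, v)) p.2 := by
  have h1 := hf.comp_quasiMeasurePreserving quasiMeasurePreserving_left
  have h2 := hf.comp_quasiMeasurePreserving quasiMeasurePreserving_right
  have w := (continuous_weight (d := d) γ s).measurable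
  have e := (continuous_equilibrium (d := d) γ).measurable
  have w1 : Measurable fun p : Vec d × (Vec d × Vec d) => weight γ s p.2.1 :=
    w.comp measurable_snd.fst
  have w2 : Measurable fun p : Vec d × (Vec d × Vec d) => weight γ s p.2.2 :=
    w.comp measurable_snd.snd
  have e1 : Measurable fun p : Vec d × (Vec d × Vec d) => equilibrium γ p.2.1 :=
    e.comp measurable_snd.fst
  have e2 : Measurable fun p : Vec d × (Vec d × Vec d) => equilibrium γ p.2.2 :=
    e.comp measurable_snd.snd
  exact ((w1.mul w2).aestronglyMeasurable).mul
    (((h1.div₀ e1.aestronglyMeasurable).sub (h2.div₀ e2.aestronglyMeasurable)).pow 2)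

theorem energy_eq {f : Vec d × Vec d → ℝ} (γ s : ℝ) (hf : AEStronglyMeasurable f) :
    energy γ s f = ∫⁻ x, pairEnergy γ s fun v => f (x, v) :=
  lintegral_prod _ (aestronglyMeasurable_energyIntegrand γ s hf).aemeasurable.ennreal_ofReal

theorem aestronglyMeasurable_energyIntegrand_slice {u : Vec d → ℝ} (γ s : ℝ)
    (hu : AEStronglyMeasurable u) : AEStronglyMeasurable (energyIntegrand γ s u) := by
  have e := (continuous_equilibrium (d := d) γ).measurable
  have w := (continuous_weight (d := d) γ s).measurable
  have h := hu.div₀ e.aestronglyMeasurable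
  exact ((w.comp measurable_fst).mul (w.comp measurable_snd)).aestronglyMeasurable.mul
    ((h.comp_fst.sub h.comp_snd).pow 2)

/-- The square of the weighted norm of a function of `v`. -/
noncomputable def sliceNormSq (γ s : ℝ) (u : Vec d → ℝ) : ENNReal :=
  ∫⁻ v, ENNReal.ofReal (weight γ s v * (u v / equilibrium γ v) ^ 2)

theorem aestronglyMeasurable_sliceNormSq {u : Vec d → ℝ} (γ s : ℝ)
    (hu : AEStronglyMeasurable u) :
    AEStronglyMeasurable fun v => weight γ s v * (u v / equilibrium γ v) ^ 2 :=
  (continuous_weight γ s).aestronglyMeasurable.mul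
    ((hu.div₀ (continuous_equilibrium γ).aestronglyMeasurable).pow 2)

theorem normSq_eq {f : Vec d × Vec d → ℝ} {γ : ℝ} (hγ : 0 < γ) (s : ℝ)
    (hf : AEStronglyMeasurable f) :
    normSq γ s f = ∫⁻ x, sliceNormSq γ s fun v => f (x, v) := by
  rw [normSq, Measure.volume_eq_prod, lintegral_prod]
  · simp only [density_mul_sq hγ]
    rfl
  · exact ((measurable_density γ s).aestronglyMeasurable.mul (hf.pow 2)).aemeasurable.ennreal_ofReal

theorem integrable_of_sliceNormSq {γ s : ℝ} (hγ : 0 < γ) {u : Vec d → ℝ}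
    (hu : AEStronglyMeasurable u) (h : sliceNormSq γ s u ≠ ⊤) :
    Integrable fun v => weight γ s v * (u v / equilibrium γ v) ^ 2 := by
  refine ⟨aestronglyMeasurable_sliceNormSq γ s hu, ?_⟩
  rw [hasFiniteIntegral_iff_ofReal (.of_forall fun v =>
    mul_nonneg (weight_pos hγ s v).le (sq_nonneg _))]
  exact lt_top_iff_ne_top.2 h

theorem lintegral_weight {γ s : ℝ} (hγ : 0 < γ) (h : s < γ) :
    ∫⁻ v : Vec d, ENNReal.ofReal (weight γ s v) = ENNReal.ofReal (∫ v : Vec d, weight γ s v) :=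
  (ofReal_integral_eq_lintegral_ofReal (integrable_weight h)
    (.of_forall fun v => (weight_pos hγ s v).le)).symm

/-- From (a-b)² ≤ 2a² + 2b²: each square is integrated against a product weight whose other factor
has finite mass because s < γ. -/
theorem pairEnergy_le_sliceNormSq {γ s : ℝ} (hγ : 0 < γ) (h : s < γ) {u : Vec d → ℝ}
    (hu : AEStronglyMeasurable u) :
    pairEnergy γ s u ≤ ENNReal.ofReal (4 * ∫ v : Vec d, weight γ s v) * sliceNormSq γ s u := by
  have hw := (continuous_weight (d := d) γ s).measurable.ennreal_ofReal
  have hm := (aestronglyMeasurable_sliceNormSq γ s hu).aemeasurable.ennreal_ofReal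
  have key : ∀ q : Vec d × Vec d, ENNReal.ofReal (energyIntegrand γ s u q) ≤
      2 * (ENNReal.ofReal (weight γ s q.1 * (u q.1 / equilibrium γ q.1) ^ 2) *
        ENNReal.ofReal (weight γ s q.2)) +
      2 * (ENNReal.ofReal (weight γ s q.1) *
        ENNReal.ofReal (weight γ s q.2 * (u q.2 / equilibrium γ q.2) ^ 2)) := by
    intro q
    have w1 := weight_pos hγ s q.1
    have w2 := weight_pos hγ s q.2
    rw [← ENNReal.ofReal_mul (by positivity), ← ENNReal.ofReal_mul (by positivity),
      ← ENNReal.ofReal_ofNat 2, ← ENNReal.ofReal_mul (by positivity),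
      ← ENNReal.ofReal_mul (by positivity), ← ENNReal.ofReal_add (by positivity) (by positivity)]
    refine ENNReal.ofReal_le_ofReal ?_
    rw [energyIntegrand]
    have := mul_pos w1 w2
    nlinarith [mul_nonneg this.le
      (sq_nonneg (u q.1 / equilibrium γ q.1 + u q.2 / equilibrium γ q.2))]
  refine (lintegral_mono key).trans ?_
  have i1 : ∫⁻ q : Vec d × Vec d,
      ENNReal.ofReal (weight γ s q.1 * (u q.1 / equilibrium γ q.1) ^ 2) *
        ENNReal.ofReal (weight γ s q.2) =
      sliceNormSq γ s u * ENNReal.ofReal (∫ v : Vec d, weight γ s v) := by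
    rw [Measure.volume_eq_prod, lintegral_prod_mul hm hw.aemeasurable, lintegral_weight hγ h]
    rfl
  have i2 : ∫⁻ q : Vec d × Vec d, ENNReal.ofReal (weight γ s q.1) *
        ENNReal.ofReal (weight γ s q.2 * (u q.2 / equilibrium γ q.2) ^ 2) =
      ENNReal.ofReal (∫ v : Vec d, weight γ s v) * sliceNormSq γ s u := by
    rw [Measure.volume_eq_prod, lintegral_prod_mul hw.aemeasurable hm, lintegral_weight hγ h]
    rfl
  rw [lintegral_add_left', lintegral_const_mul', lintegral_const_mul', i1, i2,
    ENNReal.ofReal_mul (by norm_num), ENNReal.ofReal_ofNat]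
  · apply le_of_eq; ring
  · simp
  · simp
  · exact ((hm.comp_fst).mul (hw.comp measurable_snd).aemeasurable).const_mul _

theorem energy_le_normSq {γ s : ℝ} (hγ : 0 < γ) (h : s < γ) {f : Vec d × Vec d → ℝ}
    (hf : AEStronglyMeasurable f) :
    energy γ s f ≤ ENNReal.ofReal (4 * ∫ v : Vec d, weight γ s v) * normSq γ s f := by
  rw [energy_eq γ s hf, normSq_eq hγ s hf, ← lintegral_const_mul' _ _ ENNReal.ofReal_ne_top]
  refine lintegral_mono_ae ?_
  filter_upwards [hf.prodMk_left] with x hx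
  exact pairEnergy_le_sliceNormSq hγ h hx

/-! ### Weighted means and the projection Π_η -/

/-- The mean of `u / F` with respect to the weight `⟨v⟩^s F`. -/
noncomputable def weightedMean (γ s : ℝ) (u : Vec d → ℝ) : ℝ :=
  (∫ v, bracket v ^ s * u v) / ∫ v : Vec d, weight γ s v

theorem integrable_bracket_rpow_mul {γ s : ℝ} (hγ : 0 < γ) (h : s < γ) {u : Vec d → ℝ}
    (hu : AEStronglyMeasurable u) (hfin : sliceNormSq γ s u ≠ ⊤) :
    Integrable fun v => bracket v ^ s * u v := by
  refine ((integrable_weight h).add (integrable_of_sliceNormSq hγ hu hfin)).mono'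
    ((continuous_bracket_rpow s).aestronglyMeasurable.mul hu) (.of_forall fun v => ?_)
  have h1 := equilibrium_pos hγ v
  have h2 := bracket_rpow_pos s v
  have h3 : bracket v ^ s * u v = weight γ s v * (u v / equilibrium γ v) := by
    rw [weight]; field_simp
  have h4 := weight_pos hγ s v
  rw [h3, norm_mul, Real.norm_of_nonneg h4.le, Pi.add_apply, ← mul_one_add]
  refine mul_le_mul_of_nonneg_left ?_ h4.le
  rw [Real.norm_eq_abs, ← sq_abs]
  nlinarith [sq_nonneg (|u v / equilibrium γ v| - 1)]

/-- Jensen's inequality for the square. The right-hand integral is a quadratic polynomial in `a`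
whose minimum is at the mean m; subtracting its nonnegative value at m leaves W (a - m)². -/
theorem sq_sub_weightedMean_le {γ s : ℝ} (hγ : 0 < γ) (h : s < γ) {u : Vec d → ℝ}
    (hu : AEStronglyMeasurable u) (hfin : sliceNormSq γ s u ≠ ⊤) (a : ℝ) :
    ENNReal.ofReal ((∫ v : Vec d, weight γ s v) * (a - weightedMean γ s u) ^ 2) ≤
      ∫⁻ v, ENNReal.ofReal (weight γ s v * (a - u v / equilibrium γ v) ^ 2) := by
  have hW := integral_weight_pos (d := d) hγ h
  set W := ∫ v : Vec d, weight γ s v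
  have iw := integrable_weight (d := d) h
  have i1 : Integrable fun v => weight γ s v * (u v / equilibrium γ v) := by
    refine (integrable_bracket_rpow_mul hγ h hu hfin).congr (.of_forall fun v => ?_)
    have h1 := equilibrium_pos hγ v
    simp only [weight]; field_simp
  have i2 := integrable_of_sliceNormSq hγ hu hfin
  set m := weightedMean γ s u with hm
  have e1 : ∫ v, weight γ s v * (u v / equilibrium γ v) = W * m := by
    rw [hm, weightedMean, mul_div_cancel₀ _ hW.ne']
    refine integral_congr_ae (.of_forall fun v => ?_)
    have h1 := equilibrium_pos hγ v
    simp only [weight]; field_simp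
  have exp : ∀ c : ℝ, (fun v => weight γ s v * (c - u v / equilibrium γ v) ^ 2) =
      fun v => c ^ 2 * weight γ s v - 2 * c * (weight γ s v * (u v / equilibrium γ v)) +
        weight γ s v * (u v / equilibrium γ v) ^ 2 := by
    intro c; ext v; ring
  have ii : ∀ c : ℝ, Integrable fun v => weight γ s v * (c - u v / equilibrium γ v) ^ 2 := by
    intro c
    rw [exp]
    exact ((iw.const_mul _).sub (i1.const_mul _)).add i2
  have val : ∀ c : ℝ, ∫ v, weight γ s v * (c - u v / equilibrium γ v) ^ 2 =
      c ^ 2 * W - 2 * c * (W * m) + ∫ v, weight γ s v * (u v / equilibrium γ v) ^ 2 := by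
    intro c
    rw [exp, integral_add _ i2, integral_sub (iw.const_mul _) (i1.const_mul _),
      integral_const_mul, integral_const_mul, e1]
    exact (iw.const_mul _).sub (i1.const_mul _)
  have pos : ∀ c : ℝ, 0 ≤ᵐ[volume] fun v => weight γ s v * (c - u v / equilibrium γ v) ^ 2 :=
    fun c => .of_forall fun v => mul_nonneg (weight_pos hγ s v).le (sq_nonneg _)
  rw [← ofReal_integral_eq_lintegral_ofReal (ii a) (pos a)]
  refine ENNReal.ofReal_le_ofReal ?_
  have := integral_nonneg_of_ae (pos m)
  rw [val] at this ⊢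
  nlinarith

/-- Take a = u(v)/F(v) in `sq_sub_weightedMean_le` and integrate against the weight in v. -/
theorem mul_sliceNormSq_sub_mean_le {γ s : ℝ} (hγ : 0 < γ) (h : s < γ) {u : Vec d → ℝ}
    (hu : AEStronglyMeasurable u) (hfin : sliceNormSq γ s u ≠ ⊤) :
    ENNReal.ofReal (∫ v : Vec d, weight γ s v) *
        sliceNormSq γ s (fun v => u v - weightedMean γ s u * equilibrium γ v) ≤
      pairEnergy γ s u := by
  have hW := integral_weight_pos (d := d) hγ h
  rw [sliceNormSq, ← lintegral_const_mul' _ _ ENNReal.ofReal_ne_top, pairEnergy,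
    Measure.volume_eq_prod, lintegral_prod _
      (aestronglyMeasurable_energyIntegrand_slice γ s hu).aemeasurable.ennreal_ofReal]
  refine lintegral_mono fun v => ?_
  have h1 := equilibrium_pos hγ v
  have h2 := weight_pos hγ s v
  have h3 : (u v - weightedMean γ s u * equilibrium γ v) / equilibrium γ v =
      u v / equilibrium γ v - weightedMean γ s u := by field_simp
  rw [h3, ← ENNReal.ofReal_mul hW.le, mul_left_comm, ENNReal.ofReal_mul h2.le]
  refine (mul_le_mul_right (sq_sub_weightedMean_le hγ h hu hfin _) _).trans_eq ?_
  rw [← lintegral_const_mul' _ _ ENNReal.ofReal_ne_top]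
  refine lintegral_congr fun v' => ?_
  rw [← ENNReal.ofReal_mul h2.le, energyIntegrand, mul_assoc]

theorem ae_sliceNormSq_ne_top {γ s : ℝ} (hγ : 0 < γ) {f : Vec d × Vec d → ℝ}
    (hf : AEStronglyMeasurable f) (hfin : normSq γ s f ≠ ⊤) :
    ∀ᵐ x, sliceNormSq γ s (fun v => f (x, v)) ≠ ⊤ := by
  rw [normSq_eq hγ s hf] at hfin
  have hm : AEMeasurable fun x => sliceNormSq γ s fun v => f (x, v) := by
    have := (((measurable_density γ s).aestronglyMeasurable.mul
      (hf.pow 2)).aemeasurable.ennreal_ofReal).lintegral_prod_right'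
    refine this.congr (.of_forall fun x => lintegral_congr fun v => ?_)
    simp only [Pi.mul_apply, Pi.pow_apply, density_mul_sq hγ]
  filter_upwards [ae_lt_top' hm hfin] with x hx using hx.ne

theorem aestronglyMeasurable_proj (γ s : ℝ) {f : Vec d × Vec d → ℝ}
    (hf : AEStronglyMeasurable f) : AEStronglyMeasurable (proj γ s f) := by
  have h1 : AEStronglyMeasurable fun z : Vec d × Vec d => bracket z.2 ^ s * f z :=
    ((continuous_bracket_rpow s).comp continuous_snd).aestronglyMeasurable.mul hf
  have h2 := h1.integral_prod_right'
  have h3 : AEStronglyMeasurable fun z : Vec d × Vec d =>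
      ∫ w, bracket w ^ s * f (z.1, w) := h2.comp_fst
  exact (h3.div₀ aestronglyMeasurable_const).mul
    ((continuous_equilibrium γ).comp continuous_snd).aestronglyMeasurable

theorem mul_normSq_sub_proj_le {γ s : ℝ} (hγ : 0 < γ) (h : s < γ) {f : Vec d × Vec d → ℝ}
    (hf : AEStronglyMeasurable f) (hfin : normSq γ s f ≠ ⊤) :
    ENNReal.ofReal (∫ v : Vec d, weight γ s v) * normSq γ s (f - proj γ s f) ≤ energy γ s f := by
  rw [energy_eq γ s hf, normSq_eq hγ s (hf.sub (aestronglyMeasurable_proj γ s hf)),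
    ← lintegral_const_mul' _ _ ENNReal.ofReal_ne_top]
  refine lintegral_mono_ae ?_
  filter_upwards [hf.prodMk_left, ae_sliceNormSq_ne_top hγ hf hfin] with x hx hx'
  exact mul_sliceNormSq_sub_mean_le hγ h hx hx'

/-! ### Interpolation between the energies -/

theorem weight_interpolation {γ : ℝ} (hγ : 0 < γ) {r s t θ : ℝ}
    (hs : s = θ * r + (1 - θ) * t) (v : Vec d) :
    weight γ s v = weight γ r v ^ θ * weight γ t v ^ (1 - θ) := by
  have hb := bracket_pos v
  have he := equilibrium_pos hγ v
  rw [weight, weight, weight, Real.mul_rpow (by positivity) he.le,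
    Real.mul_rpow (by positivity) he.le, ← Real.rpow_mul hb.le, ← Real.rpow_mul hb.le,
    mul_mul_mul_comm, ← Real.rpow_add hb, ← Real.rpow_add he, hs]
  ring_nf
  simp

/-- The weights interpolate geometrically while the squared difference does not depend on the
exponent, so the integrand is pointwise the product of the θ and 1-θ powers of the two others.
Hölder's inequality then applies. -/
theorem energy_interpolation {γ : ℝ} (hγ : 0 < γ) {r s t θ : ℝ} (h0 : 0 ≤ θ) (h1 : θ ≤ 1)
    (hs : s = θ * r + (1 - θ) * t) {f : Vec d × Vec d → ℝ} (hf : AEStronglyMeasurable f) :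
    energy γ s f ≤ energy γ r f ^ θ * energy γ t f ^ (1 - θ) := by
  have key : ∀ p : Vec d × (Vec d × Vec d),
      ENNReal.ofReal (energyIntegrand γ s (fun v => f (p.1, v)) p.2) =
      ENNReal.ofReal (energyIntegrand γ r (fun v => f (p.1, v)) p.2) ^ θ *
      ENNReal.ofReal (energyIntegrand γ t (fun v => f (p.1, v)) p.2) ^ (1 - θ) := by
    intro p
    have a1 := weight_pos hγ r p.2.1
    have a2 := weight_pos hγ r p.2.2
    have a3 := weight_pos hγ t p.2.1
    have a4 := weight_pos hγ t p.2.2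
    rw [ENNReal.ofReal_rpow_of_nonneg (energyIntegrand_nonneg hγ _ _ _) h0,
      ENNReal.ofReal_rpow_of_nonneg (energyIntegrand_nonneg hγ _ _ _) (by linarith),
      ← ENNReal.ofReal_mul (Real.rpow_nonneg (energyIntegrand_nonneg hγ _ _ _) _)]
    congr 1
    simp only [energyIntegrand]
    rw [weight_interpolation hγ hs, weight_interpolation hγ hs]
    set c := (f (p.1, p.2.1) / equilibrium γ p.2.1 - f (p.1, p.2.2) / equilibrium γ p.2.2) ^ 2
    have hc : 0 ≤ c := sq_nonneg _
    have hc' : c = c ^ θ * c ^ (1 - θ) := by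
      rw [← Real.rpow_add_of_nonneg hc h0 (by linarith)]; simp
    rw [Real.mul_rpow (by positivity) hc, Real.mul_rpow (by positivity) hc,
      Real.mul_rpow a1.le a2.le, Real.mul_rpow a3.le a4.le]
    nth_rewrite 1 [hc']
    ring
  rw [energy, lintegral_congr key]
  exact ENNReal.lintegral_mul_norm_pow_le
    (aestronglyMeasurable_energyIntegrand γ r hf).aemeasurable.ennreal_ofReal
    (aestronglyMeasurable_energyIntegrand γ t hf).aemeasurable.ennreal_ofReal h0 (by linarith)
    (by ring)

/-- Isolates the part of the argument that does not see the operator: any bound `A` on the energy of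
exponent -β may play the role of the dissipation. -/
theorem interpolated_coercivity {γ β η k : ℝ} (hγ : 0 < γ) (hη : -β ≤ η) (hηγ : η < γ)
    (hkγ : k < γ) (hηk : η < k) :
    ∃ C : ℝ, 0 < C ∧ ∀ f : Vec d × Vec d → ℝ, MemLp f 2 (weightedMeasure d γ k) →
      MemLp (f - proj γ η f) 2 (weightedMeasure d γ η) ∧
      ∀ A : ℝ, 0 ≤ A → energy γ (-β) f ≤ ENNReal.ofReal A →
        C * weightedNorm γ η (f - proj γ η f) ^ (2 * ((k + β) / (k - η))) *
            weightedNorm γ k f ^ (-2 * ((η + β) / (k - η))) ≤ A := by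
  have hW := integral_weight_pos (d := d) hγ hηγ
  have hV := integral_weight_pos (d := d) hγ hkγ
  set W := ∫ v : Vec d, weight γ η v
  set V := 4 * ∫ v : Vec d, weight γ k v with hVdef
  have hV' : 0 < V := by positivity
  have h1 : 0 < k - η := by linarith
  have h2 : 0 < k + β := by linarith
  set θ := (k - η) / (k + β) with hθ
  have hθ0 : 0 < θ := by positivity
  have hθ1 : θ ≤ 1 := by rw [hθ, div_le_one h2]; linarith
  -- This is what remains of W X² ≤ A^θ (V Y²)^{1-θ} (`b5` below) once it is raised to the power 1/θ
  -- and solved for A.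
  refine ⟨W ^ (1 / θ) * V ^ (-((1 - θ) / θ)), by positivity, fun f hf => ?_⟩
  have hf' := hf
  rw [memLp_weightedMeasure_iff hγ] at hf
  obtain ⟨hm, hfin⟩ := hf
  have hfinη : normSq γ η f ≠ ⊤ := ne_top_of_le_ne_top hfin (normSq_mono hγ hηk.le f)
  have b1 := mul_normSq_sub_proj_le hγ hηγ hm hfinη
  have b2 := energy_le_normSq hγ hηγ hm
  have hfin' : normSq γ η (f - proj γ η f) ≠ ⊤ := by
    intro htop
    rw [htop, ENNReal.mul_top (by simpa using hW), top_le_iff] at b1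
    rw [b1, top_le_iff] at b2
    exact ENNReal.mul_ne_top ENNReal.ofReal_ne_top hfinη b2
  refine ⟨(memLp_weightedMeasure_iff hγ).2 ⟨hm.sub (aestronglyMeasurable_proj γ η hm), hfin'⟩,
    fun A hA hE => ?_⟩
  have b3 : energy γ η f ≤ energy γ (-β) f ^ θ * energy γ k f ^ (1 - θ) :=
    energy_interpolation hγ hθ0.le hθ1 (by rw [hθ]; field_simp; ring) hm
  have b4 := energy_le_normSq hγ hkγ hm
  set X := weightedNorm γ η (f - proj γ η f)
  set Y := weightedNorm γ k f
  have hX0 : 0 ≤ X := weightedNorm_nonneg _ _ _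
  have hY0 : 0 ≤ Y := weightedNorm_nonneg _ _ _
  have hX : normSq γ η (f - proj γ η f) = ENNReal.ofReal (X ^ 2) := by
    rw [weightedNorm_sq hγ, ENNReal.ofReal_toReal hfin']
  have hY : normSq γ k f = ENNReal.ofReal (Y ^ 2) := by
    rw [weightedNorm_sq hγ, ENNReal.ofReal_toReal hfin]
  have b5 : W * X ^ 2 ≤ A ^ θ * (V * Y ^ 2) ^ (1 - θ) := by
    have hh := b1.trans (b3.trans (mul_le_mul' (ENNReal.rpow_le_rpow hE hθ0.le)
      (ENNReal.rpow_le_rpow b4 (by linarith : (0 : ℝ) ≤ 1 - θ))))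
    rw [hX, hY, ← ENNReal.ofReal_mul hW.le, ← ENNReal.ofReal_mul hV'.le,
      ENNReal.ofReal_rpow_of_nonneg hA hθ0.le,
      ENNReal.ofReal_rpow_of_nonneg (by positivity) (by linarith),
      ← ENNReal.ofReal_mul (by positivity)] at hh
    exact (ENNReal.ofReal_le_ofReal_iff (by positivity)).1 hh
  have eA : 2 * ((k + β) / (k - η)) = 2 * (1 / θ) := by rw [hθ]; field_simp
  have eB : -2 * ((η + β) / (k - η)) = 2 * (-((1 - θ) / θ)) := by
    rw [hθ]; field_simp; ring
  rw [eA, eB, Real.rpow_mul hX0, Real.rpow_mul hY0, Real.rpow_two, Real.rpow_two]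
  have hθi : 0 < 1 / θ := by positivity
  -- The exponent of Y is nonpositive, so cancelling powers of Y requires Y > 0. If Y = 0, then X =
  -- 0 too, and the positive power of X annihilates the left-hand side.
  rcases hY0.eq_or_lt with hY00 | hYpos
  · have hX00 : X = 0 := by
      have : normSq γ η f = 0 :=
        le_antisymm ((normSq_mono hγ hηk.le f).trans (by rw [hY, ← hY00]; simp)) bot_le
      rw [this, mul_zero] at b2
      have h3 := b1.trans b2
      rw [hX, ← ENNReal.ofReal_mul hW.le, nonpos_iff_eq_zero, ENNReal.ofReal_eq_zero] at h3
      have : X ^ 2 ≤ 0 := nonpos_of_mul_nonpos_right h3 hW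
      nlinarith
    rw [hX00]
    simp [Real.zero_rpow (inv_pos.2 hθ0).ne', hA]
  · have b6 := Real.rpow_le_rpow (by positivity) b5 hθi.le
    rw [Real.mul_rpow hW.le (by positivity), Real.mul_rpow (by positivity) (by positivity),
      ← Real.rpow_mul hA, ← Real.rpow_mul (by positivity), mul_one_div_cancel hθ0.ne',
      Real.rpow_one, mul_one_div, Real.mul_rpow hV'.le (by positivity)] at b6
    have n1 : V ^ (-((1 - θ) / θ)) * V ^ ((1 - θ) / θ) = 1 := by
      rw [← Real.rpow_add hV']; simp
    have n2 : (Y ^ 2) ^ (-((1 - θ) / θ)) * (Y ^ 2) ^ ((1 - θ) / θ) = 1 := by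
      rw [← Real.rpow_add (by positivity)]; simp
    calc W ^ (1 / θ) * V ^ (-((1 - θ) / θ)) * (X ^ 2) ^ (1 / θ) * (Y ^ 2) ^ (-((1 - θ) / θ))
        = W ^ (1 / θ) * (X ^ 2) ^ (1 / θ) *
          (V ^ (-((1 - θ) / θ)) * (Y ^ 2) ^ (-((1 - θ) / θ))) := by ring
      _ ≤ A * (V ^ ((1 - θ) / θ) * (Y ^ 2) ^ ((1 - θ) / θ)) *
          (V ^ (-((1 - θ) / θ)) * (Y ^ 2) ^ (-((1 - θ) / θ))) := by gcongr
      _ = A * (V ^ (-((1 - θ) / θ)) * V ^ ((1 - θ) / θ)) *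
          ((Y ^ 2) ^ (-((1 - θ) / θ)) * (Y ^ 2) ^ ((1 - θ) / θ)) := by ring
      _ = A := by rw [n1, n2]; ring

/-! ### From classical functions to the extended quadratic form -/

/-- Lower semicontinuity of the energy: a subsequence converges almost everywhere in (x,v), hence at
both (x,v) and (x,v') for almost every triple, and Fatou's lemma applies. -/
theorem energy_le_of_tendsto {γ s : ℝ} (hγ : 0 < γ) {f : Vec d × Vec d → ℝ}
    {φ : ℕ → Vec d × Vec d → ℝ} (hf : AEStronglyMeasurable f)
    (hφ : ∀ n, AEStronglyMeasurable (φ n))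
    (hlim : Tendsto (fun n => eLpNorm (φ n - f) 2 (weightedMeasure d γ 0)) atTop (𝓝 0))
    {M : ENNReal} (hM : ∀ n, energy γ s (φ n) ≤ M) : energy γ s f ≤ M := by
  obtain ⟨ns, -, hns⟩ := (tendstoInMeasure_of_tendsto_eLpNorm two_ne_zero
    (fun n => (aestronglyMeasurable_weightedMeasure_iff hγ).2 (hφ n))
    ((aestronglyMeasurable_weightedMeasure_iff hγ).2 hf) hlim).exists_seq_tendsto_ae
  rw [ae_weightedMeasure_iff hγ] at hns
  have h1 := quasiMeasurePreserving_left.ae hns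
  have h2 := quasiMeasurePreserving_right.ae hns
  calc energy γ s f ≤ ∫⁻ p : Vec d × (Vec d × Vec d), liminf (fun n => ENNReal.ofReal
        (energyIntegrand γ s (fun v => φ (ns n) (p.1, v)) p.2)) atTop := by
        refine lintegral_mono_ae ?_
        filter_upwards [h1, h2] with p hp1 hp2
        have : Tendsto (fun n => ENNReal.ofReal
            (energyIntegrand γ s (fun v => φ (ns n) (p.1, v)) p.2)) atTop
            (𝓝 (ENNReal.ofReal (energyIntegrand γ s (fun v => f (p.1, v)) p.2))) :=
          ENNReal.tendsto_ofReal
            ((((hp1.div_const _).sub (hp2.div_const _)).pow 2).const_mul _)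
        exact this.liminf_eq.ge
    _ ≤ liminf (fun n => energy γ s (φ (ns n))) atTop :=
        lintegral_liminf_le' fun n =>
          (aestronglyMeasurable_energyIntegrand γ s (hφ (ns n))).aemeasurable.ennreal_ofReal
    _ ≤ M := by
        refine (liminf_le_liminf (.of_forall fun n => hM (ns n))).trans_eq ?_
        simp

/-- If the lower limit along some competitor were below `B`, a level `A` strictly in between would
bound the dissipation along a subsequence. The energy of the limit is then at most C A, which forces
B ≤ A. Nonnegativity of the classical dissipation makes `A` admissible. -/
theorem le_extendedDissipation {γ k s C : ℝ} (hγ : 0 < γ) (hC : 0 < C)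
    {L : (Vec d → ℝ) → Vec d → ℝ}
    (hL : ∀ φ, IsClassical γ k L φ → 0 ≤ dissipation γ L φ ∧
      energy γ s φ ≤ ENNReal.ofReal (C * dissipation γ L φ))
    {f : Vec d × Vec d → ℝ} (hf : AEStronglyMeasurable f) {B : ℝ}
    (hB : ∀ A : ℝ, 0 ≤ A → energy γ s f ≤ ENNReal.ofReal (C * A) → B ≤ A) :
    (B : EReal) ≤ extendedDissipation γ k L f := by
  refine le_iInf fun φ => ?_
  obtain ⟨φ, hφ, hlim⟩ := φ
  by_contra! hlt
  obtain ⟨A, hA1, hA2⟩ := EReal.lt_iff_exists_real_btwn.1 hlt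
  have hfreq := frequently_lt_of_liminf_lt (by isBoundedDefault) hA1
  obtain ⟨ns, hns, hlt'⟩ := extraction_of_frequently_atTop hfreq
  have hlt'' : ∀ n, dissipation γ L (φ (ns n)) < A := fun n => by exact_mod_cast hlt' n
  have hA0 : 0 ≤ A := (hL _ (hφ (ns 0))).1.trans (hlt'' 0).le
  refine absurd (EReal.coe_lt_coe_iff.1 hA2) (not_lt.2 (hB A hA0 ?_))
  refine energy_le_of_tendsto hγ hf
    (fun n => (aestronglyMeasurable_weightedMeasure_iff hγ).1 (hφ (ns n)).memLp.1)
    (hlim.comp hns.tendsto_atTop) fun n => ?_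
  refine (hL _ (hφ (ns n))).2.trans (ENNReal.ofReal_le_ofReal ?_)
  exact mul_le_mul_of_nonneg_left (hlt'' n).le hC.le

theorem extendedDissipation_coercivity {γ β η k : ℝ} (hγ : 0 < γ) (hη : -β ≤ η) (hηγ : η < γ)
    (hkγ : k < γ) (hηk : η < k) {C : ℝ} (hC : 0 < C) {L : (Vec d → ℝ) → Vec d → ℝ}
    (hL : ∀ φ, IsClassical γ k L φ → 0 ≤ dissipation γ L φ ∧
      energy γ (-β) φ ≤ ENNReal.ofReal (C * dissipation γ L φ)) :
    ∃ C : ℝ, 0 < C ∧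
      ∀ f : Vec d × Vec d → ℝ, MemLp f 2 (weightedMeasure d γ k) →
        MemLp (f - proj γ η f) 2 (weightedMeasure d γ η) ∧
        ((C * weightedNorm γ η (f - proj γ η f) ^ (2 * ((k + β) / (k - η))) *
            weightedNorm γ k f ^ (-2 * ((η + β) / (k - η))) : ℝ) : EReal) ≤
          extendedDissipation γ k L f := by
  obtain ⟨K, hK, hmain⟩ := interpolated_coercivity (d := d) hγ hη hηγ hkγ hηk
  refine ⟨K / C, by positivity, fun f hf => ⟨(hmain f hf).1, ?_⟩⟩
  refine le_extendedDissipation (s := -β) hγ hC hL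
    ((aestronglyMeasurable_weightedMeasure_iff hγ).1 hf.1) fun A hA hE => ?_
  have := (hmain f hf).2 (C * A) (by positivity) hE
  rw [div_mul_eq_mul_div, div_mul_eq_mul_div, div_le_iff₀ hC]
  linarith

/-- The integrand of `∬ f L f dx dμ` with respect to `dv`. -/
noncomputable def slicePairing (γ : ℝ) (L : (Vec d → ℝ) → Vec d → ℝ) (u : Vec d → ℝ) (v : Vec d) :
    ℝ := u v / equilibrium γ v * L u v

/-- The operators act on v only, so Fubini's theorem reduces both conclusions to almost every fixed
x. -/
theorem classical_of_slices {γ k s C : ℝ} (hγ : 0 < γ) {L : (Vec d → ℝ) → Vec d → ℝ}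
    (hL : ∀ u : Vec d → ℝ, ContDiff ℝ 2 u → sliceNormSq γ k u ≠ ⊤ →
      Integrable (slicePairing γ L u) → 0 ≤ -∫ v, slicePairing γ L u v ∧
        pairEnergy γ s u ≤ ENNReal.ofReal (C * -∫ v, slicePairing γ L u v)) (hC : 0 < C)
    (φ : Vec d × Vec d → ℝ) (hφ : IsClassical γ k L φ) : 0 ≤ dissipation γ L φ ∧
      energy γ s φ ≤ ENNReal.ofReal (C * dissipation γ L φ) := by
  obtain ⟨hm, hfin⟩ := (memLp_weightedMeasure_iff hγ).1 hφ.memLp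
  have hint := (integrable_weightedMeasure_iff hγ).1 hφ.integrable
  have hfun : (fun z : Vec d × Vec d => bracket z.2 ^ (0 : ℝ) / equilibrium γ z.2 *
      pairing L φ z) = fun z => slicePairing γ L (fun v => φ (z.1, v)) z.2 := by
    ext z
    simp only [pairing, slicePairing, Real.rpow_zero]
    ring
  rw [hfun, Measure.volume_eq_prod] at hint
  have hslice : ∀ᵐ x, 0 ≤ -∫ v, slicePairing γ L (fun v => φ (x, v)) v ∧
      pairEnergy γ s (fun v => φ (x, v)) ≤
        ENNReal.ofReal (C * -∫ v, slicePairing γ L (fun v => φ (x, v)) v) := by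
    filter_upwards [ae_sliceNormSq_ne_top hγ hm hfin, hint.prod_right_ae] with x h1 h2
    exact hL _ (hφ.contDiff x) h1 h2
  have hdiss : dissipation γ L φ = ∫ x, -∫ v, slicePairing γ L (fun v => φ (x, v)) v := by
    rw [dissipation, integral_weightedMeasure hγ, hfun, Measure.volume_eq_prod,
      integral_prod _ hint, integral_neg]
  have hintx : Integrable fun x => C * -∫ v, slicePairing γ L (fun v => φ (x, v)) v :=
    hint.integral_prod_left.neg.const_mul C
  rw [hdiss]
  constructor
  · exact integral_nonneg_of_ae (hslice.mono fun x hx => hx.1)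
  · rw [energy_eq γ s hm, ← integral_const_mul, ofReal_integral_eq_lintegral_ofReal hintx
      (hslice.mono fun x hx => mul_nonneg hC.le hx.1)]
    exact lintegral_mono_ae (hslice.mono fun x hx => hx.2)

/-! ### The scattering operator -/

namespace IsCollisionKernel

variable {γ β : ℝ} {b : Vec d → Vec d → ℝ}

theorem pos_of_ne (hb : IsCollisionKernel γ β b) {v v' : Vec d} (h : v ≠ v') : 0 < b v v' := by
  obtain ⟨Z, hZ, hlow⟩ := hb.lower_bound
  have h1 := bracket_rpow_pos (-β) v
  have h2 := bracket_rpow_pos (-β) v'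
  exact lt_of_lt_of_le (by positivity) (hlow v v' h)

theorem ae_abs_right (hd : 1 ≤ d) (hb : IsCollisionKernel γ β b) (v : Vec d) :
    ∀ᵐ v', |b v v'| = b v v' := by
  have : Nonempty (Fin d) := ⟨⟨0, hd⟩⟩
  filter_upwards [Measure.ae_ne volume v] with v' hv'
  exact abs_of_pos (hb.pos_of_ne hv'.symm)

theorem ae_abs_left (hd : 1 ≤ d) (hb : IsCollisionKernel γ β b) (v : Vec d) :
    ∀ᵐ v', |b v' v| = b v' v := by
  have : Nonempty (Fin d) := ⟨⟨0, hd⟩⟩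
  filter_upwards [Measure.ae_ne volume v] with v' hv'
  exact abs_of_pos (hb.pos_of_ne hv')

theorem exists_bound (hd : 1 ≤ d) (hγ : 0 < γ) (hγβ : 0 < γ + β) (hb : IsCollisionKernel γ β b) :
    ∃ M : ℝ, ∀ v, Integrable (fun v' => b v' v * equilibrium γ v') ∧
      ∫ v', b v' v * equilibrium γ v' ≤ M * bracket v ^ (-β) := by
  -- Any exponent in (0, γ+β) would do: the factor ⟨v'⟩ to a positive power is at least 1 and is
  -- simply dropped.
  obtain ⟨M, hM⟩ := hb.moment_bound ((γ + β) / 2) (by linarith) (by linarith)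
  refine ⟨M, fun v => ?_⟩
  obtain ⟨h1, h2⟩ := hM v
  have hle : ∀ᵐ v', 0 ≤ b v' v * equilibrium γ v' ∧
      b v' v * equilibrium γ v' ≤ b v' v * bracket v' ^ ((γ + β) / 2) * equilibrium γ v' := by
    filter_upwards [hb.ae_abs_left hd v] with v' hv'
    have hbv : 0 ≤ b v' v := hv' ▸ abs_nonneg _
    have he := equilibrium_pos hγ v'
    refine ⟨by positivity, mul_le_mul_of_nonneg_right ?_ he.le⟩
    exact le_mul_of_one_le_right hbv
      (Real.one_le_rpow (one_le_bracket v') (by linarith))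
  have hint : Integrable (fun v' => b v' v * equilibrium γ v') := by
    refine h1.mono' ?_ (hle.mono fun v' h => by rw [Real.norm_of_nonneg h.1]; exact h.2)
    exact ((hb.measurable.comp (measurable_id.prodMk measurable_const)).mul
      (continuous_equilibrium γ).measurable).aestronglyMeasurable
  refine ⟨hint, ?_⟩
  have h3 := integral_mono_ae hint h1 (hle.mono fun v' h => h.2)
  have hβ := bracket_rpow_pos β v
  rw [Real.rpow_neg (bracket_pos v).le, ← div_eq_mul_inv, le_div_iff₀ hβ, mul_comm]
  exact (mul_le_mul_of_nonneg_left h3 hβ.le).trans h2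

/-- Mass conservation, written for nonnegative integrals: the kernel and its transpose have the same
collision frequency. -/
theorem lintegral_left_eq_right (hd : 1 ≤ d) (hγ : 0 < γ) (hγβ : 0 < γ + β)
    (hb : IsCollisionKernel γ β b) (v : Vec d) :
    ∫⁻ v', ENNReal.ofReal (|b v' v| * equilibrium γ v') =
      ∫⁻ v', ENNReal.ofReal (|b v v'| * equilibrium γ v') := by
  obtain ⟨M, hM⟩ := hb.exists_bound hd hγ hγβ
  have e1 : ∫⁻ v', ENNReal.ofReal (|b v' v| * equilibrium γ v') =
      ENNReal.ofReal (∫ v', b v' v * equilibrium γ v') := by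
    rw [ofReal_integral_eq_lintegral_ofReal (hM v).1]
    · exact lintegral_congr_ae ((hb.ae_abs_left hd v).mono fun v' h => by simp only [h])
    · filter_upwards [hb.ae_abs_left hd v] with v' h
      exact mul_nonneg (h ▸ abs_nonneg _) (equilibrium_pos hγ v').le
  have e2 : ∫⁻ v', ENNReal.ofReal (|b v v'| * equilibrium γ v') =
      ENNReal.ofReal (∫ v', b v v' * equilibrium γ v') := by
    rw [ofReal_integral_eq_lintegral_ofReal (hb.frequency_integrable v)]
    · exact lintegral_congr_ae ((hb.ae_abs_right hd v).mono fun v' h => by simp only [h])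
    · filter_upwards [hb.ae_abs_right hd v] with v' h
      exact mul_nonneg (h ▸ abs_nonneg _) (equilibrium_pos hγ v').le
  have hmass := hb.mass v
  simp only [sub_mul] at hmass
  rw [integral_sub (hb.frequency_integrable v) (hM v).1, sub_eq_zero] at hmass
  rw [e1, e2, hmass]

/-- The moment hypothesis bounds the transposed kernel; mass conservation transfers the bound to the
kernel itself. -/
theorem exists_lintegral_bound (hd : 1 ≤ d) (hγ : 0 < γ) (hγβ : 0 < γ + β)
    (hb : IsCollisionKernel γ β b) : ∃ M : ℝ, 0 ≤ M ∧ ∀ v,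
      ∫⁻ v', ENNReal.ofReal (|b v v'| * equilibrium γ v') ≤
        ENNReal.ofReal (M * bracket v ^ (-β)) := by
  obtain ⟨M, hM⟩ := hb.exists_bound hd hγ hγβ
  refine ⟨|M|, abs_nonneg _, fun v => ?_⟩
  rw [← hb.lintegral_left_eq_right hd hγ hγβ,
    lintegral_congr_ae (g := fun v' => ENNReal.ofReal (b v' v * equilibrium γ v'))
      ((hb.ae_abs_left hd v).mono fun v' h => by simp only [h]),
    ← ofReal_integral_eq_lintegral_ofReal (hM v).1]
  · exact ENNReal.ofReal_le_ofReal ((hM v).2.trans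
      (mul_le_mul_of_nonneg_right (le_abs_self M) (bracket_rpow_pos _ _).le))
  · filter_upwards [hb.ae_abs_left hd v] with v' h
    exact mul_nonneg (h ▸ abs_nonneg _) (equilibrium_pos hγ v').le

theorem measurable_abs (hb : IsCollisionKernel γ β b) :
    Measurable fun q : Vec d × Vec d => |b q.1 q.2| :=
  hb.measurable.abs

end IsCollisionKernel

section Scattering

variable {γ β : ℝ} {b : Vec d → Vec d → ℝ}

/-- The symmetrized collision density `|b(v,v')| F(v) F(v')`. -/
noncomputable def collisionDensity (γ : ℝ) (b : Vec d → Vec d → ℝ) (q : Vec d × Vec d) : ℝ :=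
  |b q.1 q.2| * (equilibrium γ q.1 * equilibrium γ q.2)

/-- The absolute value in the density secures the sign everywhere. It changes b at most on the
diagonal, where the lower bound is not assumed and which is negligible since d ≥ 1. -/
theorem collisionDensity_nonneg (hγ : 0 < γ) (b : Vec d → Vec d → ℝ) (q : Vec d × Vec d) :
    0 ≤ collisionDensity γ b q :=
  mul_nonneg (abs_nonneg _) (mul_pos (equilibrium_pos hγ _) (equilibrium_pos hγ _)).le

theorem measurable_collisionDensity (hb : IsCollisionKernel γ β b) :
    Measurable (collisionDensity γ b) :=
  hb.measurable_abs.mul (((continuous_equilibrium γ).measurable.comp measurable_fst).mul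
    ((continuous_equilibrium γ).measurable.comp measurable_snd))

theorem lintegral_collision_left (hγ : 0 < γ) (hb : IsCollisionKernel γ β b) {u : Vec d → ℝ}
    (hu : AEStronglyMeasurable u) :
    ∫⁻ q, ENNReal.ofReal (collisionDensity γ b q * (u q.1 / equilibrium γ q.1) ^ 2) =
      ∫⁻ v, ENNReal.ofReal (equilibrium γ v * (u v / equilibrium γ v) ^ 2) *
        ∫⁻ v', ENNReal.ofReal (|b v v'| * equilibrium γ v') := by
  have hg := hu.div₀ (continuous_equilibrium (d := d) γ).aestronglyMeasurable
  have hm : AEStronglyMeasurable (fun q : Vec d × Vec d =>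
      collisionDensity γ b q * (u q.1 / equilibrium γ q.1) ^ 2) :=
    (measurable_collisionDensity hb).aestronglyMeasurable.mul (hg.comp_fst.pow 2)
  rw [Measure.volume_eq_prod, lintegral_prod _ hm.aemeasurable.ennreal_ofReal]
  refine lintegral_congr fun v => ?_
  rw [← lintegral_const_mul' _ _ ENNReal.ofReal_ne_top]
  refine lintegral_congr fun v' => ?_
  have := equilibrium_pos hγ v
  rw [← ENNReal.ofReal_mul (by positivity), collisionDensity]
  congr 1; ring

theorem lintegral_collision_right (hγ : 0 < γ) (hb : IsCollisionKernel γ β b) {u : Vec d → ℝ}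
    (hu : AEStronglyMeasurable u) :
    ∫⁻ q, ENNReal.ofReal (collisionDensity γ b q * (u q.2 / equilibrium γ q.2) ^ 2) =
      ∫⁻ v, ENNReal.ofReal (equilibrium γ v * (u v / equilibrium γ v) ^ 2) *
        ∫⁻ v', ENNReal.ofReal (|b v' v| * equilibrium γ v') := by
  have hg := hu.div₀ (continuous_equilibrium (d := d) γ).aestronglyMeasurable
  have hm : AEStronglyMeasurable (fun q : Vec d × Vec d =>
      collisionDensity γ b q * (u q.2 / equilibrium γ q.2) ^ 2) :=
    (measurable_collisionDensity hb).aestronglyMeasurable.mul (hg.comp_snd.pow 2)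
  rw [Measure.volume_eq_prod, lintegral_prod_symm _ hm.aemeasurable.ennreal_ofReal]
  refine lintegral_congr fun v => ?_
  rw [← lintegral_const_mul' _ _ ENNReal.ofReal_ne_top]
  refine lintegral_congr fun v' => ?_
  have := equilibrium_pos hγ v
  rw [← ENNReal.ofReal_mul (by positivity), collisionDensity]
  congr 1; ring

/-- With K = |b| F F', the dissipation is -∭ K (g g' - g²). The integrals of K g² and K g'² are
finite by the frequency bound and equal by mass conservation, so this is ½ ∭ K (g - g')². The lower
bound on b compares K with the kernel of the energy. -/
theorem scattering_coercivity_aux (hd : 1 ≤ d) (hγ : 0 < γ) (hγβ : 0 < γ + β)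
    (hb : IsCollisionKernel γ β b) :
    ∃ C : ℝ, 0 < C ∧ ∀ f : Vec d × Vec d → ℝ, AEStronglyMeasurable f → normSq γ (-β) f ≠ ⊤ →
      Integrable (pairing (scattering γ b) f) (weightedMeasure d γ 0) ∧
      0 ≤ dissipation γ (scattering γ b) f ∧
      energy γ (-β) f ≤ ENNReal.ofReal (C * dissipation γ (scattering γ b) f) := by
  obtain ⟨Z, hZ, hlow⟩ := hb.lower_bound
  obtain ⟨M, hM0, hM⟩ := hb.exists_lintegral_bound hd hγ hγβ
  refine ⟨2 * Z, by positivity, fun f hf hfin => ?_⟩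
  -- the quotient `f / F`, at the two velocities
  let g : Vec d × Vec d → ℝ := fun z => f z / equilibrium γ z.2
  have hg : AEStronglyMeasurable g :=
    hf.div₀ ((continuous_equilibrium γ).comp continuous_snd).aestronglyMeasurable
  have hg1 := hg.comp_quasiMeasurePreserving quasiMeasurePreserving_left
  have hg2 := hg.comp_quasiMeasurePreserving quasiMeasurePreserving_right
  let K : Vec d × (Vec d × Vec d) → ℝ := fun p => collisionDensity γ b p.2
  have hK : AEStronglyMeasurable K :=
    ((measurable_collisionDensity hb).comp measurable_snd).aestronglyMeasurable
  have hK0 : ∀ p, 0 ≤ K p := fun p => collisionDensity_nonneg hγ b p.2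
  have m1 : AEStronglyMeasurable fun p => K p * g (p.1, p.2.1) ^ 2 := hK.mul (hg1.pow 2)
  have m2 : AEStronglyMeasurable fun p => K p * g (p.1, p.2.2) ^ 2 := hK.mul (hg2.pow 2)
  have l1 : ∫⁻ p, ENNReal.ofReal (K p * g (p.1, p.2.1) ^ 2) =
      ∫⁻ x, ∫⁻ v, ENNReal.ofReal (equilibrium γ v * (f (x, v) / equilibrium γ v) ^ 2) *
        ∫⁻ v', ENNReal.ofReal (|b v v'| * equilibrium γ v') := by
    rw [Measure.volume_eq_prod, lintegral_prod _ m1.aemeasurable.ennreal_ofReal]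
    refine lintegral_congr_ae ?_
    filter_upwards [hf.prodMk_left] with x hx
    exact lintegral_collision_left hγ hb hx
  have l2 : ∫⁻ p, ENNReal.ofReal (K p * g (p.1, p.2.2) ^ 2) =
      ∫⁻ x, ∫⁻ v, ENNReal.ofReal (equilibrium γ v * (f (x, v) / equilibrium γ v) ^ 2) *
        ∫⁻ v', ENNReal.ofReal (|b v v'| * equilibrium γ v') := by
    rw [Measure.volume_eq_prod, lintegral_prod _ m2.aemeasurable.ennreal_ofReal]
    refine lintegral_congr_ae ?_
    filter_upwards [hf.prodMk_left] with x hx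
    refine (lintegral_collision_right hγ hb hx).trans (lintegral_congr fun v => ?_)
    rw [hb.lintegral_left_eq_right hd hγ hγβ]
  have l3 : ∫⁻ p, ENNReal.ofReal (K p * g (p.1, p.2.1) ^ 2) < ⊤ := by
    rw [l1]
    refine lt_of_le_of_lt ?_ (ENNReal.mul_lt_top (ENNReal.ofReal_lt_top (r := M))
      (lt_top_iff_ne_top.2 hfin))
    rw [normSq_eq hγ _ hf, ← lintegral_const_mul' _ _ ENNReal.ofReal_ne_top]
    refine lintegral_mono fun x => ?_
    rw [sliceNormSq, ← lintegral_const_mul' _ _ ENNReal.ofReal_ne_top]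
    refine lintegral_mono fun v => (mul_le_mul_right (hM v) _).trans_eq ?_
    have he := equilibrium_pos hγ v
    have hβ := bracket_rpow_pos (-β) v
    rw [← ENNReal.ofReal_mul (by positivity), ← ENNReal.ofReal_mul hM0, weight]
    congr 1; ring
  have i1 : Integrable fun p => K p * g (p.1, p.2.1) ^ 2 := by
    refine ⟨m1, ?_⟩
    rwa [hasFiniteIntegral_iff_ofReal (.of_forall fun p => mul_nonneg (hK0 p) (sq_nonneg _))]
  have i2 : Integrable fun p => K p * g (p.1, p.2.2) ^ 2 := by
    refine ⟨m2, ?_⟩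
    rw [hasFiniteIntegral_iff_ofReal (.of_forall fun p => mul_nonneg (hK0 p) (sq_nonneg _)),
      l2, ← l1]
    exact l3
  have e12 : ∫ p, K p * g (p.1, p.2.1) ^ 2 = ∫ p, K p * g (p.1, p.2.2) ^ 2 := by
    rw [integral_eq_lintegral_of_nonneg_ae (.of_forall fun p => mul_nonneg (hK0 p) (sq_nonneg _))
      m1, integral_eq_lintegral_of_nonneg_ae
      (.of_forall fun p => mul_nonneg (hK0 p) (sq_nonneg _)) m2, l1, l2]
  let S : Vec d × (Vec d × Vec d) → ℝ :=
    fun p => K p * (g (p.1, p.2.1) - g (p.1, p.2.2)) ^ 2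
  let H : Vec d × (Vec d × Vec d) → ℝ :=
    fun p => K p * (g (p.1, p.2.1) * g (p.1, p.2.2) - g (p.1, p.2.1) ^ 2)
  have hS0 : ∀ p, 0 ≤ S p := fun p => mul_nonneg (hK0 p) (sq_nonneg _)
  have iS : Integrable S := by
    refine ((i1.const_mul 2).add (i2.const_mul 2)).mono' (hK.mul ((hg1.sub hg2).pow 2))
      (.of_forall fun p => ?_)
    rw [Real.norm_of_nonneg (hS0 p), Pi.add_apply]
    have := mul_nonneg (hK0 p) (sq_nonneg (g (p.1, p.2.1) + g (p.1, p.2.2)))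
    simp only [S]
    nlinarith
  -- The polarization g g' - g² = ½ g'² - ½ g² - ½ (g - g')²; the first two terms cancel after
  -- integration.
  have hHS : H = fun p => (1 / 2) * (K p * g (p.1, p.2.2) ^ 2) -
      (1 / 2) * (K p * g (p.1, p.2.1) ^ 2) - (1 / 2) * S p := by
    ext p; simp only [H, S]; ring
  have iH : Integrable H := by
    rw [hHS]
    exact ((i2.const_mul _).sub (i1.const_mul _)).sub (iS.const_mul _)
  have vH : ∫ p, H p = -(1 / 2) * ∫ p, S p := by
    have hi : Integrable fun p => 1 / 2 * (K p * g (p.1, p.2.2) ^ 2) -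
      1 / 2 * (K p * g (p.1, p.2.1) ^ 2) := (i2.const_mul _).sub (i1.const_mul _)
    rw [hHS, integral_sub hi (iS.const_mul _),
      integral_sub (i2.const_mul _) (i1.const_mul _), integral_const_mul, integral_const_mul,
      integral_const_mul, e12]
    ring
  -- The pairing is an integral over (x,v) of an integral over v', whereas `H` lives on triples
  -- bracketed as (x, (v, v')).
  have hassoc := (measurePreserving_prodAssoc
    (volume : Measure (Vec d)) (volume : Measure (Vec d)) (volume : Measure (Vec d)))
  have iH' : Integrable (fun q : (Vec d × Vec d) × Vec d => H (q.1.1, (q.1.2, q.2)))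
      ((volume : Measure (Vec d × Vec d)).prod volume) :=
    hassoc.integrable_comp_of_integrable iH
  have hpair : (fun z : Vec d × Vec d => bracket z.2 ^ (0 : ℝ) / equilibrium γ z.2 *
      pairing (scattering γ b) f z) = fun z => ∫ v', H (z.1, (z.2, v')) := by
    ext z
    rw [pairing, scattering, Real.rpow_zero, ← mul_assoc, ← integral_const_mul]
    refine integral_congr_ae ?_
    filter_upwards [hb.ae_abs_right hd z.2] with v' hv'
    have h1 := equilibrium_pos hγ z.2
    have h2 := equilibrium_pos hγ v'
    simp only [H, K, g, collisionDensity, hv']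
    field_simp
  have hdiss : dissipation γ (scattering γ b) f = (1 / 2) * ∫ p, S p := by
    rw [dissipation, integral_weightedMeasure hγ, hpair, ← integral_prod _ iH']
    have := hassoc.integral_comp (MeasurableEquiv.measurableEmbedding _) H
    refine (congrArg Neg.neg (this.trans vH)).trans ?_
    ring
  refine ⟨?_, ?_, ?_⟩
  · rw [integrable_weightedMeasure_iff hγ, hpair]
    exact iH'.integral_prod_left
  · rw [hdiss]
    exact mul_nonneg (by norm_num) (integral_nonneg hS0)
  · rw [hdiss, show 2 * Z * (1 / 2 * ∫ p, S p) = ∫ p, Z * S p by rw [integral_const_mul]; ring,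
      ofReal_integral_eq_lintegral_ofReal (iS.const_mul Z)
      (.of_forall fun p => mul_nonneg hZ.le (hS0 p))]
    refine lintegral_mono_ae ?_
    have hne : ∀ᵐ q : Vec d × Vec d, q.1 ≠ q.2 := by
      have : Nonempty (Fin d) := ⟨⟨0, hd⟩⟩
      rw [Measure.volume_eq_prod, ae_iff]
      simp only [ne_eq, not_not]
      rw [Measure.measure_prod_null (measurableSet_eq_fun measurable_fst measurable_snd)]
      refine .of_forall fun v => ?_
      have : (Prod.mk v ⁻¹' {q : Vec d × Vec d | q.1 = q.2}) = {v} := by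
        ext w; simp [eq_comm]
      change volume (Prod.mk v ⁻¹' {q : Vec d × Vec d | q.1 = q.2}) = 0
      rw [this]; simp
    have hne' := (Measure.quasiMeasurePreserving_snd (μ := (volume : Measure (Vec d)))
      (ν := (volume : Measure (Vec d × Vec d)))).ae hne
    filter_upwards [hne'] with p hp
    refine ENNReal.ofReal_le_ofReal ?_
    have h1 := equilibrium_pos hγ p.2.1
    have h2 := equilibrium_pos hγ p.2.2
    have h3 := (hlow _ _ hp).trans (le_abs_self _)
    have h4 : bracket p.2.1 ^ (-β) * bracket p.2.2 ^ (-β) ≤ Z * |b p.2.1 p.2.2| := by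
      rw [mul_assoc, one_div, inv_mul_le_iff₀ hZ] at h3
      exact h3
    simp only [energyIntegrand, S, K, g, collisionDensity, weight]
    calc _ = (bracket p.2.1 ^ (-β) * bracket p.2.2 ^ (-β)) *
          ((equilibrium γ p.2.1 * equilibrium γ p.2.2) *
          (f (p.1, p.2.1) / equilibrium γ p.2.1 - f (p.1, p.2.2) / equilibrium γ p.2.2) ^ 2) := by
          ring
      _ ≤ (Z * |b p.2.1 p.2.2|) * ((equilibrium γ p.2.1 * equilibrium γ p.2.2) *
          (f (p.1, p.2.1) / equilibrium γ p.2.1 - f (p.1, p.2.2) / equilibrium γ p.2.2) ^ 2) := by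
          gcongr
      _ = _ := by ring

theorem scattering_coercivity {η k : ℝ} (hd : 1 ≤ d) (hγ : 0 < γ) (hη : -β ≤ η)
    (hηγ : η < γ) (hkγ : k < γ) (hηk : η < k) (hb : IsCollisionKernel γ β b) :
    ∃ C : ℝ, 0 < C ∧
      ∀ f : Vec d × Vec d → ℝ, MemLp f 2 (weightedMeasure d γ k) →
        MemLp (f - proj γ η f) 2 (weightedMeasure d γ η) ∧
        Integrable (pairing (scattering γ b) f) (weightedMeasure d γ 0) ∧
        C * weightedNorm γ η (f - proj γ η f) ^ (2 * ((k + β) / (k - η))) *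
            weightedNorm γ k f ^ (-2 * ((η + β) / (k - η))) ≤
          dissipation γ (scattering γ b) f := by
  obtain ⟨K, hK, hmain⟩ := interpolated_coercivity (d := d) hγ hη hηγ hkγ hηk
  obtain ⟨C, hC, hscat⟩ := scattering_coercivity_aux hd hγ (by linarith) hb
  refine ⟨K / C, by positivity, fun f hf => ?_⟩
  obtain ⟨hm, hfin⟩ := (memLp_weightedMeasure_iff hγ).1 hf
  obtain ⟨h1, h2, h3⟩ := hscat f hm
    (ne_top_of_le_ne_top hfin (normSq_mono hγ (hη.trans hηk.le) f))
  refine ⟨(hmain f hf).1, h1, ?_⟩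
  have := (hmain f hf).2 _ (mul_nonneg hC.le h2) h3
  rw [div_mul_eq_mul_div, div_mul_eq_mul_div, div_le_iff₀ hC]
  linarith

end Scattering

/-! ### Divergence theorem, cut-off functions and localization -/

theorem continuous_divergence {X : Vec d → Vec d} (hX : ContDiff ℝ 1 X) :
    Continuous (divergence X) := by
  have h := hX.continuous_fderiv one_ne_zero
  unfold divergence
  fun_prop

theorem divergence_smul {a : Vec d → ℝ} {X : Vec d → Vec d} {v : Vec d}
    (ha : DifferentiableAt ℝ a v) (hX : DifferentiableAt ℝ X v) :
    divergence (fun w => a w • X w) v = a v * divergence X v + fderiv ℝ a v (X v) := by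
  have hsum : X v = ∑ i : Fin d, X v i • EuclideanSpace.single i (1 : ℝ) := by
    simpa using ((EuclideanSpace.basisFun (Fin d) ℝ).sum_repr (X v)).symm
  unfold divergence
  rw [fderiv_fun_smul ha hX]
  conv_rhs => rw [hsum, map_sum]
  rw [Finset.mul_sum, ← Finset.sum_add_distrib]
  refine Finset.sum_congr rfl fun i _ => ?_
  simp [mul_comm]

theorem integral_fderiv_eq_zero {a : Vec d → ℝ} (ha : ContDiff ℝ 1 a) (hc : HasCompactSupport a)
    (w : Vec d) : ∫ v, fderiv ℝ a v w = 0 := by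
  have h1 : Continuous fun v => fderiv ℝ a v w := by
    have := ha.continuous_fderiv one_ne_zero
    fun_prop
  have h2 : HasCompactSupport fun v => fderiv ℝ a v w := hc.fderiv_apply (𝕜 := ℝ) w
  have := integral_mul_fderiv_eq_neg_fderiv_mul_of_integrable (μ := (volume : Measure (Vec d)))
    (f := fun _ => (1 : ℝ)) (g := a) (v := w) (by simp)
    (by simpa using h1.integrable_of_hasCompactSupport h2)
    (by simpa using ha.continuous.integrable_of_hasCompactSupport hc)
    (fun x _ => differentiableAt_const _)
    (fun x _ => ha.differentiable one_ne_zero x)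
  simpa using this

theorem divergence_eq_sum {X : Vec d → Vec d} (hX : Differentiable ℝ X) (v : Vec d) :
    divergence X v = ∑ i : Fin d, fderiv ℝ (fun w => X w i) v (EuclideanSpace.single i 1) := by
  refine Finset.sum_congr rfl fun i _ => ?_
  have : (fun w => X w i) = (EuclideanSpace.proj (𝕜 := ℝ) i : Vec d →L[ℝ] ℝ) ∘ X := rfl
  rw [this, fderiv_comp _ (ContinuousLinearMap.differentiableAt _) (hX v),
    ContinuousLinearMap.fderiv]
  rfl

theorem integral_divergence {X : Vec d → Vec d} (hX : ContDiff ℝ 1 X)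
    (hc : HasCompactSupport X) : ∫ v, divergence X v = 0 := by
  have hi : ∀ i, ContDiff ℝ 1 fun w => X w i := fun i =>
    (EuclideanSpace.proj (𝕜 := ℝ) i : Vec d →L[ℝ] ℝ).contDiff.comp hX
  have hci : ∀ i, HasCompactSupport fun w => X w i := fun i =>
    hc.comp_left (g := fun x : Vec d => x i) rfl
  simp only [divergence_eq_sum (hX.differentiable one_ne_zero)]
  rw [integral_finsetSum]
  · exact Finset.sum_eq_zero fun i _ => integral_fderiv_eq_zero (hi i) (hci i) _
  · intro i _
    refine Continuous.integrable_of_hasCompactSupport ?_ ((hci i).fderiv_apply (𝕜 := ℝ) _)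
    have := (hi i).continuous_fderiv one_ne_zero
    fun_prop

theorem HasCompactSupport.divergence {X : Vec d → Vec d} (hc : HasCompactSupport X) :
    HasCompactSupport (divergence X) := by
  have h := hc.fderiv (𝕜 := ℝ)
  exact h.comp_left (g := fun A : Vec d →L[ℝ] Vec d =>
    ∑ i : Fin d, (A (EuclideanSpace.single i 1)) i) (by simp)

/-- A smooth radially nonincreasing function with values in `[0, 1]`, equal to `1` on the unit ball
and to `0` outside of the ball of radius `2`. -/
noncomputable def bump (v : Vec d) : ℝ := Real.smoothTransition (2 - ‖v‖ ^ 2)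

theorem contDiff_bump {n : ℕ∞} : ContDiff ℝ n (bump : Vec d → ℝ) :=
  Real.smoothTransition.contDiff.comp (contDiff_const.sub (contDiff_norm_sq ℝ))

theorem bump_eq_one {v : Vec d} (h : ‖v‖ ≤ 1) : bump v = 1 :=
  Real.smoothTransition.one_of_one_le (by nlinarith [norm_nonneg v])

theorem bump_eq_zero {v : Vec d} (h : 2 ≤ ‖v‖) : bump v = 0 :=
  Real.smoothTransition.zero_of_nonpos (by nlinarith [norm_nonneg v])

theorem hasCompactSupport_bump : HasCompactSupport (bump : Vec d → ℝ) :=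
  HasCompactSupport.intro (isCompact_closedBall (0 : Vec d) 2) fun v hv => by
    rw [mem_closedBall_zero_iff, not_le] at hv
    exact bump_eq_zero hv.le

/-- The derivative at t = 1 of t ↦ bump(tv), which is nonincreasing for t > 0. This sign later
allows a merely one-sided bound on the friction force. -/
theorem fderiv_bump_self_nonpos (v : Vec d) : fderiv ℝ bump v v ≤ 0 := by
  have hd : DifferentiableAt ℝ (bump : Vec d → ℝ) v :=
    (contDiff_bump (n := 1)).differentiable one_ne_zero v
  have h1 : HasDerivAt (fun t : ℝ => t • v) v 1 := by
    simpa using (hasDerivAt_id (1 : ℝ)).smul_const v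
  have h2 : HasDerivAt (fun t : ℝ => bump (t • v)) (fderiv ℝ bump v v) 1 := by
    have h3 : HasFDerivAt (bump : Vec d → ℝ) (fderiv ℝ bump v) ((1 : ℝ) • v) := by
      simpa using hd.hasFDerivAt
    exact h3.comp_hasDerivAt 1 h1
  have hanti : AntitoneOn (fun t : ℝ => bump (t • v)) (Set.Ioi 0) := by
    intro s hs t ht hst
    refine Real.smoothTransition.monotone ?_
    have : ‖s • v‖ ≤ ‖t • v‖ := by
      rw [norm_smul, norm_smul, Real.norm_of_nonneg (le_of_lt hs), Real.norm_of_nonneg (le_of_lt ht)]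
      gcongr
    have := pow_le_pow_left₀ (norm_nonneg _) this 2
    linarith
  have h4 := h2.hasDerivWithinAt (s := Set.Ioi 0)
  rw [← h4.derivWithin ((isOpen_Ioi.uniqueDiffWithinAt (by simp)))]
  exact hanti.derivWithin_nonpos

/-- The cut-off function at scale `R`. -/
noncomputable def cutoff (R : ℝ) (v : Vec d) : ℝ := bump (R⁻¹ • v)

theorem contDiff_cutoff (R : ℝ) {n : ℕ∞} : ContDiff ℝ n (cutoff R : Vec d → ℝ) :=
  contDiff_bump.comp (contDiff_const_smul _)

theorem continuous_cutoff (R : ℝ) : Continuous (cutoff R : Vec d → ℝ) :=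
  (contDiff_cutoff R (n := 0)).continuous

theorem cutoff_nonneg (R : ℝ) (v : Vec d) : 0 ≤ cutoff R v := Real.smoothTransition.nonneg _

theorem cutoff_le_one (R : ℝ) (v : Vec d) : cutoff R v ≤ 1 := Real.smoothTransition.le_one _

theorem cutoff_eq_one {R : ℝ} (hR : 0 < R) {v : Vec d} (h : ‖v‖ ≤ R) : cutoff R v = 1 := by
  refine bump_eq_one ?_
  rwa [norm_smul, norm_inv, Real.norm_of_nonneg hR.le, inv_mul_le_one₀ hR]

theorem cutoff_eq_zero {R : ℝ} (hR : 0 < R) {v : Vec d} (h : 2 * R ≤ ‖v‖) : cutoff R v = 0 := by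
  refine bump_eq_zero ?_
  rwa [norm_smul, norm_inv, Real.norm_of_nonneg hR.le, le_inv_mul_iff₀ hR, mul_comm]

theorem hasCompactSupport_cutoff {R : ℝ} (hR : 0 < R) :
    HasCompactSupport (cutoff R : Vec d → ℝ) :=
  HasCompactSupport.intro (isCompact_closedBall (0 : Vec d) (2 * R)) fun v hv => by
    rw [mem_closedBall_zero_iff, not_le] at hv
    exact cutoff_eq_zero hR hv.le

theorem fderiv_cutoff (R : ℝ) (v : Vec d) :
    fderiv ℝ (cutoff R) v = R⁻¹ • fderiv ℝ bump (R⁻¹ • v) :=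
  fderiv_comp_smul _

theorem fderiv_cutoff_self (R : ℝ) (v : Vec d) :
    fderiv ℝ (cutoff R) v v = fderiv ℝ bump (R⁻¹ • v) (R⁻¹ • v) := by
  rw [fderiv_cutoff, map_smul]; rfl

theorem fderiv_cutoff_self_nonpos (R : ℝ) (v : Vec d) : fderiv ℝ (cutoff R) v v ≤ 0 := by
  rw [fderiv_cutoff_self]
  exact fderiv_bump_self_nonpos _

theorem exists_fderiv_bump_bound :
    ∃ M : ℝ, 0 < M ∧ ∀ v : Vec d, ‖fderiv ℝ (bump : Vec d → ℝ) v‖ ≤ M := by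
  obtain ⟨M, hM⟩ := ((contDiff_bump (d := d) (n := 1)).continuous_fderiv
    one_ne_zero).bounded_above_of_compact_support (hasCompactSupport_bump.fderiv (𝕜 := ℝ))
  exact ⟨max M 1, by positivity, fun v => (hM v).trans (le_max_left _ _)⟩

theorem exists_fderiv_cutoff_bound : ∃ M : ℝ, 0 < M ∧ ∀ R : ℝ, 0 < R → ∀ v : Vec d,
    ‖fderiv ℝ (cutoff R : Vec d → ℝ) v‖ ≤ M / R := by
  obtain ⟨M, hM0, hM⟩ := exists_fderiv_bump_bound (d := d)
  refine ⟨M, hM0, fun R hR v => ?_⟩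
  rw [fderiv_cutoff, norm_smul, norm_inv, Real.norm_of_nonneg hR.le, div_eq_inv_mul]
  gcongr
  exact hM _

theorem fderiv_cutoff_eq_zero_of_lt {R : ℝ} (hR : 0 < R) {v : Vec d} (h : ‖v‖ < R) :
    fderiv ℝ (cutoff R) v = 0 := by
  have : (cutoff R : Vec d → ℝ) =ᶠ[𝓝 v] fun _ => 1 := by
    filter_upwards [(isOpen_lt continuous_norm continuous_const).mem_nhds h] with w hw
    exact cutoff_eq_one hR (le_of_lt hw)
  rw [this.fderiv_eq]; simp

theorem fderiv_cutoff_eq_zero_of_gt {R : ℝ} (hR : 0 < R) {v : Vec d} (h : 2 * R < ‖v‖) :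
    fderiv ℝ (cutoff R) v = 0 := by
  have : (cutoff R : Vec d → ℝ) =ᶠ[𝓝 v] fun _ => 0 := by
    filter_upwards [(isOpen_lt continuous_const continuous_norm).mem_nhds h] with w hw
    exact cutoff_eq_zero hR (le_of_lt hw)
  rw [this.fderiv_eq]; simp

theorem tendsto_cutoff (v : Vec d) :
    Tendsto (fun n : ℕ => cutoff (n + 1 : ℝ) v) atTop (𝓝 1) := by
  refine tendsto_const_nhds.congr' ?_
  obtain ⟨N, hN⟩ := exists_nat_ge ‖v‖
  filter_upwards [eventually_ge_atTop N] with n hn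
  have : (N : ℝ) ≤ n := by exact_mod_cast hn
  exact (cutoff_eq_one (by positivity) (by linarith)).symm

/-- Removes the cut-offs: dominated convergence for the integrable `P`, Fatou's lemma for the
nonnegative `e`, whose integrability is not known beforehand. -/
theorem nonneg_and_lintegral_le_of_localized {e P : Vec d → ℝ} (he : ∀ v, 0 ≤ e v)
    (hP : Integrable P) {χ : ℕ → Vec d → ℝ} (hχ : ∀ n, Continuous (χ n))
    (hχ0 : ∀ n v, 0 ≤ χ n v) (hχ1 : ∀ n v, χ n v ≤ 1)
    (hlim : ∀ v, Tendsto (fun n => χ n v) atTop (𝓝 1))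
    (hi : ∀ n, Integrable fun v => χ n v * e v) {err : ℕ → ℝ} (herr : Tendsto err atTop (𝓝 0))
    (h : ∀ n, ∫ v, χ n v * e v ≤ (∫ v, χ n v * P v) + err n) :
    0 ≤ ∫ v, P v ∧ ∫⁻ v, ENNReal.ofReal (e v) ≤ ENNReal.ofReal (∫ v, P v) := by
  have hPn : Tendsto (fun n => (∫ v, χ n v * P v) + err n) atTop (𝓝 (∫ v, P v)) := by
    have h1 : Tendsto (fun n => ∫ v, χ n v * P v) atTop (𝓝 (∫ v, P v)) := by
      refine tendsto_integral_of_dominated_convergence (fun v => ‖P v‖)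
        (fun n => (hχ n).aestronglyMeasurable.mul hP.1) hP.norm (fun n => .of_forall fun v => ?_)
        (.of_forall fun v => ?_)
      · rw [norm_mul, Real.norm_of_nonneg (hχ0 n v)]
        exact mul_le_of_le_one_left (norm_nonneg _) (hχ1 n v)
      · simpa using (hlim v).mul_const (P v)
    simpa using h1.add herr
  have hn0 : ∀ n v, 0 ≤ χ n v * e v := fun n v => mul_nonneg (hχ0 n v) (he v)
  refine ⟨ge_of_tendsto' hPn fun n => (integral_nonneg (hn0 n)).trans (h n), ?_⟩
  calc ∫⁻ v, ENNReal.ofReal (e v)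
      ≤ ∫⁻ v, liminf (fun n => ENNReal.ofReal (χ n v * e v)) atTop := by
        refine lintegral_mono fun v => ?_
        have : Tendsto (fun n => ENNReal.ofReal (χ n v * e v)) atTop (𝓝 (ENNReal.ofReal (e v))) :=
          ENNReal.tendsto_ofReal (by simpa using (hlim v).mul_const (e v))
        exact this.liminf_eq.ge
    _ ≤ liminf (fun n => ∫⁻ v, ENNReal.ofReal (χ n v * e v)) atTop :=
        lintegral_liminf_le' fun n => (hi n).1.aemeasurable.ennreal_ofReal
    _ ≤ liminf (fun n => ENNReal.ofReal ((∫ v, χ n v * P v) + err n)) atTop := by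
        refine liminf_le_liminf (.of_forall fun n => ?_)
        rw [← ofReal_integral_eq_lintegral_ofReal (hi n) (.of_forall (hn0 n))]
        exact ENNReal.ofReal_le_ofReal (h n)
    _ = ENNReal.ofReal (∫ v, P v) := (ENNReal.tendsto_ofReal hPn).liminf_eq

/-! ### The Fokker-Planck operator -/

theorem ofReal_mul_lintegral_comp_smul_add (φ : Vec d → ENNReal) {c : ℝ} (hc : 0 < c) (a : Vec d) :
    ENNReal.ofReal (c ^ d) * ∫⁻ v, φ (c • v + a) = ∫⁻ v, φ v := by
  have h1 : ∫⁻ v, φ (c • v + a) = ENNReal.ofReal ((c ^ d)⁻¹) * ∫⁻ v, φ (v + a) := by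
    have hemb : MeasurableEmbedding fun v : Vec d => c • v :=
      (Homeomorph.smulOfNeZero c hc.ne').measurableEmbedding
    have := hemb.lintegral_map (μ := volume) (fun v => φ (v + a))
    have h2 := Measure.map_addHaar_smul (volume : Measure (Vec d)) hc.ne'
    rw [← this, h2, lintegral_smul_measure]
    simp [abs_of_pos, hc]
  rw [h1, lintegral_add_right_eq_self φ a, ← mul_assoc, ← ENNReal.ofReal_mul (by positivity),
    mul_inv_cancel₀ (by positivity), ENNReal.ofReal_one, one_mul]

/-- The bracket is the Euclidean norm of (1, v); the cross term is the Cauchy-Schwarz inequality 1 +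
|v||w| ≤ ⟨v⟩⟨w⟩. -/
theorem bracket_convex (v w : Vec d) {t : ℝ} (h0 : 0 ≤ t) (h1 : t ≤ 1) :
    bracket ((1 - t) • v + t • w) ≤ (1 - t) * bracket v + t * bracket w := by
  have hn : ‖(1 - t) • v + t • w‖ ≤ (1 - t) * ‖v‖ + t * ‖w‖ := by
    refine (norm_add_le _ _).trans_eq ?_
    rw [norm_smul, norm_smul, Real.norm_of_nonneg h0, Real.norm_of_nonneg (sub_nonneg.2 h1)]
  have hvw : 1 + ‖v‖ * ‖w‖ ≤ bracket v * bracket w := by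
    refine abs_le_of_sq_le_sq' ?_ (mul_pos (bracket_pos v) (bracket_pos w)).le |>.2
    rw [mul_pow, bracket_sq, bracket_sq]
    nlinarith [sq_nonneg (‖v‖ - ‖w‖)]
  have hb := bracket_pos v
  have hb' := bracket_pos w
  have h2 : 0 ≤ 1 - t := sub_nonneg.2 h1
  refine abs_le_of_sq_le_sq' ?_ (by positivity) |>.2
  rw [bracket_sq]
  have hsq := pow_le_pow_left₀ (norm_nonneg _) hn 2
  have hprod := mul_le_mul_of_nonneg_left hvw (mul_nonneg h2 h0)
  have e : ((1 - t) * bracket v + t * bracket w) ^ 2 = (1 - t) ^ 2 * (1 + ‖v‖ ^ 2) +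
      t ^ 2 * (1 + ‖w‖ ^ 2) + 2 * ((1 - t) * t * (bracket v * bracket w)) := by
    rw [← bracket_sq, ← bracket_sq]; ring
  rw [e]
  nlinarith

/-- By convexity the bracket of the intermediate point is at most twice the larger of (1-t)⟨v⟩ and
t⟨w⟩. The corresponding factor on the left is traded for that bracket, with a gain (1-t)^a or t^a.
-/
theorem bracket_rpow_neg_mul_le {a : ℝ} (ha : 0 ≤ a) (v w : Vec d) {t : ℝ} (h0 : 0 < t)
    (h1 : t < 1) :
    bracket v ^ (-a) * bracket w ^ (-a) ≤
      2 ^ a * bracket ((1 - t) • v + t • w) ^ (-a) *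
        ((1 - t) ^ a * bracket w ^ (-a) + t ^ a * bracket v ^ (-a)) := by
  have hb := bracket_pos v
  have hb' := bracket_pos w
  have hu := bracket_pos ((1 - t) • v + t • w)
  have h2 : 0 < 1 - t := sub_pos.2 h1
  have key : ∀ (c y : ℝ), 0 < c → 0 < y → bracket ((1 - t) • v + t • w) ≤ 2 * (c * y) →
      y ^ (-a) ≤ 2 ^ a * bracket ((1 - t) • v + t • w) ^ (-a) * c ^ a := by
    intro c y hc hy h
    have := Real.rpow_le_rpow_of_nonpos hu h (neg_nonpos.2 ha)
    rw [Real.mul_rpow (by norm_num) (by positivity), Real.mul_rpow hc.le hy.le,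
      Real.rpow_neg (by norm_num : (0 : ℝ) ≤ 2), Real.rpow_neg hc.le,
      ← mul_assoc, ← mul_inv, inv_mul_le_iff₀ (by positivity)] at this
    linarith
  have hconv := bracket_convex v w h0.le h1.le
  have p1 := bracket_rpow_pos (-a) v
  have p2 := bracket_rpow_pos (-a) w
  have p3 := bracket_rpow_pos (-a) ((1 - t) • v + t • w)
  rcases le_total (t * bracket w) ((1 - t) * bracket v) with h | h
  · have hk := key (1 - t) _ h2 hb (by linarith)
    calc _ ≤ (2 ^ a * bracket ((1 - t) • v + t • w) ^ (-a) * (1 - t) ^ a) *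
          bracket w ^ (-a) := by gcongr
      _ ≤ _ := by
        rw [mul_assoc]
        gcongr
        have := mul_pos (Real.rpow_pos_of_pos h0 a) p1
        linarith
  · have hk := key t _ h0 hb' (by linarith)
    calc _ ≤ bracket v ^ (-a) * (2 ^ a * bracket ((1 - t) • v + t • w) ^ (-a) * t ^ a) := by
          gcongr
      _ = 2 ^ a * bracket ((1 - t) • v + t • w) ^ (-a) * (t ^ a * bracket v ^ (-a)) := by ring
      _ ≤ _ := by
        gcongr
        have := mul_pos (Real.rpow_pos_of_pos h2 a) p2
        linarith

/-- The factors (1-t)^d and t^d are exactly the Jacobians of the maps sending v, respectively w, to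
the intermediate point. This makes the next integral estimate uniform as t tends to 0 or 1. -/
theorem equilibrium_mul_le {γ : ℝ} (hγ : 0 < γ) (v w : Vec d) {t : ℝ} (h0 : 0 < t) (h1 : t < 1) :
    equilibrium γ v * equilibrium γ w ≤ 2 ^ ((d : ℝ) + γ) * equilibrium γ ((1 - t) • v + t • w) *
      ((1 - t) ^ d * equilibrium γ w + t ^ d * equilibrium γ v) := by
  have hc := normalization_pos (d := d) hγ
  have ha : 0 ≤ (d : ℝ) + γ := by positivity
  have h2 : 0 < 1 - t := sub_pos.2 h1
  have hpow : ∀ c : ℝ, 0 < c → c ≤ 1 → c ^ ((d : ℝ) + γ) ≤ c ^ d := by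
    intro c hc hc1
    rw [← Real.rpow_natCast]
    exact Real.rpow_le_rpow_of_exponent_ge hc hc1 (by linarith)
  have p1 := bracket_rpow_pos (-((d : ℝ) + γ)) v
  have p2 := bracket_rpow_pos (-((d : ℝ) + γ)) w
  have p3 := bracket_rpow_pos (-((d : ℝ) + γ)) ((1 - t) • v + t • w)
  simp only [equilibrium_eq]
  calc _ = normalization d γ ^ 2 *
        (bracket v ^ (-((d : ℝ) + γ)) * bracket w ^ (-((d : ℝ) + γ))) := by ring
    _ ≤ normalization d γ ^ 2 *
        (2 ^ ((d : ℝ) + γ) * bracket ((1 - t) • v + t • w) ^ (-((d : ℝ) + γ)) *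
        ((1 - t) ^ ((d : ℝ) + γ) * bracket w ^ (-((d : ℝ) + γ)) +
          t ^ ((d : ℝ) + γ) * bracket v ^ (-((d : ℝ) + γ)))) := by
        exact mul_le_mul_of_nonneg_left (bracket_rpow_neg_mul_le ha v w h0 h1) (by positivity)
    _ ≤ normalization d γ ^ 2 *
        (2 ^ ((d : ℝ) + γ) * bracket ((1 - t) • v + t • w) ^ (-((d : ℝ) + γ)) *
        ((1 - t) ^ d * bracket w ^ (-((d : ℝ) + γ)) +
          t ^ d * bracket v ^ (-((d : ℝ) + γ)))) := by
        have e1 := hpow (1 - t) h2 (by linarith)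
        have e2 := hpow t h0 h1.le
        gcongr
    _ = _ := by ring

theorem weight_mul_dist_sq_le {γ : ℝ} (hγ : 0 < γ) (v w : Vec d) :
    weight γ (-2) v * weight γ (-2) w * ‖w - v‖ ^ 2 ≤ 4 * (equilibrium γ v * equilibrium γ w) := by
  have hb := bracket_pos v
  have hb' := bracket_pos w
  have he := equilibrium_pos hγ v
  have he' := equilibrium_pos hγ w
  have e : ∀ u : Vec d, bracket u ^ (-2 : ℝ) = (bracket u ^ 2)⁻¹ := fun u => by
    rw [Real.rpow_neg (bracket_pos u).le, Real.rpow_two]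
  have hn : ‖w - v‖ ^ 2 ≤ 4 * (bracket v ^ 2 * bracket w ^ 2) := by
    have h1 := pow_le_pow_left₀ (norm_nonneg _) (norm_sub_le w v) 2
    rw [bracket_sq, bracket_sq]
    nlinarith [sq_nonneg (‖v‖ - ‖w‖), mul_nonneg (sq_nonneg ‖v‖) (sq_nonneg ‖w‖)]
  rw [weight, weight, e, e]
  calc _ = (equilibrium γ v * equilibrium γ w) * ((bracket v ^ 2 * bracket w ^ 2)⁻¹ * ‖w - v‖ ^ 2) := by
        rw [mul_inv]; ring
    _ ≤ (equilibrium γ v * equilibrium γ w) * 4 := by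
        gcongr
        rw [inv_mul_le_iff₀ (by positivity)]
        linarith
    _ = _ := by ring

theorem sq_sub_le_lintegral {g : Vec d → ℝ} (hg : ContDiff ℝ 1 g) (v w : Vec d) :
    ENNReal.ofReal ((g v - g w) ^ 2) ≤ ∫⁻ t in Set.Ioo (0 : ℝ) 1,
      ENNReal.ofReal (‖w - v‖ ^ 2 * ‖fderiv ℝ g ((1 - t) • v + t • w)‖ ^ 2) := by
  have hcont := hg.continuous_fderiv one_ne_zero
  let p : ℝ → Vec d := fun t => (1 - t) • v + t • w
  have hp : ∀ t, HasDerivAt p (w - v) t := by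
    intro t
    have h1 : HasDerivAt (fun t : ℝ => (1 - t) • v) ((-1 : ℝ) • v) t :=
      ((hasDerivAt_id t).const_sub 1).smul_const v
    have h2 : HasDerivAt (fun t : ℝ => t • w) ((1 : ℝ) • w) t := (hasDerivAt_id t).smul_const w
    exact (h1.add h2).congr_deriv (by rw [neg_one_smul, one_smul, neg_add_eq_sub])
  have hderiv : ∀ t, HasDerivAt (fun t => g (p t)) (fderiv ℝ g (p t) (w - v)) t := fun t =>
    (hg.differentiable one_ne_zero (p t)).hasFDerivAt.comp_hasDerivAt t (hp t)
  have hpc : Continuous p := by fun_prop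
  have hc' : Continuous fun t => fderiv ℝ g (p t) (w - v) := by fun_prop
  have hftc := intervalIntegral.integral_eq_sub_of_hasDerivAt (a := 0) (b := 1)
    (fun t _ => hderiv t) (hc'.intervalIntegrable _ _)
  have hval : g w - g v = ∫ t in Set.Ioo (0 : ℝ) 1, fderiv ℝ g (p t) (w - v) := by
    rw [← integral_Ioc_eq_integral_Ioo, ← intervalIntegral.integral_of_le zero_le_one, hftc]
    simp [p]
  have hi1 : IntegrableOn (fun t => fderiv ℝ g (p t) (w - v)) (Set.Ioo (0 : ℝ) 1) :=
    (hc'.integrableOn_Icc).mono_set Set.Ioo_subset_Icc_self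
  have hi2 : IntegrableOn (fun t => ‖w - v‖ ^ 2 * ‖fderiv ℝ g (p t)‖ ^ 2) (Set.Ioo (0 : ℝ) 1) := by
    have : Continuous fun t => ‖w - v‖ ^ 2 * ‖fderiv ℝ g (p t)‖ ^ 2 := by fun_prop
    exact this.integrableOn_Icc.mono_set Set.Ioo_subset_Icc_self
  rw [← ofReal_integral_eq_lintegral_ofReal hi2 (.of_forall fun t => by positivity)]
  refine ENNReal.ofReal_le_ofReal ?_
  set m := g w - g v with hm
  -- Jensen's inequality on the unit interval, by integrating 2my - m² ≤ y² for the directional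
  -- derivative y, whose mean is m.
  have hint : ∫ t in Set.Ioo (0 : ℝ) 1, (2 * m * fderiv ℝ g (p t) (w - v) - m ^ 2) ≤
      ∫ t in Set.Ioo (0 : ℝ) 1, ‖w - v‖ ^ 2 * ‖fderiv ℝ g (p t)‖ ^ 2 := by
    refine integral_mono ((hi1.const_mul _).sub (by simp)) hi2 fun t => ?_
    have h1 := (fderiv ℝ g (p t)).le_opNorm (w - v)
    have h2 := pow_le_pow_left₀ (norm_nonneg _) h1 2
    rw [Real.norm_eq_abs, sq_abs] at h2
    simp only
    nlinarith [sq_nonneg (m - fderiv ℝ g (p t) (w - v))]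
  rw [integral_sub (hi1.const_mul _) (by simp), integral_const_mul, ← hval] at hint
  simp at hint
  nlinarith

/-- In each of the two terms of `equilibrium_mul_le`, one velocity is replaced by the intermediate
point at the cost of the Jacobian already present, and the other integrates F. The constant does not
depend on t. -/
theorem lintegral_segment_le {γ : ℝ} (hγ : 0 < γ) {G : Vec d → ℝ} (hG : Continuous G)
    (hG0 : ∀ v, 0 ≤ G v) {t : ℝ} (h0 : 0 < t) (h1 : t < 1) :
    ∫⁻ q : Vec d × Vec d, ENNReal.ofReal
        (equilibrium γ q.1 * equilibrium γ q.2 * G ((1 - t) • q.1 + t • q.2)) ≤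
      ENNReal.ofReal (2 ^ ((d : ℝ) + γ) * 2 * ∫ v : Vec d, equilibrium γ v) *
        ∫⁻ v, ENNReal.ofReal (equilibrium γ v * G v) := by
  have h2 : 0 < 1 - t := sub_pos.2 h1
  have hF := continuous_equilibrium (d := d) γ
  have hFi : ∫⁻ v : Vec d, ENNReal.ofReal (equilibrium γ v) =
      ENNReal.ofReal (∫ v : Vec d, equilibrium γ v) :=
    (ofReal_integral_eq_lintegral_ofReal (integrable_equilibrium hγ)
      (.of_forall fun v => (equilibrium_pos hγ v).le)).symm
  set Φ : Vec d → ENNReal := fun v => ENNReal.ofReal (equilibrium γ v * G v)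
  have hΦ : Measurable Φ := (hF.mul hG).measurable.ennreal_ofReal
  have key : ∀ q : Vec d × Vec d, ENNReal.ofReal
      (equilibrium γ q.1 * equilibrium γ q.2 * G ((1 - t) • q.1 + t • q.2)) ≤
      ENNReal.ofReal (2 ^ ((d : ℝ) + γ)) *
        ((ENNReal.ofReal ((1 - t) ^ d) * (ENNReal.ofReal (equilibrium γ q.2) *
          Φ ((1 - t) • q.1 + t • q.2))) +
        (ENNReal.ofReal (t ^ d) * (ENNReal.ofReal (equilibrium γ q.1) *
          Φ ((1 - t) • q.1 + t • q.2)))) := by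
    intro q
    have e1 := equilibrium_pos hγ q.1
    have e2 := equilibrium_pos hγ q.2
    have e3 := equilibrium_pos hγ ((1 - t) • q.1 + t • q.2)
    have e4 := hG0 ((1 - t) • q.1 + t • q.2)
    simp only [Φ]
    rw [← ENNReal.ofReal_mul e1.le, ← ENNReal.ofReal_mul e2.le, ← ENNReal.ofReal_mul (by positivity),
      ← ENNReal.ofReal_mul (by positivity), ← ENNReal.ofReal_add (by positivity) (by positivity),
      ← ENNReal.ofReal_mul (by positivity)]
    refine ENNReal.ofReal_le_ofReal ?_
    have := mul_le_mul_of_nonneg_right (equilibrium_mul_le hγ q.1 q.2 h0 h1) e4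
    linarith
  refine (lintegral_mono key).trans ?_
  have hm : ∀ (w : Vec d × Vec d → Vec d), Measurable w → Measurable fun q : Vec d × Vec d =>
      ENNReal.ofReal (equilibrium γ (w q)) * Φ ((1 - t) • q.1 + t • q.2) := by
    intro w hw
    exact (hF.measurable.comp hw).ennreal_ofReal.mul (hΦ.comp (by fun_prop))
  have i1 : ENNReal.ofReal ((1 - t) ^ d) * ∫⁻ q : Vec d × Vec d,
      ENNReal.ofReal (equilibrium γ q.2) * Φ ((1 - t) • q.1 + t • q.2) =
      ENNReal.ofReal (∫ v : Vec d, equilibrium γ v) * ∫⁻ v, Φ v := by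
    rw [Measure.volume_eq_prod, lintegral_prod_symm _ (hm _ measurable_snd).aemeasurable,
      ← lintegral_const_mul' _ _ ENNReal.ofReal_ne_top, ← hFi,
      ← lintegral_mul_const _ hF.measurable.ennreal_ofReal]
    refine lintegral_congr fun w => ?_
    simp only
    rw [lintegral_const_mul' _ _ ENNReal.ofReal_ne_top, mul_left_comm,
      ofReal_mul_lintegral_comp_smul_add Φ h2 (t • w)]
  have i2 : ENNReal.ofReal (t ^ d) * ∫⁻ q : Vec d × Vec d,
      ENNReal.ofReal (equilibrium γ q.1) * Φ ((1 - t) • q.1 + t • q.2) =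
      ENNReal.ofReal (∫ v : Vec d, equilibrium γ v) * ∫⁻ v, Φ v := by
    rw [Measure.volume_eq_prod, lintegral_prod _ (hm _ measurable_fst).aemeasurable,
      ← lintegral_const_mul' _ _ ENNReal.ofReal_ne_top, ← hFi,
      ← lintegral_mul_const _ hF.measurable.ennreal_ofReal]
    refine lintegral_congr fun w => ?_
    simp only
    rw [lintegral_const_mul' _ _ ENNReal.ofReal_ne_top, mul_left_comm]
    simp only [add_comm ((1 - t) • w)]
    rw [ofReal_mul_lintegral_comp_smul_add Φ h0 ((1 - t) • w)]
  have hI : 0 ≤ ∫ v : Vec d, equilibrium γ v := integral_nonneg fun v => (equilibrium_pos hγ v).le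
  rw [lintegral_const_mul' _ _ ENNReal.ofReal_ne_top, lintegral_add_left
    ((hm _ measurable_snd).const_mul _), lintegral_const_mul' _ _ ENNReal.ofReal_ne_top,
    lintegral_const_mul' _ _ ENNReal.ofReal_ne_top, i1, i2, ENNReal.ofReal_mul (by positivity),
    ENNReal.ofReal_mul (by positivity), ENNReal.ofReal_ofNat]
  apply le_of_eq; ring

/-- Weighted Poincaré inequality. The factor |w-v|² from the segment is absorbed by the weights
⟨v⟩^{-2}⟨w⟩^{-2}, which is where β = 2 enters; the rest is `lintegral_segment_le`, integrated over
t. -/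
theorem pairEnergy_le_gradient {γ : ℝ} (hγ : 0 < γ) {u : Vec d → ℝ} (hu : ContDiff ℝ 1 u) :
    pairEnergy γ (-2) u ≤
      ENNReal.ofReal (4 * (2 ^ ((d : ℝ) + γ) * 2 * ∫ v : Vec d, equilibrium γ v)) *
        ∫⁻ v, ENNReal.ofReal
          (equilibrium γ v * ‖fderiv ℝ (fun w => u w / equilibrium γ w) v‖ ^ 2) := by
  set g : Vec d → ℝ := fun w => u w / equilibrium γ w
  have hg : ContDiff ℝ 1 g := hu.div (contDiff_equilibrium γ) fun v => (equilibrium_pos hγ v).ne'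
  have hcont := hg.continuous_fderiv one_ne_zero
  set G : Vec d → ℝ := fun v => ‖fderiv ℝ g v‖ ^ 2
  have hG : Continuous G := by fun_prop
  have hG0 : ∀ v, 0 ≤ G v := fun v => sq_nonneg _
  have hI : 0 ≤ ∫ v : Vec d, equilibrium γ v := integral_nonneg fun v => (equilibrium_pos hγ v).le
  have hF := continuous_equilibrium (d := d) γ
  have key : ∀ q : Vec d × Vec d, ENNReal.ofReal (energyIntegrand γ (-2) u q) ≤
      ∫⁻ t in Set.Ioo (0 : ℝ) 1, ENNReal.ofReal 4 * ENNReal.ofReal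
        (equilibrium γ q.1 * equilibrium γ q.2 * G ((1 - t) • q.1 + t • q.2)) := by
    intro q
    have w1 := weight_pos hγ (-2) q.1
    have w2 := weight_pos hγ (-2) q.2
    rw [energyIntegrand, ENNReal.ofReal_mul (by positivity)]
    refine (mul_le_mul_right (sq_sub_le_lintegral hg q.1 q.2) _).trans ?_
    rw [← lintegral_const_mul' _ _ ENNReal.ofReal_ne_top]
    refine lintegral_mono fun t => ?_
    rw [← ENNReal.ofReal_mul (by positivity), ← ENNReal.ofReal_mul (by positivity)]
    refine ENNReal.ofReal_le_ofReal ?_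
    have := mul_le_mul_of_nonneg_right (weight_mul_dist_sq_le hγ q.1 q.2)
      (hG0 ((1 - t) • q.1 + t • q.2))
    simp only [G] at this ⊢
    linarith
  refine (lintegral_mono key).trans ?_
  rw [lintegral_lintegral_swap]
  · have hle : ∀ t ∈ Set.Ioo (0 : ℝ) 1, ∫⁻ q : Vec d × Vec d, ENNReal.ofReal 4 * ENNReal.ofReal
        (equilibrium γ q.1 * equilibrium γ q.2 * G ((1 - t) • q.1 + t • q.2)) ≤
        ENNReal.ofReal (4 * (2 ^ ((d : ℝ) + γ) * 2 * ∫ v : Vec d, equilibrium γ v)) *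
        ∫⁻ v, ENNReal.ofReal (equilibrium γ v * G v) := by
      intro t ht
      rw [lintegral_const_mul' _ _ ENNReal.ofReal_ne_top, ENNReal.ofReal_mul (by norm_num),
        mul_assoc]
      exact mul_le_mul_right (lintegral_segment_le hγ hG hG0 ht.1 ht.2) _
    refine (setLIntegral_mono measurable_const hle).trans ?_
    simp [G]
  · refine Measurable.aemeasurable (Measurable.const_mul (Measurable.ennreal_ofReal ?_) _)
    refine Continuous.measurable ?_
    fun_prop

theorem contDiff_gradient {g : Vec d → ℝ} (hg : ContDiff ℝ 2 g) : ContDiff ℝ 1 (gradient g) :=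
  (InnerProductSpace.toDual ℝ (Vec d)).symm.contDiff.comp
    (hg.fderiv_right (m := 1) (by norm_num))

theorem norm_gradient (g : Vec d → ℝ) (v : Vec d) : ‖gradient g v‖ = ‖fderiv ℝ g v‖ :=
  (InnerProductSpace.toDual ℝ (Vec d)).symm.norm_map _

theorem fderiv_gradient_self (g : Vec d → ℝ) (v : Vec d) :
    fderiv ℝ g v (gradient g v) = ‖fderiv ℝ g v‖ ^ 2 := by
  rw [← inner_gradient_left, real_inner_self_eq_norm_sq, norm_gradient]

theorem sliceNormSq_mono {γ : ℝ} (hγ : 0 < γ) {s t : ℝ} (h : s ≤ t) (u : Vec d → ℝ) :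
    sliceNormSq γ s u ≤ sliceNormSq γ t u :=
  lintegral_mono fun v => ENNReal.ofReal_le_ofReal
    (mul_le_mul_of_nonneg_right (weight_mono hγ h v) (sq_nonneg _))

/-- A Caccioppoli argument: test against c² g with a cut-off c, and absorb the term containing ∇c
into half of the gradient energy. -/
theorem fokkerPlanck_slice {γ k : ℝ} (hγ : 0 < γ) (hk : 0 < k) :
    ∃ C : ℝ, 0 < C ∧ ∀ u : Vec d → ℝ, ContDiff ℝ 2 u → sliceNormSq γ k u ≠ ⊤ →
      Integrable (slicePairing γ (fokkerPlanck γ) u) →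
        0 ≤ -∫ v, slicePairing γ (fokkerPlanck γ) u v ∧
        pairEnergy γ (-2) u ≤
          ENNReal.ofReal (C * -∫ v, slicePairing γ (fokkerPlanck γ) u v) := by
  have hI : 0 < ∫ v : Vec d, equilibrium γ v := by
    simpa only [weight_zero] using integral_weight_pos (d := d) hγ hγ
  set K := 4 * (2 ^ ((d : ℝ) + γ) * 2 * ∫ v : Vec d, equilibrium γ v) with hK
  have hK0 : 0 < K := by positivity
  refine ⟨2 * K, by positivity, fun u hu hfin hint => ?_⟩
  obtain ⟨M, hM0, hM⟩ := exists_fderiv_cutoff_bound (d := d)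
  set g : Vec d → ℝ := fun w => u w / equilibrium γ w with hgdef
  have hF : ∀ n : WithTop ℕ∞, ContDiff ℝ n (equilibrium γ : Vec d → ℝ) := fun n =>
    contDiff_equilibrium γ
  have hg : ContDiff ℝ 2 g := hu.div (hF 2) fun v => (equilibrium_pos hγ v).ne'
  have hg1 : ContDiff ℝ 1 g := hg.of_le (by norm_num)
  have hcont := hg1.continuous_fderiv one_ne_zero
  have hFc := continuous_equilibrium (d := d) γ
  let Y : Vec d → Vec d := fun w => equilibrium γ w • gradient g w
  have hY : ContDiff ℝ 1 Y := (hF 1).smul (contDiff_gradient hg)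
  let P : Vec d → ℝ := fun v => -slicePairing γ (fokkerPlanck γ) u v
  have hP : Integrable P := hint.neg
  have hPval : ∀ v, P v = -(g v * divergence Y v) := fun v => rfl
  -- Only half of F|∇g|² is kept, since the other half pays for the cut-off; hence the factor 2 in
  -- the final constant.
  let e : Vec d → ℝ := fun v => equilibrium γ v * ‖fderiv ℝ g v‖ ^ 2 / 2
  have he : ∀ v, 0 ≤ e v := fun v => by
    have := equilibrium_pos hγ v
    positivity
  have hec : Continuous e := by fun_prop
  have hsq : Integrable fun v => equilibrium γ v * g v ^ 2 := by
    have := integrable_of_sliceNormSq (s := 0) hγ hu.continuous.aestronglyMeasurable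
      (ne_top_of_le_ne_top hfin (sliceNormSq_mono hγ hk.le u))
    simpa only [weight_zero] using this
  -- The cut-off is squared so that its derivative retains a factor c, as the absorption requires.
  let χ : ℕ → Vec d → ℝ := fun n v => cutoff (n + 1 : ℝ) v ^ 2
  have hχ : ∀ n, ContDiff ℝ 1 (χ n) := fun n => (contDiff_cutoff _ (n := 1)).pow 2
  have hχc : ∀ n, HasCompactSupport (χ n) := fun n =>
    (hasCompactSupport_cutoff (by positivity : (0 : ℝ) < n + 1)).comp_left
      (g := fun x : ℝ => x ^ 2) (by simp)
  let X : ℕ → Vec d → Vec d := fun n v => (χ n v * g v) • Y v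
  have hX : ∀ n, ContDiff ℝ 1 (X n) := fun n => ((hχ n).mul hg1).smul hY
  have hXc : ∀ n, HasCompactSupport (X n) := fun n => ((hχc n).mul_right).smul_right
  have hdivi : ∀ n, Integrable (divergence (X n)) := fun n =>
    (continuous_divergence (hX n)).integrable_of_hasCompactSupport (hXc n).divergence
  have hpt : ∀ n v, χ n v * e v ≤ divergence (X n) v + χ n v * P v +
      2 * (M / (n + 1)) ^ 2 * (equilibrium γ v * g v ^ 2) := by
    intro n v
    set c := cutoff (n + 1 : ℝ) v with hc
    have hcd : DifferentiableAt ℝ (cutoff (n + 1 : ℝ) : Vec d → ℝ) v :=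
      (contDiff_cutoff _ (n := 1)).differentiable one_ne_zero v
    have hgd : DifferentiableAt ℝ g v := hg1.differentiable one_ne_zero v
    have hχd : DifferentiableAt ℝ (χ n) v := (hχ n).differentiable one_ne_zero v
    have hfχ : fderiv ℝ (χ n) v = (2 * c) • fderiv ℝ (cutoff (n + 1 : ℝ)) v := by
      have := (hcd.hasFDerivAt.pow 2).fderiv
      refine this.trans ?_
      simp [hc]
    have hdiv : divergence (X n) v = χ n v * g v * divergence Y v +
        (χ n v * fderiv ℝ g v (Y v) + g v * (2 * c * fderiv ℝ (cutoff (n + 1 : ℝ)) v (Y v))) := by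
      have := divergence_smul (a := fun v => χ n v * g v) (X := Y) (v := v) (hχd.mul hgd)
        (hY.differentiable one_ne_zero v)
      refine this.trans ?_
      rw [fderiv_fun_mul hχd hgd, hfχ]
      simp
    have hgY : fderiv ℝ g v (Y v) = equilibrium γ v * ‖fderiv ℝ g v‖ ^ 2 := by
      simp only [Y]
      rw [map_smul, fderiv_gradient_self, smul_eq_mul]
    have hcY : fderiv ℝ (cutoff (n + 1 : ℝ)) v (Y v) =
        equilibrium γ v * fderiv ℝ (cutoff (n + 1 : ℝ)) v (gradient g v) := by
      simp only [Y]
      rw [map_smul, smul_eq_mul]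
    set r := fderiv ℝ (cutoff (n + 1 : ℝ)) v (gradient g v) with hr
    have hrb : r ^ 2 ≤ (M / (n + 1)) ^ 2 * ‖fderiv ℝ g v‖ ^ 2 := by
      have h1 := (fderiv ℝ (cutoff (n + 1 : ℝ)) v).le_of_opNorm_le
        (hM (n + 1) (by positivity) v) (gradient g v)
      rw [norm_gradient] at h1
      have h2 := pow_le_pow_left₀ (norm_nonneg _) h1 2
      rwa [Real.norm_eq_abs, sq_abs, mul_pow] at h2
    have hFv := equilibrium_pos hγ v
    rw [hdiv, hgY, hcY, hPval]
    have hχv : χ n v = c ^ 2 := rfl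
    simp only [e]
    rw [hχv]
    -- Young's inequality; the leftover is of order R^{-2} g², and F g² is integrable.
    have hkey : -(g v * (2 * c * r)) ≤ c ^ 2 * ‖fderiv ℝ g v‖ ^ 2 / 2 +
        2 * (M / (n + 1)) ^ 2 * g v ^ 2 := by
      set a := M / ((n : ℝ) + 1)
      have ha : 0 < a := by positivity
      set N := ‖fderiv ℝ g v‖
      have hN : 0 ≤ N := norm_nonneg _
      have habs : |r| ≤ a * N := abs_le_of_sq_le_sq (by rwa [mul_pow]) (by positivity)
      have h3 : -(g v * (2 * c * r)) ≤ 2 * (|g v| * |c|) * (a * N) := by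
        have : -(g v * (2 * c * r)) ≤ 2 * (|g v| * |c|) * |r| := by
          rw [show 2 * (|g v| * |c|) * |r| = |-(g v * (2 * c * r))| by
            rw [abs_neg, abs_mul, abs_mul, abs_mul, abs_two]; ring]
          exact le_abs_self _
        refine this.trans (by gcongr)
      rw [← sq_abs c, ← sq_abs (g v)]
      nlinarith [sq_nonneg (|c| * N - 2 * a * |g v|)]
    have := mul_le_mul_of_nonneg_left hkey hFv.le
    linarith
  have hi : ∀ n, Integrable fun v => χ n v * e v := fun n =>
    (((hχ n).continuous).mul hec).integrable_of_hasCompactSupport (hχc n).mul_right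
  have hiP : ∀ n, Integrable fun v => χ n v * P v := fun n => by
    refine hP.norm.mono' ((hχ n).continuous.aestronglyMeasurable.mul hP.1)
      (.of_forall fun v => ?_)
    rw [norm_mul, Real.norm_of_nonneg (sq_nonneg _)]
    exact mul_le_of_le_one_left (norm_nonneg _)
      (pow_le_one₀ (cutoff_nonneg _ _) (cutoff_le_one _ _))
  have herr : Tendsto (fun n : ℕ => 2 * (M / ((n : ℝ) + 1)) ^ 2 *
      ∫ v, equilibrium γ v * g v ^ 2) atTop (𝓝 0) := by
    have h1 : Tendsto (fun n : ℕ => M / ((n : ℝ) + 1)) atTop (𝓝 0) := by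
      simpa [div_eq_mul_inv] using tendsto_one_div_add_atTop_nhds_zero_nat.const_mul M
    simpa using ((h1.pow 2).const_mul 2).mul_const (∫ v, equilibrium γ v * g v ^ 2)
  have hfinal := nonneg_and_lintegral_le_of_localized he hP (fun n => (hχ n).continuous)
    (fun n v => sq_nonneg _) (fun n v => pow_le_one₀ (cutoff_nonneg _ _) (cutoff_le_one _ _))
    (fun v => by simpa using (tendsto_cutoff v).pow 2) hi herr (fun n => by
      have h1 := integral_mono (hi n) (((hdivi n).add (hiP n)).add (hsq.const_mul _)) (hpt n)
      rwa [integral_add' ((hdivi n).add (hiP n)) (hsq.const_mul _),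
        integral_add' (hdivi n) (hiP n), integral_divergence (hX n) (hXc n),
        integral_const_mul, zero_add] at h1)
  have hneg : ∫ v, P v = -∫ v, slicePairing γ (fokkerPlanck γ) u v := integral_neg _
  rw [hneg] at hfinal
  refine ⟨hfinal.1, (pairEnergy_le_gradient hγ (hu.of_le (by norm_num))).trans ?_⟩
  have h2 : ∫⁻ v, ENNReal.ofReal (equilibrium γ v * ‖fderiv ℝ g v‖ ^ 2) =
      ENNReal.ofReal 2 * ∫⁻ v, ENNReal.ofReal (e v) := by
    rw [← lintegral_const_mul' _ _ ENNReal.ofReal_ne_top]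
    refine lintegral_congr fun v => ?_
    rw [← ENNReal.ofReal_mul (by norm_num)]
    congr 1; simp only [e]; ring
  rw [h2]
  refine (mul_le_mul_right (mul_le_mul_right hfinal.2 _) _).trans_eq ?_
  rw [← ENNReal.ofReal_mul (by norm_num), ← ENNReal.ofReal_mul hK0.le]
  congr 1; ring

/-! ### The fractional Laplacian: integrability, symmetry and cut-offs -/

/-- The symmetric second difference `u(v+w) + u(v-w) - 2 u(v)`. -/
def secondDiff (u : Vec d → ℝ) (v w : Vec d) : ℝ := u (v + w) + u (v - w) - 2 * u v

/-- The positive constant `C_{d,σ}` in the definition of the fractional Laplacian. -/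
noncomputable def fracConst (d : ℕ) (σ : ℝ) : ℝ :=
  -(2 ^ σ / Real.pi ^ ((d : ℝ) / 2) * (Real.Gamma ((d + σ) / 2) / Real.Gamma (-σ / 2)))

theorem fracConst_pos {σ : ℝ} (h0 : 0 < σ) (h2 : σ < 2) : 0 < fracConst d σ := by
  have h1 : 0 < Real.Gamma ((d + σ) / 2) := Real.Gamma_pos_of_pos (by positivity)
  have h3 : Real.Gamma (-σ / 2) < 0 := by
    have h4 : 0 < Real.Gamma (-σ / 2 + 1) := Real.Gamma_pos_of_pos (by linarith)
    rw [Real.Gamma_add_one (by linarith)] at h4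
    by_contra! h5
    have := mul_nonpos_of_nonpos_of_nonneg (by linarith : -σ / 2 ≤ 0) h5
    linarith
  have hpi := Real.rpow_pos_of_pos Real.pi_pos ((d : ℝ) / 2)
  have h6 : (2 : ℝ) ^ σ / Real.pi ^ ((d : ℝ) / 2) *
      (Real.Gamma ((d + σ) / 2) / Real.Gamma (-σ / 2)) < 0 :=
    mul_neg_of_pos_of_neg (by positivity) (div_neg_of_pos_of_neg h1 h3)
  unfold fracConst
  linarith

theorem fracLaplacian_eq (σ : ℝ) (u : Vec d → ℝ) (v : Vec d) :
    fracLaplacian σ u v =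
      fracConst d σ / 2 * ∫ w : Vec d, secondDiff u v w / ‖w‖ ^ ((d : ℝ) + σ) := rfl

/-- An integrable majorant of the kernel of the fractional Laplacian, applied to a bounded function
with bounded second derivatives. -/
noncomputable def truncKernel (d : ℕ) (σ : ℝ) (w : Vec d) : ℝ :=
  min 1 (‖w‖ ^ 2) / ‖w‖ ^ ((d : ℝ) + σ)

theorem truncKernel_nonneg (σ : ℝ) (w : Vec d) : 0 ≤ truncKernel d σ w := by
  unfold truncKernel; positivity

/-- In polar coordinates the integrand is r^{1-σ} on (0,1] and r^{-1-σ} beyond, integrable because 0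
< σ < 2. -/
theorem integrable_truncKernel (hd : 1 ≤ d) {σ : ℝ} (h0 : 0 < σ) (h2 : σ < 2) :
    Integrable (truncKernel d σ) := by
  have : Nonempty (Fin d) := ⟨⟨0, hd⟩⟩
  have key : IntegrableOn (fun y : ℝ => y ^ (Module.finrank ℝ (Vec d) - 1) •
      (min 1 (y ^ 2) / y ^ ((d : ℝ) + σ))) (Set.Ioi 0) := by
    simp only [finrank_euclideanSpace, Fintype.card_fin, smul_eq_mul]
    have hpow : ∀ y : ℝ, 0 < y → y ^ (d - 1) = y ^ ((d : ℝ) - 1) := by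
      intro y hy
      rw [← Real.rpow_natCast, Nat.cast_sub hd]; simp
    rw [← Set.Ioc_union_Ioi_eq_Ioi (zero_le_one : (0 : ℝ) ≤ 1)]
    refine IntegrableOn.union ?_ ?_
    · have : IntegrableOn (fun y : ℝ => y ^ (1 - σ)) (Set.Ioc 0 1) := by
        rw [← intervalIntegrable_iff_integrableOn_Ioc_of_le zero_le_one]
        exact intervalIntegral.intervalIntegrable_rpow' (by linarith)
      refine this.congr_fun (fun y hy => ?_) measurableSet_Ioc
      have hy1 : y ^ 2 ≤ 1 := pow_le_one₀ hy.1.le hy.2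
      simp only
      rw [min_eq_right hy1, hpow y hy.1, ← Real.rpow_two, ← Real.rpow_sub hy.1,
        ← Real.rpow_add hy.1]
      congr 1; ring
    · refine (integrableOn_Ioi_rpow_of_lt (by linarith : -1 - σ < -1) zero_lt_one).congr_fun
        (fun y hy => ?_) measurableSet_Ioi
      have hy0 : 0 < y := zero_lt_one.trans hy
      have hy1 : 1 ≤ y ^ 2 := one_le_pow₀ (le_of_lt hy)
      simp only
      rw [min_eq_left hy1, hpow y hy0, mul_one_div, ← Real.rpow_sub hy0]
      congr 1; ring
  exact (integrable_fun_norm_addHaar (volume : Measure (Vec d))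
    (f := fun y : ℝ => min 1 (y ^ 2) / y ^ ((d : ℝ) + σ))).2 key

/-- Apply the mean value inequality to t ↦ u(v+tw) + u(v-tw), whose derivative is a difference of
first derivatives of u at points at distance 2t|w|. -/
theorem abs_secondDiff_le {u : Vec d → ℝ} (hu : ContDiff ℝ 2 u) {v w : Vec d} {M : ℝ}
    (hM : ∀ z ∈ Metric.closedBall v ‖w‖, ‖fderiv ℝ (fderiv ℝ u) z‖ ≤ M) :
    |secondDiff u v w| ≤ 2 * M * ‖w‖ ^ 2 := by
  have hu1 : ContDiff ℝ 1 (fderiv ℝ u) := hu.fderiv_right (m := 1) (by norm_num)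
  have hdu : Differentiable ℝ u := hu.differentiable (by norm_num)
  have hM0 : 0 ≤ M := le_trans (norm_nonneg (fderiv ℝ (fderiv ℝ u) v))
    (hM v (Metric.mem_closedBall_self (norm_nonneg _)))
  have hp : ∀ t : ℝ, HasDerivAt (fun t : ℝ => v + t • w) w t := fun t => by
    simpa using ((hasDerivAt_id t).smul_const w).const_add v
  have hm : ∀ t : ℝ, HasDerivAt (fun t : ℝ => v - t • w) (-w) t := fun t => by
    simpa using ((hasDerivAt_id t).smul_const w).const_sub v
  have hφ : ∀ t : ℝ, HasDerivAt (fun t : ℝ => u (v + t • w) + u (v - t • w))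
      ((fderiv ℝ u (v + t • w)) w + (fderiv ℝ u (v - t • w)) (-w)) t := fun t =>
    ((hdu _).hasFDerivAt.comp_hasDerivAt t (hp t)).add
      ((hdu _).hasFDerivAt.comp_hasDerivAt t (hm t))
  have hbound : ∀ t ∈ Set.Ico (0 : ℝ) 1,
      ‖(fderiv ℝ u (v + t • w)) w + (fderiv ℝ u (v - t • w)) (-w)‖ ≤ 2 * M * ‖w‖ ^ 2 := by
    intro t ht
    have hmem : ∀ s : ℝ, |s| ≤ 1 → v + s • w ∈ Metric.closedBall v ‖w‖ := by
      intro s hs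
      rw [mem_closedBall_iff_norm, add_sub_cancel_left, norm_smul, Real.norm_eq_abs]
      exact mul_le_of_le_one_left (norm_nonneg _) hs
    have h1 : v + t • w ∈ Metric.closedBall v ‖w‖ :=
      hmem t (abs_le.2 ⟨by linarith [ht.1], ht.2.le⟩)
    have h2 : v - t • w ∈ Metric.closedBall v ‖w‖ := by
      have := hmem (-t) (abs_le.2 ⟨by linarith [ht.2], by linarith [ht.1]⟩)
      rwa [neg_smul, ← sub_eq_add_neg] at this
    have h3 := (convex_closedBall v ‖w‖).norm_image_sub_le_of_norm_fderiv_le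
      (fun z _ => hu1.differentiable one_ne_zero z) hM h2 h1
    have h4 : (fderiv ℝ u (v + t • w)) w + (fderiv ℝ u (v - t • w)) (-w) =
        (fderiv ℝ u (v + t • w) - fderiv ℝ u (v - t • w)) w := by
      simp [sub_eq_add_neg]
    have h5 : ‖v + t • w - (v - t • w)‖ ≤ 2 * ‖w‖ := by
      rw [show v + t • w - (v - t • w) = (2 * t) • w by module, norm_smul, Real.norm_eq_abs,
        abs_of_nonneg (by linarith [ht.1])]
      nlinarith [norm_nonneg w, ht.2]
    rw [h4]
    refine (ContinuousLinearMap.le_opNorm _ _).trans ?_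
    calc _ ≤ M * ‖v + t • w - (v - t • w)‖ * ‖w‖ := by gcongr
      _ ≤ M * (2 * ‖w‖) * ‖w‖ := by gcongr
      _ = _ := by ring
  have := norm_image_sub_le_of_norm_deriv_le_segment_01'
    (fun t _ => (hφ t).hasDerivWithinAt) hbound
  rw [Real.norm_eq_abs] at this
  convert this using 2
  simp only [secondDiff, one_smul, zero_smul, add_zero, sub_zero]
  ring

theorem exists_secondDiff_bound {u : Vec d → ℝ} (hu : ContDiff ℝ 2 u) (ρ σ : ℝ) :
    ∃ A : ℝ, 0 ≤ A ∧ ∀ v : Vec d, ‖v‖ ≤ ρ → ∀ w : Vec d,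
      |secondDiff u v w| / ‖w‖ ^ ((d : ℝ) + σ) ≤
        A * truncKernel d σ w + (|u (v + w)| + |u (v - w)|) * (if ‖w‖ ≤ 1 then 0 else
          truncKernel d σ w) := by
  have hu2 : Continuous fun z => ‖fderiv ℝ (fderiv ℝ u) z‖ :=
    ((hu.fderiv_right (m := 1) (by norm_num)).continuous_fderiv one_ne_zero).norm
  obtain ⟨M, hM⟩ := (isCompact_closedBall (0 : Vec d) (ρ + 1)).exists_bound_of_continuousOn
    hu2.continuousOn
  replace hM : ∀ z ∈ Metric.closedBall (0 : Vec d) (ρ + 1), ‖fderiv ℝ (fderiv ℝ u) z‖ ≤ M :=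
    fun z hz => (le_abs_self _).trans (hM z hz)
  obtain ⟨N, hN⟩ := (isCompact_closedBall (0 : Vec d) ρ).exists_bound_of_continuousOn
    hu.continuous.continuousOn
  refine ⟨2 * |M| + 2 * |N|, by positivity, fun v hv w => ?_⟩
  have hk : 0 ≤ ‖w‖ ^ ((d : ℝ) + σ) := by positivity
  by_cases hw : ‖w‖ ≤ 1
  · have h1 := abs_secondDiff_le hu (v := v) (w := w) (M := |M|) fun z hz => by
      refine (hM z ?_).trans (le_abs_self M)
      rw [mem_closedBall_iff_norm] at hz
      rw [mem_closedBall_zero_iff]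
      have := norm_sub_norm_le z v
      linarith
    have h2 : ‖w‖ ^ 2 ≤ 1 := pow_le_one₀ (norm_nonneg _) hw
    rw [if_pos hw, mul_zero, add_zero, truncKernel, min_eq_right h2, ← mul_div_assoc]
    gcongr
    refine h1.trans ?_
    have : 0 ≤ |N| := abs_nonneg _
    gcongr
    linarith
  · push Not at hw
    have h2 : 1 ≤ ‖w‖ ^ 2 := one_le_pow₀ hw.le
    have h3 := hN v (by rwa [mem_closedBall_zero_iff])
    rw [if_neg (not_le.2 hw), truncKernel, min_eq_left h2, mul_one_div, mul_one_div, ← add_div]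
    gcongr
    have h4 : |secondDiff u v w| ≤ |u (v + w)| + |u (v - w)| + 2 * |u v| := by
      unfold secondDiff
      rw [abs_le]
      constructor <;> cases abs_cases (u (v + w)) <;> cases abs_cases (u (v - w)) <;>
        cases abs_cases (u v) <;> linarith
    rw [Real.norm_eq_abs] at h3
    have := le_abs_self N
    have : 0 ≤ |M| := abs_nonneg _
    linarith

theorem exists_secondDiff_bound' {u : Vec d → ℝ} (hu : ContDiff ℝ 2 u) (ρ : ℝ) {σ : ℝ}
    (h0 : 0 < σ) :
    ∃ A : ℝ, 0 ≤ A ∧ ∀ v : Vec d, ‖v‖ ≤ ρ → ∀ w : Vec d,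
      |secondDiff u v w| / ‖w‖ ^ ((d : ℝ) + σ) ≤
        A * truncKernel d σ w + (|u (v + w)| + |u (v - w)|) := by
  obtain ⟨A, hA0, hA⟩ := exists_secondDiff_bound hu ρ σ
  refine ⟨A, hA0, fun v hv w => (hA v hv w).trans ?_⟩
  gcongr
  refine mul_le_of_le_one_right (by positivity) ?_
  split_ifs with h
  · exact zero_le_one
  · push Not at h
    have hk : 1 ≤ ‖w‖ ^ ((d : ℝ) + σ) := Real.one_le_rpow h.le (by positivity)
    rw [truncKernel, div_le_one (by positivity)]
    exact (min_le_left _ _).trans hk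

theorem measurable_secondDiff_div {u : Vec d → ℝ} (hu : Continuous u) (σ : ℝ) :
    Measurable fun q : Vec d × Vec d => secondDiff u q.1 q.2 / ‖q.2‖ ^ ((d : ℝ) + σ) := by
  have h1 : Measurable fun q : Vec d × Vec d => secondDiff u q.1 q.2 := by
    unfold secondDiff
    exact Continuous.measurable (by fun_prop)
  have h2 : Measurable fun q : Vec d × Vec d => ‖q.2‖ ^ ((d : ℝ) + σ) :=
    (measurable_snd.norm).pow_const _
  exact h1.div h2

theorem integrable_secondDiff_div (hd : 1 ≤ d) {u : Vec d → ℝ} (hu : ContDiff ℝ 2 u)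
    (hi : Integrable u) {σ : ℝ} (h0 : 0 < σ) (h2 : σ < 2) (v : Vec d) :
    Integrable fun w : Vec d => secondDiff u v w / ‖w‖ ^ ((d : ℝ) + σ) := by
  obtain ⟨A, hA0, hA⟩ := exists_secondDiff_bound' hu ‖v‖ h0
  refine (((integrable_truncKernel hd h0 h2).const_mul A).add
    ((hi.comp_add_left v).abs.add (hi.comp_sub_left v).abs)).mono'
    ((measurable_secondDiff_div hu.continuous σ).comp measurable_prodMk_left).aestronglyMeasurable
    (.of_forall fun w => ?_)
  rw [norm_div, Real.norm_eq_abs, Real.norm_of_nonneg (by positivity)]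
  exact hA v le_rfl w

theorem hasCompactSupport_norm_fderiv_fderiv {u : Vec d → ℝ} (hu : HasCompactSupport u) :
    HasCompactSupport fun z => ‖fderiv ℝ (fderiv ℝ u) z‖ := by
  refine HasCompactSupport.intro hu fun z hz => ?_
  have h0 : u =ᶠ[𝓝 z] fun _ => 0 := notMem_tsupport_iff_eventuallyEq.1 hz
  have h1 : fderiv ℝ u =ᶠ[𝓝 z] fun _ => 0 := by
    refine h0.fderiv.trans (.of_forall fun y => ?_)
    simp
  have h2 : fderiv ℝ (fderiv ℝ u) z = 0 := by
    rw [h1.fderiv_eq]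
    exact fderiv_const_apply _
  rw [h2]
  exact norm_zero (E := Vec d →L[ℝ] Vec d →L[ℝ] ℝ)

theorem exists_secondDiff_bump_bound : ∃ A : ℝ, 0 ≤ A ∧ ∀ v w : Vec d,
    |secondDiff bump v w| ≤ A * min 1 (‖w‖ ^ 2) := by
  have hb : ContDiff ℝ 2 (bump : Vec d → ℝ) := contDiff_bump (n := 2)
  have hu2 : Continuous fun z => ‖fderiv ℝ (fderiv ℝ (bump : Vec d → ℝ)) z‖ :=
    ((hb.fderiv_right (m := 1) (by norm_num)).continuous_fderiv one_ne_zero).norm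
  have hc2 : HasCompactSupport fun z => ‖fderiv ℝ (fderiv ℝ (bump : Vec d → ℝ)) z‖ :=
    hasCompactSupport_norm_fderiv_fderiv hasCompactSupport_bump
  obtain ⟨M, hM⟩ := hu2.bounded_above_of_compact_support hc2
  replace hM : ∀ z : Vec d, ‖fderiv ℝ (fderiv ℝ bump) z‖ ≤ M :=
    fun z => (le_abs_self _).trans (hM z)
  have hM0 : 0 ≤ M := le_trans (norm_nonneg (fderiv ℝ (fderiv ℝ (bump : Vec d → ℝ)) 0)) (hM 0)
  refine ⟨2 * M + 2, by positivity, fun v w => ?_⟩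
  have h1 := abs_secondDiff_le hb (v := v) (w := w) (M := M) fun z _ => hM z
  have h2 : |secondDiff bump v w| ≤ 2 := by
    have hb0 : ∀ z : Vec d, 0 ≤ bump z := fun z => Real.smoothTransition.nonneg _
    have hb1 : ∀ z : Vec d, bump z ≤ 1 := fun z => Real.smoothTransition.le_one _
    unfold secondDiff
    rw [abs_le]
    constructor <;> linarith [hb0 (v + w), hb0 (v - w), hb0 v, hb1 (v + w), hb1 (v - w), hb1 v]
  rcases le_total 1 (‖w‖ ^ 2) with h | h
  · rw [min_eq_left h]; linarith
  · rw [min_eq_right h]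
    nlinarith [sq_nonneg ‖w‖]

/-- Scaling: for R ≥ 1 the dilation by 1/R shortens w, so the bound for the unit bump holds
uniformly in R. This provides the domination needed as R tends to infinity. -/
theorem exists_secondDiff_cutoff_bound : ∃ A : ℝ, 0 ≤ A ∧ ∀ R : ℝ, 1 ≤ R → ∀ v w : Vec d,
    |secondDiff (cutoff R) v w| ≤ A * min 1 (‖w‖ ^ 2) := by
  obtain ⟨A, hA0, hA⟩ := exists_secondDiff_bump_bound (d := d)
  refine ⟨A, hA0, fun R hR v w => ?_⟩
  have h1 : secondDiff (cutoff R) v w = secondDiff bump (R⁻¹ • v) (R⁻¹ • w) := by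
    simp only [secondDiff, cutoff, smul_add, smul_sub]
  rw [h1]
  refine (hA _ _).trans ?_
  gcongr
  rw [norm_smul, norm_inv, Real.norm_of_nonneg (by linarith)]
  exact mul_le_of_le_one_left (norm_nonneg _) (inv_le_one_of_one_le₀ hR)

theorem integrable_mul_comp_add {χ u : Vec d → ℝ} (hχ : Integrable χ) (hu : Integrable u) :
    Integrable fun q : Vec d × Vec d => χ q.1 * u (q.1 + q.2) :=
  (measurePreserving_prod_add (volume : Measure (Vec d)) volume).integrable_comp_of_integrable
    (g := fun q : Vec d × Vec d => χ q.1 * u q.2) (hχ.mul_prod hu)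

theorem integrable_mul_comp_sub {χ u : Vec d → ℝ} (hχ : Integrable χ) (hu : Integrable u) :
    Integrable fun q : Vec d × Vec d => χ q.1 * u (q.1 - q.2) := by
  have h := ((MeasurePreserving.id (volume : Measure (Vec d))).prod
    (Measure.measurePreserving_neg volume)).integrable_comp_of_integrable
    (g := fun q : Vec d × Vec d => χ q.1 * u (q.1 + q.2)) (integrable_mul_comp_add hχ hu)
  refine h.congr (.of_forall fun q => ?_)
  simp [sub_eq_add_neg]

theorem integrable_localized_secondDiff (hd : 1 ≤ d) {χ u : Vec d → ℝ} (hχ : Continuous χ)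
    (hχc : HasCompactSupport χ) (hu : ContDiff ℝ 2 u) (hi : Integrable u) {σ : ℝ}
    (h0 : 0 < σ) (h2 : σ < 2) :
    Integrable fun q : Vec d × Vec d =>
      χ q.1 * (secondDiff u q.1 q.2 / ‖q.2‖ ^ ((d : ℝ) + σ)) := by
  obtain ⟨ρ, hρ⟩ := hχc.isCompact.isBounded.exists_norm_le
  obtain ⟨A, hA0, hA⟩ := exists_secondDiff_bound' hu ρ h0
  have hχi := (hχ.integrable_of_hasCompactSupport (μ := volume) hχc).abs
  have hb : Integrable fun q : Vec d × Vec d => |χ q.1| * (A * truncKernel d σ q.2) +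
      (|χ q.1| * |u (q.1 + q.2)| + |χ q.1| * |u (q.1 - q.2)|) :=
    (hχi.mul_prod ((integrable_truncKernel hd h0 h2).const_mul A)).add
      ((integrable_mul_comp_add hχi hi.abs).add (integrable_mul_comp_sub hχi hi.abs))
  refine hb.mono' ((hχ.measurable.comp measurable_fst).mul
    (measurable_secondDiff_div hu.continuous σ)).aestronglyMeasurable (.of_forall fun q => ?_)
  rw [norm_mul, norm_div, Real.norm_eq_abs, Real.norm_eq_abs, Real.norm_of_nonneg (by positivity),
    ← mul_add, ← mul_add]
  by_cases hq : χ q.1 = 0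
  · simp [hq]
  · exact mul_le_mul_of_nonneg_left (hA q.1 (hρ _ (subset_tsupport _ hq)) q.2) (abs_nonneg _)

theorem integrable_mul_secondDiff_cutoff (hd : 1 ≤ d) {u : Vec d → ℝ} (hi : Integrable u) {σ : ℝ}
    (h0 : 0 < σ) (h2 : σ < 2) {R : ℝ} (hR : 1 ≤ R) :
    Integrable fun q : Vec d × Vec d =>
      u q.1 * (secondDiff (cutoff R) q.1 q.2 / ‖q.2‖ ^ ((d : ℝ) + σ)) := by
  obtain ⟨A, hA0, hA⟩ := exists_secondDiff_cutoff_bound (d := d)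
  have hb : Integrable fun q : Vec d × Vec d => |u q.1| * (A * truncKernel d σ q.2) :=
    hi.abs.mul_prod ((integrable_truncKernel hd h0 h2).const_mul A)
  refine hb.mono' (hi.1.comp_fst.mul
    (measurable_secondDiff_div (continuous_cutoff R) σ).aestronglyMeasurable)
    (.of_forall fun q => ?_)
  rw [norm_mul, norm_div, Real.norm_eq_abs, Real.norm_eq_abs, Real.norm_of_nonneg (by positivity)]
  refine mul_le_mul_of_nonneg_left ?_ (abs_nonneg _)
  rw [truncKernel, ← mul_div_assoc]
  gcongr
  exact hA R hR q.1 q.2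

/-- Symmetry at fixed w by translation invariance; Fubini's theorem then makes the fractional
Laplacian symmetric. -/
theorem integral_mul_secondDiff_comm {χ u : Vec d → ℝ} (hχ : Continuous χ)
    (hχc : HasCompactSupport χ) (hi : Integrable u) (w : Vec d) :
    ∫ v, χ v * secondDiff u v w = ∫ v, u v * secondDiff χ v w := by
  obtain ⟨M, hM⟩ := hχ.bounded_above_of_compact_support hχc
  have hprod : ∀ a : Vec d, Integrable fun v => χ v * u (v + a) := fun a =>
    (hi.comp_add_right a).bdd_mul hχ.aestronglyMeasurable (.of_forall hM)
  have hprod' : ∀ a : Vec d, Integrable fun v => χ (v + a) * u v := fun a =>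
    hi.bdd_mul (hχ.comp (continuous_add_const a)).aestronglyMeasurable
      (.of_forall fun v => hM _)
  have hshift : ∀ a : Vec d, ∫ v, χ v * u (v + a) = ∫ v, χ (v - a) * u v := by
    intro a
    rw [← integral_sub_right_eq_self (fun v => χ v * u (v + a)) a]
    simp
  have p1 := hprod w
  have p2 := hprod (-w)
  have p3 := hprod' w
  have p4 := hprod' (-w)
  have p0 := hprod' 0
  have s1 := hshift w
  have s2 := hshift (-w)
  simp only [← sub_eq_add_neg, sub_neg_eq_add, add_zero] at p0 p1 p2 p3 p4 s1 s2
  have e1 : (fun v => χ v * secondDiff u v w) =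
      fun v => χ v * u (v + w) + χ v * u (v - w) - 2 * (χ v * u v) := by
    ext v; simp only [secondDiff]; ring
  have e2 : (fun v => u v * secondDiff χ v w) =
      fun v => χ (v + w) * u v + χ (v - w) * u v - 2 * (χ v * u v) := by
    ext v; simp only [secondDiff]; ring
  have p12 : Integrable fun v => χ v * u (v + w) + χ v * u (v - w) := p1.add p2
  have p34 : Integrable fun v => χ (v + w) * u v + χ (v - w) * u v := p3.add p4
  rw [e1, e2, integral_sub p12 (p0.const_mul 2), integral_sub p34 (p0.const_mul 2),
    integral_add p1 p2, integral_add p3 p4, s1, s2]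
  ring

theorem integrable_cutoff_mul_fracLaplacian (hd : 1 ≤ d) {χ u : Vec d → ℝ} (hχ : Continuous χ)
    (hχc : HasCompactSupport χ) (hu : ContDiff ℝ 2 u) (hi : Integrable u) {σ : ℝ} (h0 : 0 < σ)
    (h2 : σ < 2) : Integrable fun v => χ v * fracLaplacian σ u v := by
  have := ((integrable_localized_secondDiff hd hχ hχc hu hi h0 h2).integral_prod_left).const_mul
    (fracConst d σ / 2)
  refine this.congr (.of_forall fun v => ?_)
  simp only [fracLaplacian_eq, integral_const_mul]
  ring

theorem integrable_mul_fracLaplacian_cutoff (hd : 1 ≤ d) {u : Vec d → ℝ} (hi : Integrable u)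
    {σ : ℝ} (h0 : 0 < σ) (h2 : σ < 2) {R : ℝ} (hR : 1 ≤ R) :
    Integrable fun v => u v * fracLaplacian σ (cutoff R) v := by
  have := ((integrable_mul_secondDiff_cutoff hd hi h0 h2 hR).integral_prod_left).const_mul
    (fracConst d σ / 2)
  refine this.congr (.of_forall fun v => ?_)
  simp only [fracLaplacian_eq, integral_const_mul]
  ring

theorem integral_cutoff_mul_fracLaplacian (hd : 1 ≤ d) {u : Vec d → ℝ} (hu : ContDiff ℝ 2 u)
    (hi : Integrable u) {σ : ℝ} (h0 : 0 < σ) (h2 : σ < 2) {R : ℝ} (hR : 1 ≤ R) :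
    ∫ v, cutoff R v * fracLaplacian σ u v = ∫ v, u v * fracLaplacian σ (cutoff R) v := by
  have hχ := continuous_cutoff (d := d) R
  have hχc := hasCompactSupport_cutoff (d := d) (one_pos.trans_le hR)
  have e1 : ∀ (a b : Vec d → ℝ), ∫ v, a v * fracLaplacian σ b v = fracConst d σ / 2 *
      ∫ v, ∫ w, a v * (secondDiff b v w / ‖w‖ ^ ((d : ℝ) + σ)) := by
    intro a b
    rw [← integral_const_mul]
    refine integral_congr_ae (.of_forall fun v => ?_)
    simp only [fracLaplacian_eq, integral_const_mul]
    ring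
  have s1 := integral_integral_swap (f := fun v w : Vec d =>
    cutoff R v * (secondDiff u v w / ‖w‖ ^ ((d : ℝ) + σ)))
    (integrable_localized_secondDiff hd hχ hχc hu hi h0 h2)
  have s2 := integral_integral_swap (f := fun v w : Vec d =>
    u v * (secondDiff (cutoff R) v w / ‖w‖ ^ ((d : ℝ) + σ)))
    (integrable_mul_secondDiff_cutoff hd hi h0 h2 hR)
  rw [e1, e1, s1, s2]
  congr 1
  refine integral_congr_ae (.of_forall fun w => ?_)
  simp only [← mul_div_assoc, integral_div]
  rw [integral_mul_secondDiff_comm hχ hχc hi]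

/-- Dominated convergence twice: in w at fixed v, since the cut-offs tend to 1 and their second
differences to 0, then in v, since u is integrable. -/
theorem tendsto_integral_mul_fracLaplacian_cutoff (hd : 1 ≤ d) {u : Vec d → ℝ}
    (hi : Integrable u) {σ : ℝ} (h0 : 0 < σ) (h2 : σ < 2) :
    Tendsto (fun n : ℕ => ∫ v, u v * fracLaplacian σ (cutoff (n + 1 : ℝ)) v) atTop (𝓝 0) := by
  obtain ⟨A, hA0, hA⟩ := exists_secondDiff_cutoff_bound (d := d)
  have hR : ∀ n : ℕ, (1 : ℝ) ≤ n + 1 := fun n => by simp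
  have hκ := (integrable_truncKernel hd h0 h2).const_mul A
  have hb : ∀ (n : ℕ) (v w : Vec d),
      ‖secondDiff (cutoff (n + 1 : ℝ)) v w / ‖w‖ ^ ((d : ℝ) + σ)‖ ≤ A * truncKernel d σ w := by
    intro n v w
    rw [norm_div, Real.norm_eq_abs, Real.norm_of_nonneg (by positivity), truncKernel,
      ← mul_div_assoc]
    gcongr
    exact hA _ (hR n) v w
  have hmeas : ∀ (n : ℕ) (v : Vec d), AEStronglyMeasurable
      fun w : Vec d => secondDiff (cutoff (n + 1 : ℝ)) v w / ‖w‖ ^ ((d : ℝ) + σ) := fun n v =>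
    ((measurable_secondDiff_div (continuous_cutoff _) σ).comp
      measurable_prodMk_left).aestronglyMeasurable
  have hpt : ∀ v : Vec d,
      Tendsto (fun n : ℕ => fracLaplacian σ (cutoff (n + 1 : ℝ)) v) atTop (𝓝 0) := by
    intro v
    have := tendsto_integral_of_dominated_convergence (f := fun _ : Vec d => (0 : ℝ))
      (F := fun (n : ℕ) w => secondDiff (cutoff (n + 1 : ℝ)) v w / ‖w‖ ^ ((d : ℝ) + σ))
      _ (fun n => hmeas n v) hκ (fun n => .of_forall (hb n v)) (.of_forall fun w => by
        have := (((tendsto_cutoff (v + w)).add (tendsto_cutoff (v - w))).sub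
          ((tendsto_cutoff v).const_mul 2)).div_const (‖w‖ ^ ((d : ℝ) + σ))
        norm_num at this
        exact this)
    simpa [fracLaplacian_eq] using this.const_mul (fracConst d σ / 2)
  have hbound : ∀ (n : ℕ) (v : Vec d), ‖u v * fracLaplacian σ (cutoff (n + 1 : ℝ)) v‖ ≤
      ‖u v‖ * (|fracConst d σ / 2| * ∫ w, A * truncKernel d σ w) := by
    intro n v
    rw [norm_mul, fracLaplacian_eq, norm_mul, Real.norm_eq_abs (fracConst d σ / 2)]
    gcongr
    exact norm_integral_le_of_norm_le hκ (.of_forall (hb n v))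
  have := tendsto_integral_of_dominated_convergence (f := fun _ : Vec d => (0 : ℝ))
    (F := fun (n : ℕ) v => u v * fracLaplacian σ (cutoff (n + 1 : ℝ)) v) _
    (fun n => (integrable_mul_fracLaplacian_cutoff hd hi h0 h2 (hR n)).1)
    (hi.norm.mul_const _) (fun n => .of_forall (hbound n)) (.of_forall fun v => by
      simpa using (hpt v).const_mul (u v))
  simpa using this

/-! ### Testing the fractional Fokker-Planck operator against cut-offs -/

theorem integral_cutoff_mul_divergence {X : Vec d → Vec d} (hX : ContDiff ℝ 1 X) {R : ℝ}
    (hR : 0 < R) :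
    ∫ v, cutoff R v * divergence X v = -∫ v, fderiv ℝ (cutoff R) v (X v) := by
  have hχ : ContDiff ℝ 1 (cutoff R : Vec d → ℝ) := contDiff_cutoff R (n := 1)
  have hχc := hasCompactSupport_cutoff (d := d) hR
  have hdiv := integral_divergence (X := fun v => cutoff R v • X v) (hχ.smul hX) hχc.smul_right
  have hpt : divergence (fun v => cutoff R v • X v) =
      fun v => cutoff R v * divergence X v + fderiv ℝ (cutoff R) v (X v) := by
    ext v
    exact divergence_smul (hχ.differentiable one_ne_zero v) (hX.differentiable one_ne_zero v)
  have i1 : Integrable fun v => cutoff R v * divergence X v :=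
    (hχ.continuous.mul (continuous_divergence hX)).integrable_of_hasCompactSupport hχc.mul_right
  have i2 : Integrable fun v => fderiv ℝ (cutoff R) v (X v) := by
    have h1 : Integrable (divergence fun v => cutoff R v • X v) :=
      (continuous_divergence (hχ.smul hX)).integrable_of_hasCompactSupport
        (HasCompactSupport.divergence hχc.smul_right)
    rw [hpt] at h1
    refine (h1.sub i1).congr (.of_forall fun v => ?_)
    simp
  rw [hpt, integral_add i1 i2] at hdiv
  linarith

theorem integral_cutoff_mul_fracFokkerPlanck (hd : 1 ≤ d) {h : Vec d → ℝ} (hh : ContDiff ℝ 2 h)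
    (hi : Integrable h) {E : Vec d → Vec d} (hE : ContDiff ℝ 1 E) {σ : ℝ} (h0 : 0 < σ)
    (h2 : σ < 2) {R : ℝ} (hR : 1 ≤ R) :
    Integrable (fun v => cutoff R v * fracFokkerPlanck σ E h v) ∧
    ∫ v, cutoff R v * fracFokkerPlanck σ E h v =
      (∫ v, h v * fracLaplacian σ (cutoff R) v) - ∫ v, h v * fderiv ℝ (cutoff R) v (E v) := by
  have hχ := contDiff_cutoff (d := d) R (n := 1)
  have hχc := hasCompactSupport_cutoff (d := d) (one_pos.trans_le hR)
  have hX : ContDiff ℝ 1 fun w => h w • E w := (hh.of_le (by norm_num)).smul hE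
  have i1 := integrable_cutoff_mul_fracLaplacian hd hχ.continuous hχc hh hi h0 h2
  have i2 : Integrable fun v => cutoff R v * divergence (fun w => h w • E w) v :=
    (hχ.continuous.mul (continuous_divergence hX)).integrable_of_hasCompactSupport hχc.mul_right
  have hpt : (fun v => cutoff R v * fracFokkerPlanck σ E h v) = fun v =>
      cutoff R v * fracLaplacian σ h v + cutoff R v * divergence (fun w => h w • E w) v := by
    ext v; rw [fracFokkerPlanck]; ring
  rw [hpt]
  refine ⟨i1.add i2, ?_⟩
  rw [integral_add i1 i2, integral_cutoff_mul_fracLaplacian hd hh hi h0 h2 hR,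
    integral_cutoff_mul_divergence hX (one_pos.trans_le hR)]
  simp only [map_smul, smul_eq_mul]
  ring

/-! ### An upper bound on the friction force -/

theorem sub_two_mul_sq_le_log {q : ℝ} (h : |q| ≤ 1 / 2) : q - 2 * q ^ 2 ≤ Real.log (1 + q) := by
  obtain ⟨h1, h2⟩ := abs_le.1 h
  have hq : 0 < 1 + q := by linarith
  refine le_trans ?_ (Real.one_sub_inv_le_log_of_pos hq)
  rw [← sub_nonneg]
  have : 1 - (1 + q)⁻¹ - (q - 2 * q ^ 2) = q ^ 2 * (1 + 2 * q) / (1 + q) := by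
    field_simp; ring
  rw [this]
  have : 0 ≤ 1 + 2 * q := by linarith
  positivity

/-- Writing (1±q)^{-a} ≤ exp(2aq²) exp(∓aq), the sum becomes a hyperbolic cosine, bounded by a
Gaussian: the terms linear in q cancel. -/
theorem rpow_neg_add_rpow_neg_le {a q : ℝ} (ha : 0 ≤ a) (hq : |q| ≤ 1 / 2) :
    (1 + q) ^ (-a) + (1 - q) ^ (-a) - 2 ≤
      2 * ((2 * a + a ^ 2 / 2) * Real.exp (2 * a + a ^ 2 / 2)) * q ^ 2 := by
  obtain ⟨h1, h2⟩ := abs_le.1 hq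
  have e1 : ∀ r : ℝ, |r| ≤ 1 / 2 → (1 + r) ^ (-a) ≤ Real.exp (2 * a * r ^ 2) * Real.exp (-(a * r)) := by
    intro r hr
    have : 0 < 1 + r := by linarith [(abs_le.1 hr).1]
    rw [Real.rpow_def_of_pos this, ← Real.exp_add, Real.exp_le_exp]
    have := mul_le_mul_of_nonneg_left (sub_two_mul_sq_le_log hr) ha
    linarith
  have e2 := e1 q hq
  have e3 := e1 (-q) (by rwa [abs_neg])
  rw [neg_sq, ← sub_eq_add_neg, mul_neg, neg_neg] at e3
  set B := 2 * a + a ^ 2 / 2 with hB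
  have hB0 : 0 ≤ B := by positivity
  have e4 : Real.exp (2 * a * q ^ 2) * Real.exp (-(a * q)) +
      Real.exp (2 * a * q ^ 2) * Real.exp (a * q) ≤ 2 * Real.exp (B * q ^ 2) := by
    have h3 := Real.cosh_le_exp_half_sq (a * q)
    rw [Real.cosh_eq] at h3
    have h4 : Real.exp (B * q ^ 2) = Real.exp (2 * a * q ^ 2) * Real.exp ((a * q) ^ 2 / 2) := by
      rw [← Real.exp_add, hB]; congr 1; ring
    rw [h4]
    have := mul_le_mul_of_nonneg_left h3 (Real.exp_pos (2 * a * q ^ 2)).le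
    linarith
  have hq2 : q ^ 2 ≤ 1 := by nlinarith
  have e5 : Real.exp (B * q ^ 2) - 1 ≤ B * q ^ 2 * Real.exp B := by
    have h3 := Real.add_one_le_exp (-(B * q ^ 2))
    have h4 : Real.exp (B * q ^ 2) ≤ Real.exp B := by
      rw [Real.exp_le_exp]
      exact mul_le_of_le_one_right hB0 hq2
    have h5 : Real.exp (B * q ^ 2) * Real.exp (-(B * q ^ 2)) = 1 := by
      rw [← Real.exp_add]; simp
    have h6 := mul_le_mul_of_nonneg_left h3 (Real.exp_pos (B * q ^ 2)).le
    rw [h5] at h6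
    have h7 := mul_le_mul_of_nonneg_left h4 (by positivity : 0 ≤ B * q ^ 2)
    linarith
  linarith

/-- With s = 1+|v|² and q = 2⟨v,w⟩/s, one has 1+|v±w|² ≥ s(1±q), and the negative exponent reverses
the inequality. The condition 4|w| ≤ |v| ensures |q| ≤ 1/2. -/
theorem exists_secondDiff_equilibrium_le {γ : ℝ} (hγ : 0 < γ) :
    ∃ A : ℝ, 0 ≤ A ∧ ∀ v w : Vec d, 4 * ‖w‖ ≤ ‖v‖ →
      secondDiff (equilibrium γ) v w ≤ A * equilibrium γ v * (‖w‖ ^ 2 / (1 + ‖v‖ ^ 2)) := by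
  set a : ℝ := ((d : ℝ) + γ) / 2 with ha
  have ha0 : 0 ≤ a := by positivity
  set C := 2 * ((2 * a + a ^ 2 / 2) * Real.exp (2 * a + a ^ 2 / 2))
  have hC : 0 ≤ C := by positivity
  refine ⟨4 * C, by positivity, fun v w hw => ?_⟩
  set s := 1 + ‖v‖ ^ 2 with hs
  have hs0 : 0 < s := by positivity
  set q := 2 * inner ℝ v w / s with hq
  have hin := abs_real_inner_le_norm v w
  have hq1 : |q| ≤ 1 / 2 := by
    rw [hq, abs_div, abs_of_pos hs0, div_le_iff₀ hs0, abs_mul, abs_two]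
    nlinarith [norm_nonneg v, norm_nonneg w]
  have hq2 : q ^ 2 ≤ 4 * (‖w‖ ^ 2 / s) := by
    rw [hq, div_pow, ← mul_div_assoc, div_le_div_iff₀ (by positivity) hs0]
    have : (inner ℝ v w) ^ 2 ≤ ‖v‖ ^ 2 * ‖w‖ ^ 2 := by
      rw [← sq_abs, ← mul_pow]
      exact pow_le_pow_left₀ (abs_nonneg _) hin 2
    have h3 : ‖v‖ ^ 2 ≤ s := by rw [hs]; linarith
    have h4 : (inner ℝ v w) ^ 2 ≤ s * ‖w‖ ^ 2 :=
      this.trans (mul_le_mul_of_nonneg_right h3 (sq_nonneg _))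
    nlinarith
  have hF : ∀ u : Vec d, equilibrium γ u = normalization d γ * (1 + ‖u‖ ^ 2) ^ (-a) := by
    intro u
    rw [equilibrium_eq, bracket_rpow_eq, ha]
    congr 2; ring
  obtain ⟨hl, hr⟩ := abs_le.1 hq1
  have hsq : s * q = 2 * inner ℝ v w := by rw [hq]; field_simp
  have hp : (1 + ‖v + w‖ ^ 2) ^ (-a) ≤ s ^ (-a) * (1 + q) ^ (-a) := by
    rw [← Real.mul_rpow hs0.le (by linarith)]
    refine Real.rpow_le_rpow_of_nonpos (by nlinarith) ?_ (by linarith)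
    rw [norm_add_sq_real]
    nlinarith [sq_nonneg ‖w‖]
  have hm : (1 + ‖v - w‖ ^ 2) ^ (-a) ≤ s ^ (-a) * (1 - q) ^ (-a) := by
    rw [← Real.mul_rpow hs0.le (by linarith)]
    refine Real.rpow_le_rpow_of_nonpos (by nlinarith) ?_ (by linarith)
    rw [norm_sub_sq_real]
    nlinarith [sq_nonneg ‖w‖]
  have hkey := rpow_neg_add_rpow_neg_le ha0 hq1
  have hsa : 0 < s ^ (-a) := Real.rpow_pos_of_pos hs0 _
  have hc := normalization_pos (d := d) hγ
  simp only [secondDiff, hF]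
  calc _ = normalization d γ * ((1 + ‖v + w‖ ^ 2) ^ (-a) + (1 + ‖v - w‖ ^ 2) ^ (-a) -
        2 * s ^ (-a)) := by ring
    _ ≤ normalization d γ * (s ^ (-a) * ((1 + q) ^ (-a) + (1 - q) ^ (-a) - 2)) := by
        gcongr; linarith
    _ ≤ normalization d γ * (s ^ (-a) * (C * (4 * (‖w‖ ^ 2 / s)))) := by
        gcongr
        exact hkey.trans (mul_le_mul_of_nonneg_left hq2 hC)
    _ = _ := by ring

/-- Split at |w| = |v|/4. Nearby jumps are controlled by `exists_secondDiff_equilibrium_le`. For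
distant jumps the term -2F(v) is dropped, the kernel is of order |v|^{-(d+σ)}, and F has finite
mass. -/
theorem exists_fracLaplacian_equilibrium_le (hd : 1 ≤ d) {γ σ : ℝ} (hγ : 0 < γ) (h0 : 0 < σ)
    (h2 : σ < 2) : ∃ C : ℝ, 0 ≤ C ∧ ∀ v : Vec d, 1 ≤ ‖v‖ →
      fracLaplacian σ (equilibrium γ) v ≤ C * ‖v‖ ^ (-((d : ℝ) + σ)) := by
  obtain ⟨A, hA0, hA⟩ := exists_secondDiff_equilibrium_le (d := d) hγ
  have hc := fracConst_pos (d := d) h0 h2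
  have hN := normalization_pos (d := d) hγ
  have hiF := integrable_equilibrium (d := d) hγ
  have hF0 : ∀ v : Vec d, 0 < equilibrium γ v := equilibrium_pos hγ
  set I := ∫ v : Vec d, equilibrium γ v with hI
  have hI0 : 0 ≤ I := integral_nonneg fun v => (hF0 v).le
  have hκi := integrable_truncKernel hd h0 h2
  set K := ∫ w, truncKernel d σ w
  have hK0 : 0 ≤ K := integral_nonneg fun w => truncKernel_nonneg σ w
  refine ⟨fracConst d σ / 2 * (A * normalization d γ * K * 4 ^ σ + 2 * I * 4 ^ ((d : ℝ) + σ)),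
    by positivity, fun v hv => ?_⟩
  have hv0 : 0 < ‖v‖ := by linarith
  set ρ := ‖v‖ / 4 with hρ
  have hρ0 : 0 < ρ := by positivity
  set P := A * equilibrium γ v / (1 + ‖v‖ ^ 2) * ρ ^ 2 with hP
  have hP0 : 0 ≤ P := by have := hF0 v; positivity
  have hpt : ∀ w : Vec d, secondDiff (equilibrium γ) v w / ‖w‖ ^ ((d : ℝ) + σ) ≤
      P * ρ ^ (-((d : ℝ) + σ)) * truncKernel d σ (ρ⁻¹ • w) +
      ρ ^ (-((d : ℝ) + σ)) * (equilibrium γ (v + w) + equilibrium γ (v - w)) := by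
    intro w
    have hρp : 0 < ρ ^ (-((d : ℝ) + σ)) := Real.rpow_pos_of_pos hρ0 _
    have hκ0 := truncKernel_nonneg σ (ρ⁻¹ • w)
    have hsum : 0 < equilibrium γ (v + w) + equilibrium γ (v - w) := add_pos (hF0 _) (hF0 _)
    rcases eq_or_ne w 0 with rfl | hw
    · have : (0 : ℝ) ^ ((d : ℝ) + σ) = 0 := Real.zero_rpow (by positivity)
      rw [norm_zero, this, div_zero]
      positivity
    have hw0 : 0 < ‖w‖ := norm_pos_iff.2 hw
    by_cases hle : ‖w‖ ≤ ρ
    · have h1 := hA v w (by rw [hρ] at hle; linarith)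
      have h3 : ‖ρ⁻¹ • w‖ = ‖w‖ / ρ := by
        rw [norm_smul, norm_inv, Real.norm_of_nonneg hρ0.le, inv_mul_eq_div]
      have h4 : P * ρ ^ (-((d : ℝ) + σ)) * truncKernel d σ (ρ⁻¹ • w) =
          A * equilibrium γ v * (‖w‖ ^ 2 / (1 + ‖v‖ ^ 2)) / ‖w‖ ^ ((d : ℝ) + σ) := by
        rw [truncKernel, h3, min_eq_right, Real.div_rpow hw0.le hρ0.le, Real.rpow_neg hρ0.le, hP]
        · field_simp
        · exact pow_le_one₀ (by positivity) ((div_le_one hρ0).2 hle)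
      rw [h4]
      have h5 : 0 ≤ ρ ^ (-((d : ℝ) + σ)) * (equilibrium γ (v + w) + equilibrium γ (v - w)) := by
        positivity
      have h6 : secondDiff (equilibrium γ) v w / ‖w‖ ^ ((d : ℝ) + σ) ≤
          A * equilibrium γ v * (‖w‖ ^ 2 / (1 + ‖v‖ ^ 2)) / ‖w‖ ^ ((d : ℝ) + σ) := by gcongr
      linarith
    · push Not at hle
      have h3 : secondDiff (equilibrium γ) v w / ‖w‖ ^ ((d : ℝ) + σ) ≤
          (equilibrium γ (v + w) + equilibrium γ (v - w)) / ρ ^ ((d : ℝ) + σ) := by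
        refine div_le_div₀ hsum.le ?_ (by positivity)
          (Real.rpow_le_rpow hρ0.le hle.le (by positivity))
        rw [secondDiff]; linarith [hF0 v]
      have h4 : 0 ≤ P * ρ ^ (-((d : ℝ) + σ)) * truncKernel d σ (ρ⁻¹ • w) := by positivity
      rw [Real.rpow_neg hρ0.le (d + σ)] at h4 ⊢
      rw [div_eq_inv_mul (equilibrium γ (v + w) + equilibrium γ (v - w))] at h3
      linarith
  have i1 : Integrable fun w : Vec d => truncKernel d σ (ρ⁻¹ • w) :=
    hκi.comp_smul (inv_ne_zero hρ0.ne')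
  have i2 : Integrable fun w : Vec d => equilibrium γ (v + w) := hiF.comp_add_left v
  have i3 : Integrable fun w : Vec d => equilibrium γ (v - w) := hiF.comp_sub_left v
  have i4 : Integrable fun w : Vec d => equilibrium γ (v + w) + equilibrium γ (v - w) := i2.add i3
  have hint := integral_mono
    (integrable_secondDiff_div hd (contDiff_equilibrium γ) hiF h0 h2 v)
    ((i1.const_mul _).add (i4.const_mul _)) hpt
  have v1 : ∫ w : Vec d, truncKernel d σ (ρ⁻¹ • w) = ρ ^ d * K := by
    rw [Measure.integral_comp_inv_smul_of_nonneg _ _ hρ0.le]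
    simp [K]
  have v2 : ∫ w : Vec d, equilibrium γ (v + w) = I :=
    integral_add_left_eq_self (fun w : Vec d => equilibrium γ w) v
  have v3 : ∫ w : Vec d, equilibrium γ (v - w) = I :=
    integral_sub_left_eq_self (fun w : Vec d => equilibrium γ w) volume v
  rw [integral_add' (i1.const_mul _) (i4.const_mul _), integral_const_mul, integral_const_mul,
    v1, integral_add i2 i3, v2, v3] at hint
  rw [fracLaplacian_eq, mul_assoc]
  refine mul_le_mul_of_nonneg_left (hint.trans ?_) (by positivity)
  have hρv : ∀ b : ℝ, ρ ^ (-b) = 4 ^ b * ‖v‖ ^ (-b) := by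
    intro b
    rw [hρ, Real.div_rpow hv0.le (by norm_num), Real.rpow_neg (by norm_num : (0 : ℝ) ≤ 4),
      div_inv_eq_mul, mul_comm]
  have hPle : P * ρ ^ (-((d : ℝ) + σ)) * ρ ^ d ≤
      A * normalization d γ * 4 ^ σ * ‖v‖ ^ (-((d : ℝ) + σ)) := by
    have h3 : ρ ^ (-((d : ℝ) + σ)) * ρ ^ d = ρ ^ (-σ) := by
      rw [← Real.rpow_natCast, ← Real.rpow_add hρ0]; congr 1; ring
    have h4 : equilibrium γ v ≤ normalization d γ * ‖v‖ ^ (-(d : ℝ)) := by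
      rw [equilibrium_eq]
      gcongr
      calc bracket v ^ (-((d : ℝ) + γ)) ≤ bracket v ^ (-(d : ℝ)) :=
            Real.rpow_le_rpow_of_exponent_le (one_le_bracket v) (by linarith)
        _ ≤ ‖v‖ ^ (-(d : ℝ)) :=
            Real.rpow_le_rpow_of_nonpos hv0 (norm_le_bracket v) (by simp)
    have h5 : ρ ^ 2 / (1 + ‖v‖ ^ 2) ≤ 1 := by
      rw [div_le_one (by positivity), hρ]; nlinarith
    have h6 : ‖v‖ ^ (-((d : ℝ) + σ)) = ‖v‖ ^ (-(d : ℝ)) * ‖v‖ ^ (-σ) := by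
      rw [← Real.rpow_add hv0]; congr 1; ring
    rw [mul_assoc, h3, hρv σ, h6]
    calc _ = A * equilibrium γ v * (ρ ^ 2 / (1 + ‖v‖ ^ 2)) * (4 ^ σ * ‖v‖ ^ (-σ)) := by
          rw [hP]; ring
      _ ≤ A * (normalization d γ * ‖v‖ ^ (-(d : ℝ))) * 1 * (4 ^ σ * ‖v‖ ^ (-σ)) := by
          gcongr
      _ = _ := by ring
  have h7 := mul_le_mul_of_nonneg_right hPle hK0
  rw [hρv ((d : ℝ) + σ)] at h7 ⊢
  linarith

theorem bracket_eq_of_norm_eq {v w : Vec d} (h : ‖v‖ = ‖w‖) : bracket v = bracket w := by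
  rw [bracket, bracket, h]

theorem equilibrium_eq_of_norm_eq (γ : ℝ) {v w : Vec d} (h : ‖v‖ = ‖w‖) :
    equilibrium γ v = equilibrium γ w := by
  rw [equilibrium_eq, equilibrium_eq, bracket_eq_of_norm_eq h]

/-- The divergence of a radial vector field, computed along the half-line spanned by a basis
vector. -/
theorem divergence_radial {X : Vec d → Vec d} (hX : ContDiff ℝ 1 X) {p : Vec d → ℝ}
    (hp : ∀ v, X v = p v • v) (i₀ : Fin d) {r : ℝ} (hr : 0 < r) :
    HasDerivAt (fun t : ℝ => X (t • EuclideanSpace.single i₀ 1) i₀)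
      (divergence X (r • EuclideanSpace.single i₀ 1) -
        (d - 1) * (X (r • EuclideanSpace.single i₀ 1) i₀ / r)) r := by
  set e : Fin d → Vec d := fun i => EuclideanSpace.single i (1 : ℝ) with he
  change HasDerivAt (fun t : ℝ => X (t • e i₀) i₀)
      (divergence X (r • e i₀) - (d - 1) * (X (r • e i₀) i₀ / r)) r
  have hXd : Differentiable ℝ X := hX.differentiable one_ne_zero
  have hcoord : ∀ (j : Fin d) (y : Vec d), HasFDerivAt (fun w => X w j)
      ((EuclideanSpace.proj (𝕜 := ℝ) j : Vec d →L[ℝ] ℝ).comp (fderiv ℝ X y)) y := fun j y =>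
    (EuclideanSpace.proj (𝕜 := ℝ) j : Vec d →L[ℝ] ℝ).hasFDerivAt.comp y (hXd y).hasFDerivAt
  have hline : HasDerivAt (fun t : ℝ => t • e i₀) (e i₀) r := by
    simpa using (hasDerivAt_id r).smul_const (e i₀)
  have h1 : HasDerivAt (fun t : ℝ => X (t • e i₀) i₀) ((fderiv ℝ X (r • e i₀) (e i₀)) i₀) r := by
    have h := (hcoord i₀ (r • e i₀)).comp_hasDerivAt r hline
    exact h
  -- Moving transversally by s, a radial field has the i-th coordinate s/r times the i₀-th one. Only
  -- this ratio is differentiated, so `p` itself need not be differentiable.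
  have hother : ∀ i, i ≠ i₀ →
      (fderiv ℝ X (r • e i₀) (e i)) i = X (r • e i₀) i₀ / r := by
    intro i hi
    have hline' : HasDerivAt (fun s : ℝ => r • e i₀ + s • e i) (e i) 0 := by
      simpa using ((hasDerivAt_id (0 : ℝ)).smul_const (e i)).const_add (r • e i₀)
    have hy : r • e i₀ + (0 : ℝ) • e i = r • e i₀ := by simp
    have h2 : HasDerivAt (fun s : ℝ => X (r • e i₀ + s • e i) i)
        ((fderiv ℝ X (r • e i₀) (e i)) i) 0 := by
      have := hcoord i (r • e i₀ + (0 : ℝ) • e i)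
      have h := this.comp_hasDerivAt 0 hline'
      rw [hy] at h
      exact h
    have h3 : HasDerivAt (fun s : ℝ => X (r • e i₀ + s • e i) i₀)
        ((fderiv ℝ X (r • e i₀) (e i)) i₀) 0 := by
      have := hcoord i₀ (r • e i₀ + (0 : ℝ) • e i)
      have h := this.comp_hasDerivAt 0 hline'
      rw [hy] at h
      exact h
    have h4 : (fun s : ℝ => X (r • e i₀ + s • e i) i) =
        fun s : ℝ => s * (X (r • e i₀ + s • e i) i₀ / r) := by
      ext s
      rw [hp]
      simp [he, hi, hi.symm]
      field_simp
    have h5 := (hasDerivAt_id (0 : ℝ)).mul (h3.div_const r)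
    rw [h4] at h2
    have h6 := h2.unique h5
    simpa using h6
  have hdiv : divergence X (r • e i₀) =
      (fderiv ℝ X (r • e i₀) (e i₀)) i₀ + (d - 1) * (X (r • e i₀) i₀ / r) := by
    unfold divergence
    rw [← Finset.add_sum_erase _ _ (Finset.mem_univ i₀)]
    congr 1
    rw [Finset.sum_congr rfl fun i hi => hother i (Finset.ne_of_mem_erase hi)]
    rw [Finset.sum_const, Finset.card_erase_of_mem (Finset.mem_univ i₀), Finset.card_univ,
      Fintype.card_fin, nsmul_eq_mul, Nat.cast_pred (Fin.pos i₀)]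
  rw [hdiv]
  convert h1 using 1
  ring

theorem divergence_id (v : Vec d) : divergence (fun w : Vec d => w) v = d := by
  simp [divergence]

theorem integral_cutoff {R : ℝ} (hR : 0 < R) :
    ∫ v : Vec d, cutoff R v = R ^ d * ∫ v : Vec d, bump v := by
  have := Measure.integral_comp_inv_smul_of_nonneg (volume : Measure (Vec d)) bump hR.le
  simpa [cutoff] using this

theorem integral_bump_pos : 0 < ∫ v : Vec d, bump v := by
  have hc : Continuous (bump : Vec d → ℝ) := (contDiff_bump (n := 0)).continuous
  refine hc.integral_pos_of_hasCompactSupport_nonneg_nonzero hasCompactSupport_bump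
    (fun v => Real.smoothTransition.nonneg _) (x := 0) ?_
  rw [bump_eq_one (by simp)]
  exact one_ne_zero

theorem integral_fderiv_cutoff_self {R : ℝ} (hR : 0 < R) :
    ∫ v : Vec d, fderiv ℝ (cutoff R) v v = -(d * (R ^ d * ∫ v : Vec d, bump v)) := by
  have := integral_cutoff_mul_divergence (d := d) contDiff_id hR
  have h2 : ∀ v : Vec d, divergence (id : Vec d → Vec d) v = d := divergence_id
  simp only [h2, integral_mul_const, integral_cutoff hR, id] at this
  linarith

/-- The radial flux Q(r) = r^{d-1} (FE)·e satisfies Q' = -r^{d-1} Δ^{σ/2}F ≥ -C r^{-σ-1}, so W = Q -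
(C/σ) r^{-σ} is nondecreasing on [1,∞). If W were positive somewhere, Q would stay above some c > 0.
Stationarity tested against cut-offs would then keep ∫ F Δ^{σ/2}χ_R below a fixed negative number,
although it tends to 0. Hence W ≤ 0. -/
theorem exists_frictionForce_bound (hd : 1 ≤ d) {γ σ : ℝ} (hγ : 0 < γ) (h0 : 0 < σ) (h2 : σ < 2)
    {E : Vec d → Vec d} (hE : IsFrictionForce γ σ E) {G : ℝ → ℝ} (hG : ∀ v, E v = G ‖v‖ • v) :
    ∃ C : ℝ, 0 ≤ C ∧ ∀ v : Vec d, 1 ≤ ‖v‖ →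
      equilibrium γ v * G ‖v‖ * ‖v‖ ^ (d : ℝ) ≤ C * ‖v‖ ^ (-σ) := by
  obtain ⟨C, hC0, hC⟩ := exists_fracLaplacian_equilibrium_le hd hγ h0 h2
  set i₀ : Fin d := ⟨0, hd⟩
  set e : Vec d := EuclideanSpace.single i₀ (1 : ℝ) with he
  have hen : ∀ r : ℝ, 0 ≤ r → ‖r • e‖ = r := fun r hr => by
    simp [norm_smul, he, abs_of_nonneg hr]
  let X : Vec d → Vec d := fun v => equilibrium γ v • E v
  have hX : ContDiff ℝ 1 X := (contDiff_equilibrium γ).smul hE.contDiff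
  have hXp : ∀ v, X v = (equilibrium γ v * G ‖v‖) • v := fun v => by
    simp only [X]; rw [hG v, smul_smul]
  have hdivX : ∀ v, divergence X v = -fracLaplacian σ (equilibrium γ) v := fun v => by
    have := hE.stationary v
    rw [fracFokkerPlanck] at this
    linarith
  let Q : ℝ → ℝ := fun r => r ^ ((d : ℝ) - 1) * X (r • e) i₀
  have hQval : ∀ v : Vec d, 0 < ‖v‖ →
      Q ‖v‖ = equilibrium γ v * G ‖v‖ * ‖v‖ ^ (d : ℝ) := by
    intro v hv
    have h3 : ‖‖v‖ • e‖ = ‖v‖ := hen _ hv.le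
    simp only [Q]
    rw [hXp, h3, equilibrium_eq_of_norm_eq γ h3, Real.rpow_sub_one hv.ne']
    simp [he]
    field_simp
  have hQd : ∀ r : ℝ, 0 < r → HasDerivAt Q (r ^ ((d : ℝ) - 1) * divergence X (r • e)) r := by
    intro r hr
    have h3 := (Real.hasDerivAt_rpow_const (p := (d : ℝ) - 1) (Or.inl hr.ne')).mul
      (divergence_radial hX hXp i₀ hr)
    refine h3.congr_deriv ?_
    rw [Real.rpow_sub_one hr.ne' ((d : ℝ) - 1)]
    field_simp
    ring
  let W : ℝ → ℝ := fun r => Q r - C / σ * r ^ (-σ)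
  have hWd : ∀ r : ℝ, 0 < r → HasDerivAt W
      (r ^ ((d : ℝ) - 1) * divergence X (r • e) + C * r ^ (-σ - 1)) r := by
    intro r hr
    have h3 := (hQd r hr).sub
      ((Real.hasDerivAt_rpow_const (p := -σ) (Or.inl hr.ne')).const_mul (C / σ))
    refine h3.congr_deriv ?_
    field_simp
    ring
  have hWmono : MonotoneOn W (Set.Ici 1) := by
    refine monotoneOn_of_deriv_nonneg (convex_Ici 1) ?_ ?_ ?_
    · intro r hr
      exact (hWd r (zero_lt_one.trans_le hr)).continuousAt.continuousWithinAt
    · intro r hr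
      rw [interior_Ici] at hr
      exact (hWd r (zero_lt_one.trans hr)).differentiableAt.differentiableWithinAt
    · intro r hr
      rw [interior_Ici] at hr
      have hr0 : 0 < r := zero_lt_one.trans hr
      have h3 := hC (r • e) (by rw [hen r hr0.le]; exact le_of_lt hr)
      rw [hen r hr0.le] at h3
      rw [(hWd r hr0).deriv, hdivX]
      have h4 : r ^ ((d : ℝ) - 1) * r ^ (-((d : ℝ) + σ)) = r ^ (-σ - 1) := by
        rw [← Real.rpow_add hr0]; congr 1; ring
      have h5 := mul_le_mul_of_nonneg_left h3 (Real.rpow_pos_of_pos hr0 ((d : ℝ) - 1)).le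
      rw [mul_left_comm, h4] at h5
      linarith
  have hWle : ∀ r : ℝ, 1 ≤ r → W r ≤ 0 := by
    by_contra! hcon
    obtain ⟨r₀, hr₀, hpos⟩ := hcon
    set c := W r₀
    have hQc : ∀ r : ℝ, r₀ ≤ r → c ≤ Q r := by
      intro r hr
      have h3 := hWmono hr₀ (hr₀.trans hr : (1 : ℝ) ≤ r) hr
      have h4 : 0 ≤ C / σ * r ^ (-σ) := by
        have : 0 < r := by linarith
        positivity
      simp only [W] at h3 ⊢
      linarith
    have hi := integrable_equilibrium (d := d) hγ
    have hlim := tendsto_integral_mul_fracLaplacian_cutoff hd hi h0 h2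
    -- The outward flux seen by any cut-off: ∫ ∇χ_R·v is of order -R^d, while F G is at least c
    -- (2R)^{-d} where ∇χ_R does not vanish.
    set κ := c * (2 ^ d)⁻¹ * (d * ∫ v : Vec d, bump v)
    have hκ : 0 < κ := by
      have := integral_bump_pos (d := d)
      have : (0 : ℝ) < d := by exact_mod_cast hd
      positivity
    obtain ⟨N, hN⟩ := exists_nat_ge r₀
    have hbound : ∀ n : ℕ, N ≤ n →
        ∫ v : Vec d, equilibrium γ v * fracLaplacian σ (cutoff (n + 1 : ℝ)) v ≤ -κ := by
      intro n hn
      set R : ℝ := n + 1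
      have hR1 : 1 ≤ R := by simp [R]
      have hR0 : 0 < R := by linarith
      have hRr : r₀ ≤ R := by
        have : (N : ℝ) ≤ n := by exact_mod_cast hn
        simp only [R]; linarith
      have hE' := hE.contDiff
      have htest := (integral_cutoff_mul_fracFokkerPlanck hd (contDiff_equilibrium (d := d) γ)
        hi hE' h0 h2 hR1).2
      simp only [hE.stationary, mul_zero, integral_zero] at htest
      have hcf : Continuous (fderiv ℝ (cutoff R : Vec d → ℝ)) :=
        (contDiff_cutoff R (n := 1)).continuous_fderiv one_ne_zero
      have hzero : ∀ v : Vec d, v ∉ Metric.closedBall (0 : Vec d) (2 * R) →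
          fderiv ℝ (cutoff R : Vec d → ℝ) v = 0 := fun v hv => by
        rw [mem_closedBall_zero_iff, not_le] at hv
        exact fderiv_cutoff_eq_zero_of_gt hR0 hv
      have j1 : Integrable fun v : Vec d => fderiv ℝ (cutoff R) v v := by
        refine Continuous.integrable_of_hasCompactSupport (by fun_prop) ?_
        exact HasCompactSupport.intro (isCompact_closedBall 0 (2 * R)) fun v hv => by
          rw [hzero v hv]; rfl
      have j2 : Integrable fun v : Vec d => equilibrium γ v * fderiv ℝ (cutoff R) v (E v) := by
        have hFc := continuous_equilibrium (d := d) γ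
        have hEc := hE'.continuous
        refine Continuous.integrable_of_hasCompactSupport (by fun_prop) ?_
        exact HasCompactSupport.intro (isCompact_closedBall 0 (2 * R)) fun v hv => by
          rw [hzero v hv]; simp
      have hpt : ∀ v : Vec d, equilibrium γ v * fderiv ℝ (cutoff R) v (E v) ≤
          c * ((2 * R) ^ d)⁻¹ * fderiv ℝ (cutoff R) v v := by
        intro v
        by_cases hv1 : ‖v‖ < R
        · rw [fderiv_cutoff_eq_zero_of_lt hR0 hv1]; simp
        by_cases hv2 : 2 * R < ‖v‖
        · rw [fderiv_cutoff_eq_zero_of_gt hR0 hv2]; simp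
        push Not at hv1 hv2
        have hv0 : 0 < ‖v‖ := hR0.trans_le hv1
        have h3 := hQc ‖v‖ (hRr.trans hv1)
        rw [hQval v hv0, Real.rpow_natCast] at h3
        have h4 : c * ((2 * R) ^ d)⁻¹ ≤ equilibrium γ v * G ‖v‖ := by
          rw [← div_eq_mul_inv]
          calc c / (2 * R) ^ d ≤ c / ‖v‖ ^ d := by gcongr
            _ ≤ _ := by rwa [div_le_iff₀ (by positivity)]
        rw [hG v, map_smul, smul_eq_mul, ← mul_assoc]
        exact mul_le_mul_of_nonpos_right h4 (fderiv_cutoff_self_nonpos R v)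
      have hle := integral_mono j2 (j1.const_mul _) hpt
      rw [integral_const_mul, integral_fderiv_cutoff_self hR0] at hle
      have h5 : c * ((2 * R) ^ d)⁻¹ * -(d * (R ^ d * ∫ v : Vec d, bump v)) = -κ := by
        simp only [κ]
        rw [mul_pow]
        field_simp
      rw [h5] at hle
      linarith
    have h6 : (0 : ℝ) ≤ -κ :=
      le_of_tendsto hlim (eventually_atTop.2 ⟨N, fun n hn => hbound n hn⟩)
    linarith
  refine ⟨C / σ, by positivity, fun v hv => ?_⟩
  have h3 := hWle ‖v‖ hv
  simp only [W] at h3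
  rw [hQval v (by linarith)] at h3
  linarith

/-- Divides the flux bound by F: the order is |v|^{-(d+σ)} ⟨v⟩^{d+γ}, that is ⟨v⟩^{γ-σ}, which is
⟨v⟩^{-β}. -/
theorem exists_frictionForce_bracket_bound (hd : 1 ≤ d) {γ σ : ℝ} (hγ : 0 < γ) (h0 : 0 < σ)
    (h2 : σ < 2) {E : Vec d → Vec d} (hE : IsFrictionForce γ σ E) {G : ℝ → ℝ}
    (hG : ∀ v, E v = G ‖v‖ • v) :
    ∃ C : ℝ, 0 ≤ C ∧ ∀ v : Vec d, 1 ≤ ‖v‖ → G ‖v‖ ≤ C * bracket v ^ (γ - σ) := by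
  obtain ⟨C, hC0, hC⟩ := exists_frictionForce_bound hd hγ h0 h2 hE hG
  have hN := normalization_pos (d := d) hγ
  refine ⟨C / normalization d γ * 2 ^ ((d : ℝ) + σ), by positivity, fun v hv => ?_⟩
  have hv0 : 0 < ‖v‖ := by linarith
  have hb := bracket_pos v
  have h1 := hC v hv
  have h3 : bracket v ≤ 2 * ‖v‖ := by
    refine abs_le_of_sq_le_sq' ?_ (by positivity) |>.2
    rw [bracket_sq]; nlinarith
  have h4 : ‖v‖ ^ (-((d : ℝ) + σ)) ≤ 2 ^ ((d : ℝ) + σ) * bracket v ^ (-((d : ℝ) + σ)) := by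
    have := Real.rpow_le_rpow_of_nonpos hb h3 (by linarith [(Nat.cast_nonneg d : (0 : ℝ) ≤ d)] :
      -((d : ℝ) + σ) ≤ 0)
    rw [Real.mul_rpow (by norm_num) hv0.le, Real.rpow_neg (by norm_num : (0 : ℝ) ≤ 2),
      inv_mul_le_iff₀ (by positivity)] at this
    exact this
  have h5 : equilibrium γ v * G ‖v‖ ≤ C * ‖v‖ ^ (-((d : ℝ) + σ)) := by
    have h6 : ‖v‖ ^ (-((d : ℝ) + σ)) = ‖v‖ ^ (-σ) / ‖v‖ ^ (d : ℝ) := by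
      rw [← Real.rpow_sub hv0]; congr 1; ring
    rw [h6, ← mul_div_assoc, le_div_iff₀ (by positivity)]
    exact h1
  have h7 := h5.trans (mul_le_mul_of_nonneg_left h4 hC0)
  rw [equilibrium_eq, Real.rpow_neg hb.le] at h7
  have h8 : bracket v ^ (γ - σ) = bracket v ^ ((d : ℝ) + γ) * bracket v ^ (-((d : ℝ) + σ)) := by
    rw [← Real.rpow_add hb]; congr 1; ring
  rw [h8]
  have h9 : normalization d γ * (bracket v ^ ((d : ℝ) + γ))⁻¹ * G ‖v‖ =
      G ‖v‖ * (normalization d γ / bracket v ^ ((d : ℝ) + γ)) := by ring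
  rw [h9, ← le_div_iff₀ (by positivity)] at h7
  refine h7.trans_eq ?_
  field_simp

/-- In the weak form, the fractional part tends to 0. The drift part is h G (-∇χ_R·v) with -∇χ_R·v
in [0, 2M], supported in R ≤ |v| ≤ 2R. The upper bound on G makes it at most a tail of the integral
of ⟨v⟩^k h. -/
theorem integral_cutoff_mul_fracFokkerPlanck_le (hd : 1 ≤ d) {γ σ k : ℝ} (hγ : 0 < γ) (h0 : 0 < σ)
    (h2 : σ < 2) (hk : 0 ≤ k) (hk' : γ - σ ≤ k) {E : Vec d → Vec d} (hE : IsFrictionForce γ σ E)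
    {h : Vec d → ℝ} (hh : ContDiff ℝ 2 h) (hh0 : ∀ v, 0 ≤ h v)
    (hi : Integrable fun v => bracket v ^ k * h v) :
    ∃ err : ℕ → ℝ, Tendsto err atTop (𝓝 0) ∧
      ∀ n : ℕ, ∫ v, cutoff (n + 1 : ℝ) v * fracFokkerPlanck σ E h v ≤ err n := by
  obtain ⟨G, hG⟩ := hE.radial
  obtain ⟨C, hC0, hC⟩ := exists_frictionForce_bracket_bound hd hγ h0 h2 hE hG
  obtain ⟨M, hM0, hM⟩ := exists_fderiv_cutoff_bound (d := d)
  have hhi : Integrable h := by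
    refine hi.mono' hh.continuous.aestronglyMeasurable (.of_forall fun v => ?_)
    rw [Real.norm_of_nonneg (hh0 v)]
    exact le_mul_of_one_le_left (hh0 v) (Real.one_le_rpow (one_le_bracket v) hk)
  let T : ℕ → Vec d → ℝ := fun n => Set.indicator {v | (n : ℝ) + 1 ≤ ‖v‖}
    (fun v => 2 * M * C * (bracket v ^ k * h v))
  have hTm : ∀ n : ℕ, MeasurableSet {v : Vec d | (n : ℝ) + 1 ≤ ‖v‖} := fun n =>
    measurableSet_le measurable_const measurable_norm
  have hTi : ∀ n, Integrable (T n) := fun n => (hi.const_mul _).indicator (hTm n)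
  have hT0 : Tendsto (fun n => ∫ v, T n v) atTop (𝓝 0) := by
    have := tendsto_integral_of_dominated_convergence (f := fun _ : Vec d => (0 : ℝ)) (F := T)
      _ (fun n => (hTi n).1) (hi.const_mul (2 * M * C)).norm
      (fun n => .of_forall fun v => norm_indicator_le_norm_self _ _) (.of_forall fun v => by
        obtain ⟨N, hN⟩ := exists_nat_ge ‖v‖
        refine tendsto_const_nhds.congr' ?_
        filter_upwards [eventually_ge_atTop N] with n hn
        have : (N : ℝ) ≤ n := by exact_mod_cast hn
        simp only [T]
        rw [Set.indicator_of_notMem]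
        simp only [Set.mem_ofPred_eq, not_le]
        linarith)
    simpa using this
  refine ⟨fun n => (∫ v, h v * fracLaplacian σ (cutoff (n + 1 : ℝ)) v) + ∫ v, T n v, ?_,
    fun n => ?_⟩
  · simpa using (tendsto_integral_mul_fracLaplacian_cutoff hd hhi h0 h2).add hT0
  · set R : ℝ := n + 1
    have hR1 : 1 ≤ R := by simp [R]
    have hR0 : 0 < R := by linarith
    rw [(integral_cutoff_mul_fracFokkerPlanck hd hh hhi hE.contDiff h0 h2 hR1).2, sub_eq_add_neg,
      ← integral_neg]
    refine add_le_add le_rfl (integral_mono ?_ (hTi n) fun v => ?_)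
    · have hcf : Continuous (fderiv ℝ (cutoff R : Vec d → ℝ)) :=
        (contDiff_cutoff R (n := 1)).continuous_fderiv one_ne_zero
      have hEc := hE.contDiff.continuous
      have hhc := hh.continuous
      refine Integrable.neg ?_
      refine Continuous.integrable_of_hasCompactSupport (by fun_prop) ?_
      exact HasCompactSupport.intro (isCompact_closedBall 0 (2 * R)) fun v hv => by
        rw [mem_closedBall_zero_iff, not_le] at hv
        rw [fderiv_cutoff_eq_zero_of_gt hR0 hv]; simp
    · have hTv : 0 ≤ T n v := by
        refine Set.indicator_nonneg (fun v _ => ?_) v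
        have := bracket_rpow_pos k v
        have := hh0 v
        positivity
      by_cases hv1 : ‖v‖ < R
      · rw [fderiv_cutoff_eq_zero_of_lt hR0 hv1]; simpa using hTv
      by_cases hv2 : 2 * R < ‖v‖
      · rw [fderiv_cutoff_eq_zero_of_gt hR0 hv2]; simpa using hTv
      push Not at hv1 hv2
      have hTval : T n v = 2 * M * C * (bracket v ^ k * h v) := 
        Set.indicator_of_mem (show v ∈ {v : Vec d | (n : ℝ) + 1 ≤ ‖v‖} from hv1) _
      have h3 := fderiv_cutoff_self_nonpos R v
      have h4 : -fderiv ℝ (cutoff R) v v ≤ 2 * M := by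
        have h5 := (fderiv ℝ (cutoff R) v).le_of_opNorm_le (hM R hR0 v) v
        have h6 := neg_le_abs (fderiv ℝ (cutoff R) v v)
        rw [Real.norm_eq_abs] at h5
        calc _ ≤ M / R * ‖v‖ := h6.trans h5
          _ ≤ M / R * (2 * R) := by gcongr
          _ = 2 * M := by field_simp
      have h5 : G ‖v‖ ≤ C * bracket v ^ k :=
        (hC v (hR1.trans hv1)).trans (mul_le_mul_of_nonneg_left
          (Real.rpow_le_rpow_of_exponent_le (one_le_bracket v) hk') hC0)
      have hb := bracket_rpow_pos k v
      rw [hG v, map_smul, smul_eq_mul, hTval]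
      calc -(h v * (G ‖v‖ * fderiv ℝ (cutoff R) v v))
          = h v * (G ‖v‖ * -fderiv ℝ (cutoff R) v v) := by ring
        _ ≤ h v * ((C * bracket v ^ k) * -fderiv ℝ (cutoff R) v v) := by
            have h6 := hh0 v
            gcongr
            linarith
        _ ≤ h v * ((C * bracket v ^ k) * (2 * M)) := by
            have h6 := hh0 v
            gcongr
        _ = _ := by ring

/-! ### The quadratic form of the fractional Fokker-Planck operator -/

/-- The density of the quadratic form of the fractional Fokker-Planck operator, where `g` is the
quotient by the equilibrium. -/
noncomputable def fracEnergyDensity (γ σ : ℝ) (g : Vec d → ℝ) (v : Vec d) : ℝ :=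
  fracConst d σ / 4 * ∫ w : Vec d, (equilibrium γ (v + w) * (g v - g (v + w)) ^ 2 +
    equilibrium γ (v - w) * (g v - g (v - w)) ^ 2) / ‖w‖ ^ ((d : ℝ) + σ)

section Slice

variable {γ σ : ℝ} {u : Vec d → ℝ}

/-- The pointwise carré du champ identity, from expanding F(v±w)(g(v) - g(v±w))² = h(v±w) + g(v)²
F(v±w) - 2 g(v) u(v±w) with h = u²/F; the three terms taken at w = 0 cancel. -/
theorem fracEnergy_integrand_eq (hγ : 0 < γ) (v w : Vec d) :
    (equilibrium γ (v + w) * (u v / equilibrium γ v - u (v + w) / equilibrium γ (v + w)) ^ 2 +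
      equilibrium γ (v - w) * (u v / equilibrium γ v - u (v - w) / equilibrium γ (v - w)) ^ 2) /
        ‖w‖ ^ ((d : ℝ) + σ) =
    secondDiff (fun y => u y ^ 2 / equilibrium γ y) v w / ‖w‖ ^ ((d : ℝ) + σ) +
      (u v / equilibrium γ v) ^ 2 * (secondDiff (equilibrium γ) v w / ‖w‖ ^ ((d : ℝ) + σ)) -
      2 * (u v / equilibrium γ v) * (secondDiff u v w / ‖w‖ ^ ((d : ℝ) + σ)) := by
  rw [← mul_div_assoc, ← mul_div_assoc, ← add_div, ← sub_div]
  congr 1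
  have h1 := equilibrium_pos hγ v
  have h2 := equilibrium_pos hγ (v + w)
  have h3 := equilibrium_pos hγ (v - w)
  simp only [secondDiff]
  field_simp
  ring

theorem integrable_fracEnergy_integrand (hd : 1 ≤ d) (hγ : 0 < γ) (h0 : 0 < σ) (h2 : σ < 2)
    (hu : ContDiff ℝ 2 u) (hui : Integrable u)
    (hhi : Integrable fun y => u y ^ 2 / equilibrium γ y) (v : Vec d) :
    Integrable fun w : Vec d => (equilibrium γ (v + w) *
      (u v / equilibrium γ v - u (v + w) / equilibrium γ (v + w)) ^ 2 + equilibrium γ (v - w) *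
        (u v / equilibrium γ v - u (v - w) / equilibrium γ (v - w)) ^ 2) /
          ‖w‖ ^ ((d : ℝ) + σ) := by
  have hh : ContDiff ℝ 2 fun y => u y ^ 2 / equilibrium γ y :=
    (hu.pow 2).div (contDiff_equilibrium γ) fun v => (equilibrium_pos hγ v).ne'
  simp only [fracEnergy_integrand_eq hγ]
  exact ((integrable_secondDiff_div hd hh hhi h0 h2 v).add
    ((integrable_secondDiff_div hd (contDiff_equilibrium γ) (integrable_equilibrium hγ)
      h0 h2 v).const_mul _)).sub ((integrable_secondDiff_div hd hu hui h0 h2 v).const_mul _)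

/-- The identity g L₃u = -e + ½ L₃(u²/F). The difference of the drift terms, g div(gX) - ½ div(g²X)
with X = F E, is ½ g² div X, and stationarity of F cancels it against ½ g² Δ^{σ/2}F. -/
theorem slicePairing_fracFokkerPlanck (hd : 1 ≤ d) (hγ : 0 < γ) (h0 : 0 < σ) (h2 : σ < 2)
    {E : Vec d → Vec d} (hE : IsFrictionForce γ σ E)
    (hu : ContDiff ℝ 2 u) (hui : Integrable u)
    (hhi : Integrable fun y => u y ^ 2 / equilibrium γ y) (v : Vec d) :
    slicePairing γ (fracFokkerPlanck σ E) u v =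
      -fracEnergyDensity γ σ (fun y => u y / equilibrium γ y) v +
        1 / 2 * fracFokkerPlanck σ E (fun y => u y ^ 2 / equilibrium γ y) v := by
  set F : Vec d → ℝ := equilibrium γ
  set g : Vec d → ℝ := fun y => u y / F y
  set h : Vec d → ℝ := fun y => u y ^ 2 / F y
  have hF0 : ∀ y : Vec d, 0 < F y := equilibrium_pos hγ
  have hF : ContDiff ℝ 2 F := contDiff_equilibrium γ
  have hg : ContDiff ℝ 2 g := hu.div hF fun v => (hF0 v).ne'
  have hh : ContDiff ℝ 2 h := (hu.pow 2).div hF fun v => (hF0 v).ne'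
  have i1 := integrable_secondDiff_div hd hh hhi h0 h2 v
  have i2 := integrable_secondDiff_div hd hF (integrable_equilibrium hγ) h0 h2 v
  have i3 := integrable_secondDiff_div hd hu hui h0 h2 v
  have hlap : fracEnergyDensity γ σ g v = 1 / 2 * fracLaplacian σ h v +
      1 / 2 * g v ^ 2 * fracLaplacian σ F v - g v * fracLaplacian σ u v := by
    have e1 : ∫ w : Vec d, (F (v + w) * (g v - g (v + w)) ^ 2 +
        F (v - w) * (g v - g (v - w)) ^ 2) / ‖w‖ ^ ((d : ℝ) + σ) =
        (∫ w : Vec d, secondDiff h v w / ‖w‖ ^ ((d : ℝ) + σ)) +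
        g v ^ 2 * (∫ w : Vec d, secondDiff F v w / ‖w‖ ^ ((d : ℝ) + σ)) -
        2 * g v * ∫ w : Vec d, secondDiff u v w / ‖w‖ ^ ((d : ℝ) + σ) := by
      have i12 : Integrable fun w : Vec d => secondDiff h v w / ‖w‖ ^ ((d : ℝ) + σ) +
          g v ^ 2 * (secondDiff F v w / ‖w‖ ^ ((d : ℝ) + σ)) := i1.add (i2.const_mul _)
      rw [← integral_const_mul, ← integral_const_mul, ← integral_add i1 (i2.const_mul _),
        ← integral_sub i12 (i3.const_mul _)]
      exact integral_congr_ae (.of_forall fun w => fracEnergy_integrand_eq hγ v w)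
    rw [fracEnergyDensity, e1, fracLaplacian_eq, fracLaplacian_eq, fracLaplacian_eq]
    ring
  let X : Vec d → Vec d := fun w => F w • E w
  have hX : DifferentiableAt ℝ X v :=
    ((hF.of_le (by norm_num)).smul hE.contDiff).differentiable one_ne_zero v
  have hgd : DifferentiableAt ℝ g v := hg.differentiable (by norm_num) v
  have hdivX : divergence X v = -fracLaplacian σ F v := by
    have := hE.stationary v
    rw [fracFokkerPlanck] at this
    linarith
  have d1 : divergence (fun w => u w • E w) v =
      g v * divergence X v + fderiv ℝ g v (X v) := by
    rw [← divergence_smul hgd hX]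
    congr 1; ext1 w
    simp only [X, g]
    rw [smul_smul, div_mul_cancel₀ _ (hF0 w).ne']
  have d2 : divergence (fun w => h w • E w) v =
      g v ^ 2 * divergence X v + 2 * g v * fderiv ℝ g v (X v) := by
    have hg2 : HasFDerivAt (fun w => g w ^ 2) ((2 * g v) • fderiv ℝ g v) v := by
      simpa using hgd.hasFDerivAt.pow 2
    have := divergence_smul (a := fun w => g w ^ 2) hg2.differentiableAt hX
    rw [hg2.fderiv] at this
    refine Eq.trans ?_ this
    congr 1; ext1 w
    simp only [X, g, h]
    rw [smul_smul]
    congr 1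
    have := (hF0 w).ne'
    field_simp
  rw [slicePairing, fracFokkerPlanck, fracFokkerPlanck, d1, d2, hlap, hdivX]
  simp only [g]
  ring

theorem fracEnergyDensity_nonneg (hγ : 0 < γ) (h0 : 0 < σ) (h2 : σ < 2) (g : Vec d → ℝ)
    (v : Vec d) : 0 ≤ fracEnergyDensity γ σ g v := by
  have hc := fracConst_pos (d := d) h0 h2
  refine mul_nonneg (by positivity) (integral_nonneg fun w => ?_)
  have h1 := equilibrium_pos hγ (v + w)
  have h3 := equilibrium_pos hγ (v - w)
  simp only [Pi.zero_apply]
  positivity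

/-- The energy is unchanged when a multiple of F is subtracted from u. -/
theorem pairEnergy_le_of_const {s : ℝ} (hγ : 0 < γ) (hs : s < γ) (hu : Continuous u) (c : ℝ) :
    pairEnergy γ s u ≤ ENNReal.ofReal (4 * ∫ v : Vec d, weight γ s v) *
      ∫⁻ v, ENNReal.ofReal (weight γ s v * (u v / equilibrium γ v - c) ^ 2) := by
  have hF := continuous_equilibrium (d := d) γ
  have h1 : ∀ v, (u v - c * equilibrium γ v) / equilibrium γ v = u v / equilibrium γ v - c := by
    intro v
    have := equilibrium_pos hγ v
    field_simp
  have := pairEnergy_le_sliceNormSq hγ hs (u := fun v => u v - c * equilibrium γ v)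
    (by fun_prop : Continuous _).aestronglyMeasurable
  simp only [pairEnergy, energyIntegrand, sliceNormSq, h1, sub_sub_sub_cancel_right] at this
  exact this

/-- For v' in the unit ball, F(v') is bounded below and |v'-v| ≤ 2⟨v⟩, so the jump kernel dominates
a multiple of ⟨v⟩^{-(d+σ)}, the order of the weight with exponent γ-σ. The energy is bounded by the
deviation of g from the constant g(v'), and then averaged over v' in the ball. -/
theorem exists_pairEnergy_le_fracEnergy (hd : 1 ≤ d) (hγ : 0 < γ) (h0 : 0 < σ) (h2 : σ < 2) :
    ∃ C : ℝ, 0 < C ∧ ∀ u : Vec d → ℝ, ContDiff ℝ 2 u → Integrable u →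
      Integrable (fun y => u y ^ 2 / equilibrium γ y) →
      pairEnergy γ (γ - σ) u ≤ ENNReal.ofReal C *
        ∫⁻ v, ENNReal.ofReal (fracEnergyDensity γ σ (fun y => u y / equilibrium γ y) v) := by
  have hc := fracConst_pos (d := d) h0 h2
  have hN := normalization_pos (d := d) hγ
  have hW := integral_weight_pos (d := d) hγ (s := γ - σ) (by linarith)
  set W := ∫ v : Vec d, weight γ (γ - σ) v
  -- a lower bound for the kernel when `v'` is in the unit ball
  set κ := fracConst d σ / 4 * ((2 : ℝ) ^ (-((d : ℝ) + γ)) * 2 ^ (-((d : ℝ) + σ))) with hκ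
  have hκ0 : 0 < κ := by positivity
  set B := Metric.closedBall (0 : Vec d) 1
  set b := (volume B).toReal with hb
  have hBtop : volume B ≠ ⊤ := (isCompact_closedBall (0 : Vec d) 1).measure_lt_top.ne
  have hb0 : 0 < b :=
    ENNReal.toReal_pos (Metric.measure_closedBall_pos volume _ one_pos).ne' hBtop
  have hbB : volume B = ENNReal.ofReal b := (ENNReal.ofReal_toReal hBtop).symm
  refine ⟨4 * W / (κ * b), by positivity, fun u hu hui hhi => ?_⟩
  set g : Vec d → ℝ := fun y => u y / equilibrium γ y
  have hF0 : ∀ y : Vec d, 0 < equilibrium γ y := equilibrium_pos hγ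
  have hgc : Continuous g := hu.continuous.div (continuous_equilibrium γ) fun y => (hF0 y).ne'
  have hker : ∀ v v' : Vec d, v' ∈ B → κ * (weight γ (γ - σ) v * (g v - g v') ^ 2) ≤
      fracConst d σ / 4 * (equilibrium γ v' * (g v - g v') ^ 2 / ‖v' - v‖ ^ ((d : ℝ) + σ)) := by
    intro v v' hv'
    rw [mem_closedBall_zero_iff] at hv'
    rcases eq_or_ne v' v with rfl | hne
    · simp
    have hn : 0 < ‖v' - v‖ := norm_pos_iff.2 (sub_ne_zero.2 hne)
    have hbv := one_le_bracket v
    have h3 : ‖v' - v‖ ≤ 2 * bracket v := by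
      have := norm_sub_le v' v
      have := norm_le_bracket v
      linarith
    have h4 : 2 ^ (-((d : ℝ) + σ)) * bracket v ^ (-((d : ℝ) + σ)) ≤
        (‖v' - v‖ ^ ((d : ℝ) + σ))⁻¹ := by
      rw [← Real.mul_rpow (by norm_num) (by linarith), ← Real.rpow_neg hn.le]
      exact Real.rpow_le_rpow_of_nonpos hn h3 (by linarith [(Nat.cast_nonneg d : (0 : ℝ) ≤ d)])
    have h5 : normalization d γ * 2 ^ (-((d : ℝ) + γ)) ≤ equilibrium γ v' := by
      rw [equilibrium_eq]
      gcongr normalization d γ * ?_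
      refine Real.rpow_le_rpow_of_nonpos (bracket_pos v') ?_
        (by linarith [(Nat.cast_nonneg d : (0 : ℝ) ≤ d)])
      refine abs_le_of_sq_le_sq' ?_ (by norm_num) |>.2
      rw [bracket_sq]
      nlinarith [norm_nonneg v']
    have h6 : weight γ (γ - σ) v = normalization d γ * bracket v ^ (-((d : ℝ) + σ)) := by
      rw [weight_eq]; congr 2; ring
    rw [h6]
    have hbp := bracket_rpow_pos (-((d : ℝ) + σ)) v
    calc _ = fracConst d σ / 4 * ((normalization d γ * 2 ^ (-((d : ℝ) + γ))) *
          (g v - g v') ^ 2 * (2 ^ (-((d : ℝ) + σ)) * bracket v ^ (-((d : ℝ) + σ)))) := by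
          rw [hκ]; ring
      _ ≤ fracConst d σ / 4 * (equilibrium γ v' *
          (g v - g v') ^ 2 * (‖v' - v‖ ^ ((d : ℝ) + σ))⁻¹) := by
          have := hF0 v'
          gcongr
      _ = _ := by rw [← div_eq_mul_inv]
  have hlow : ∀ v, ∫⁻ v' in B, ENNReal.ofReal (κ * (weight γ (γ - σ) v * (g v - g v') ^ 2)) ≤
      ENNReal.ofReal (fracEnergyDensity γ σ g v) := by
    intro v
    have hint := integrable_fracEnergy_integrand hd hγ h0 h2 hu hui hhi v
    have hpos : ∀ w : Vec d, 0 ≤ (equilibrium γ (v + w) * (g v - g (v + w)) ^ 2 +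
        equilibrium γ (v - w) * (g v - g (v - w)) ^ 2) / ‖w‖ ^ ((d : ℝ) + σ) := fun w => by
      have := hF0 (v + w)
      have := hF0 (v - w)
      positivity
    calc _ ≤ ∫⁻ v' in B, ENNReal.ofReal (fracConst d σ / 4 *
          (equilibrium γ v' * (g v - g v') ^ 2 / ‖v' - v‖ ^ ((d : ℝ) + σ))) :=
          setLIntegral_mono' measurableSet_closedBall fun v' hv' =>
            ENNReal.ofReal_le_ofReal (hker v v' hv')
      _ ≤ ∫⁻ v', ENNReal.ofReal (fracConst d σ / 4 *
          (equilibrium γ v' * (g v - g v') ^ 2 / ‖v' - v‖ ^ ((d : ℝ) + σ))) :=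
          setLIntegral_le_lintegral _ _
      _ = ∫⁻ w, ENNReal.ofReal (fracConst d σ / 4 * (equilibrium γ (v + w) *
          (g v - g (v + w)) ^ 2 / ‖w‖ ^ ((d : ℝ) + σ))) := by
          rw [← lintegral_add_left_eq_self _ v]
          simp only [add_sub_cancel_left]
      _ ≤ ∫⁻ w, ENNReal.ofReal (fracConst d σ / 4 * ((equilibrium γ (v + w) *
          (g v - g (v + w)) ^ 2 + equilibrium γ (v - w) * (g v - g (v - w)) ^ 2) /
          ‖w‖ ^ ((d : ℝ) + σ))) := by
          refine lintegral_mono fun w => ENNReal.ofReal_le_ofReal ?_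
          have := hF0 (v - w)
          gcongr
          exact le_add_of_nonneg_right (by positivity)
      _ = ENNReal.ofReal (fracEnergyDensity γ σ g v) := by
          rw [fracEnergyDensity, ← integral_const_mul, ofReal_integral_eq_lintegral_ofReal
            (hint.const_mul _) (.of_forall fun w => mul_nonneg (by positivity) (hpos w))]
  -- Integrate `pairEnergy_le_of_const` with the constant g(v') over the ball of volume `b`, then
  -- exchange the order of integration.
  have hsum : ENNReal.ofReal κ * ENNReal.ofReal b * pairEnergy γ (γ - σ) u ≤
      ENNReal.ofReal (4 * W) * ∫⁻ v, ENNReal.ofReal (fracEnergyDensity γ σ g v) := by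
    have hwc := continuous_weight (d := d) γ (γ - σ)
    calc _ = ∫⁻ _ in B, ENNReal.ofReal κ * pairEnergy γ (γ - σ) u := by
          rw [setLIntegral_const, hbB]; ring
      _ ≤ ∫⁻ v' in B, ENNReal.ofReal (4 * W) *
          ∫⁻ v, ENNReal.ofReal (κ * (weight γ (γ - σ) v * (g v - g v') ^ 2)) := by
          refine lintegral_mono fun v' => ?_
          refine (mul_le_mul_right (pairEnergy_le_of_const hγ (by linarith) hu.continuous
            (g v')) _).trans_eq ?_
          rw [mul_left_comm, ← lintegral_const_mul' _ _ ENNReal.ofReal_ne_top]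
          congr 1
          refine lintegral_congr fun v => ?_
          rw [← ENNReal.ofReal_mul hκ0.le]
      _ = ENNReal.ofReal (4 * W) * ∫⁻ v' in B,
          ∫⁻ v, ENNReal.ofReal (κ * (weight γ (γ - σ) v * (g v - g v') ^ 2)) :=
          lintegral_const_mul' _ _ ENNReal.ofReal_ne_top
      _ = ENNReal.ofReal (4 * W) * ∫⁻ v, ∫⁻ v' in B,
          ENNReal.ofReal (κ * (weight γ (γ - σ) v * (g v - g v') ^ 2)) := by
          rw [lintegral_lintegral_swap]
          refine (Continuous.measurable ?_).ennreal_ofReal.aemeasurable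
          fun_prop
      _ ≤ _ := mul_le_mul_right (lintegral_mono hlow) _
  have hκb : 0 < κ * b := by positivity
  rw [← ENNReal.ofReal_mul hκ0.le] at hsum
  rw [ENNReal.ofReal_div_of_pos hκb, ENNReal.div_eq_inv_mul, mul_assoc]
  rw [← ENNReal.mul_le_iff_le_inv (by simpa using hκb) ENNReal.ofReal_ne_top]
  exact hsum

/-- Localizes e = P + ½ L₃h: its integral against χ_n is at most that of P up to half of the
vanishing error for h = u²/F. Finiteness of the norm with weight ⟨v⟩^k supplies the integrability of
⟨v⟩^k h. -/
theorem fracFokkerPlanck_slice {k : ℝ} (hd : 1 ≤ d) (hγ : 0 < γ) (h0 : 0 < σ) (h2 : σ < 2)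
    (hk : 0 < k) (hk' : γ - σ ≤ k) {E : Vec d → Vec d} (hE : IsFrictionForce γ σ E) :
    ∃ C : ℝ, 0 < C ∧ ∀ u : Vec d → ℝ, ContDiff ℝ 2 u → sliceNormSq γ k u ≠ ⊤ →
      Integrable (slicePairing γ (fracFokkerPlanck σ E) u) →
        0 ≤ -∫ v, slicePairing γ (fracFokkerPlanck σ E) u v ∧
        pairEnergy γ (γ - σ) u ≤
          ENNReal.ofReal (C * -∫ v, slicePairing γ (fracFokkerPlanck σ E) u v) := by
  obtain ⟨C, hC, hpair⟩ := exists_pairEnergy_le_fracEnergy (d := d) hd hγ h0 h2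
  refine ⟨C, hC, fun u hu hfin hint => ?_⟩
  have hF0 : ∀ y : Vec d, 0 < equilibrium γ y := equilibrium_pos hγ
  have hum := hu.continuous.aestronglyMeasurable (μ := (volume : Measure (Vec d)))
  have hsq : ∀ s : ℝ, sliceNormSq γ s u ≠ ⊤ →
      Integrable fun v => bracket v ^ s * (u v ^ 2 / equilibrium γ v) := by
    intro s hs
    refine (integrable_of_sliceNormSq hγ hum hs).congr (.of_forall fun v => ?_)
    have := hF0 v
    simp only [weight]
    field_simp
  have hfin0 : sliceNormSq γ 0 u ≠ ⊤ := ne_top_of_le_ne_top hfin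
    (lintegral_mono fun v => ENNReal.ofReal_le_ofReal
      (mul_le_mul_of_nonneg_right (weight_mono hγ hk.le v) (sq_nonneg _)))
  have hui : Integrable u := by
    simpa using integrable_bracket_rpow_mul (s := 0) hγ hγ hum hfin0
  have hhi : Integrable fun y => u y ^ 2 / equilibrium γ y := by simpa using hsq 0 hfin0
  have hh : ContDiff ℝ 2 fun y => u y ^ 2 / equilibrium γ y :=
    (hu.pow 2).div (contDiff_equilibrium γ) fun v => (hF0 v).ne'
  obtain ⟨err, herr, hle⟩ := integral_cutoff_mul_fracFokkerPlanck_le hd hγ h0 h2 hk.le hk' hE hh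
    (fun v => div_nonneg (sq_nonneg _) (hF0 v).le) (hsq k hfin)
  set e := fracEnergyDensity γ σ (fun y => u y / equilibrium γ y)
  set h : Vec d → ℝ := fun y => u y ^ 2 / equilibrium γ y
  let P : Vec d → ℝ := fun v => -slicePairing γ (fracFokkerPlanck σ E) u v
  have hP : Integrable P := hint.neg
  have hid : ∀ v, e v = P v + 1 / 2 * fracFokkerPlanck σ E h v := by
    intro v
    have := slicePairing_fracFokkerPlanck hd hγ h0 h2 hE hu hui hhi v
    simp only [P]
    linarith
  have hiP : ∀ n : ℕ, Integrable fun v => cutoff (n + 1 : ℝ) v * P v := fun n => by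
    refine hP.norm.mono' ((continuous_cutoff _).aestronglyMeasurable.mul hP.1)
      (.of_forall fun v => ?_)
    rw [norm_mul, Real.norm_of_nonneg (cutoff_nonneg _ _)]
    exact mul_le_of_le_one_left (norm_nonneg _) (cutoff_le_one _ _)
  have hiL : ∀ n : ℕ, Integrable fun v => cutoff (n + 1 : ℝ) v * fracFokkerPlanck σ E h v :=
    fun n => (integral_cutoff_mul_fracFokkerPlanck hd hh hhi hE.contDiff h0 h2 (by simp)).1
  have hsplit : ∀ n : ℕ, (fun v => cutoff (n + 1 : ℝ) v * e v) = fun v =>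
      cutoff (n + 1 : ℝ) v * P v + 1 / 2 * (cutoff (n + 1 : ℝ) v * fracFokkerPlanck σ E h v) := by
    intro n; ext v; rw [hid]; ring
  have hfinal := nonneg_and_lintegral_le_of_localized (e := e) (P := P)
    (fracEnergyDensity_nonneg hγ h0 h2 _) hP
    (χ := fun (n : ℕ) v => cutoff (n + 1 : ℝ) v) (fun n => continuous_cutoff _)
    (fun n v => cutoff_nonneg _ v) (fun n v => cutoff_le_one _ v) tendsto_cutoff
    (fun n => by rw [hsplit]; exact (hiP n).add ((hiL n).const_mul _))
    (err := fun n => 1 / 2 * err n) (by simpa only [mul_zero] using herr.const_mul (1 / 2 : ℝ)) (fun n => by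
      rw [hsplit, integral_add (hiP n) ((hiL n).const_mul _), integral_const_mul]
      have := hle n
      linarith)
  have hneg : ∫ v, P v = -∫ v, slicePairing γ (fracFokkerPlanck σ E) u v := integral_neg _
  rw [hneg] at hfinal
  refine ⟨hfinal.1, (hpair u hu hui hhi).trans ?_⟩
  rw [ENNReal.ofReal_mul hC.le]
  exact mul_le_mul_right hfinal.2 _

end Slice

end FatTail

/-! ### The inequality for the three operators -/

theorem proposition2 (d : ℕ) (hd : 1 ≤ d) (γ β η k : ℝ) (hγ : 0 < γ) (hγβ : 0 ≤ γ + β)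
    (hη : -β ≤ η) (hηγ : η < γ) (hk : 0 < k) (hkγ : k < γ) (hηk : η < k) :
    -- Fokker-Planck operator
    (β = 2 → ∃ C : ℝ, 0 < C ∧
      ∀ f : Vec d × Vec d → ℝ, MemLp f 2 (weightedMeasure d γ k) →
        MemLp (f - proj γ η f) 2 (weightedMeasure d γ η) ∧
        ((C * weightedNorm γ η (f - proj γ η f) ^ (2 * ((k + β) / (k - η))) *
            weightedNorm γ k f ^ (-2 * ((η + β) / (k - η))) : ℝ) : EReal) ≤
          extendedDissipation γ k (fokkerPlanck γ) f) ∧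
    -- scattering operator
    (∀ b : Vec d → Vec d → ℝ, IsCollisionKernel γ β b → ∃ C : ℝ, 0 < C ∧
      ∀ f : Vec d × Vec d → ℝ, MemLp f 2 (weightedMeasure d γ k) →
        MemLp (f - proj γ η f) 2 (weightedMeasure d γ η) ∧
        Integrable (pairing (scattering γ b) f) (weightedMeasure d γ 0) ∧
        C * weightedNorm γ η (f - proj γ η f) ^ (2 * ((k + β) / (k - η))) *
            weightedNorm γ k f ^ (-2 * ((η + β) / (k - η))) ≤
          dissipation γ (scattering γ b) f) ∧
    -- fractional Fokker-Planck operator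
    (∀ (σ : ℝ) (E : Vec d → Vec d), 0 < σ → σ < 2 → β = σ - γ → IsFrictionForce γ σ E →
      ∃ C : ℝ, 0 < C ∧
      ∀ f : Vec d × Vec d → ℝ, MemLp f 2 (weightedMeasure d γ k) →
        MemLp (f - proj γ η f) 2 (weightedMeasure d γ η) ∧
        ((C * weightedNorm γ η (f - proj γ η f) ^ (2 * ((k + β) / (k - η))) *
            weightedNorm γ k f ^ (-2 * ((η + β) / (k - η))) : ℝ) : EReal) ≤
          extendedDissipation γ k (fracFokkerPlanck σ E) f) := by
  refine ⟨fun hβ => ?_, fun b hb => scattering_coercivity hd hγ hη hηγ hkγ hηk hb,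
    fun σ E h0 h2 hβ hE => ?_⟩
  · subst hβ
    obtain ⟨C, hC, h⟩ := fokkerPlanck_slice (d := d) hγ hk
    exact extendedDissipation_coercivity hγ hη hηγ hkγ hηk hC (classical_of_slices hγ h hC)
  · obtain ⟨C, hC, h⟩ := fracFokkerPlanck_slice hd hγ h0 h2 hk (by linarith) hE
    have hs : γ - σ = -β := by rw [hβ]; ring
    rw [hs] at h
    exact extendedDissipation_coercivity hγ hη hηγ hkγ hηk hC (classical_of_slices hγ h hC)
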